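/- For $A,B,C\in\mathbb{C}$ let $H_1$ be the hypergeometric equation $$y''+\Bigl(\frac{C}{z}+\frac{A+B-C+1}{z-1}\Bigr)y'+\frac{AB}{z(z-1)}\,y=0$$ on $\mathbb{P}^1_z$, and for $t\in\mathbb{C}\setminus\{0,1\}$ and $q,a,b,c,d\in\mathbb{C}$ let $H_2$ be Heun's equation $$Y''+\Bigl(\frac{c}{x}+\frac{d}{x-1}+\frac{a+b-c-d+1}{x-t}\Bigr)Y'+\frac{abx-q}{x(x-1)(x-t)}\,Y=0$$ on $\mathbb{P}^1_x$. Let $\varphi\in\mathbb{C}(x)$ be a non-constant rational function, viewed as a finite covering $\varphi:\mathbb{P}^1_x\to\mathbb{P}^1_z$, and let $\theta=\prod_i R_i^{\xi_i}$ be a radical function, i.e. a finite product of complex powers of non-zero rational functions. Suppose that the pull-back transformation $y(z)\mapsto Y(x)=\theta(x)\,y(\varphi(x))$ transforms $H_1$ into $H_2$, that is, it takes local solutions of $H_1$ near $\varphi(x_0)$ to local solutions of $H_2$ near $x_0$, for every $x_0\in\mathbb{C}$ at which $\varphi$, a branch of $\theta$ and the coefficients of $H_2$ are holomorphic and for which the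 coefficients of $H_1$ are holomorphic at $\varphi(x_0)$. Suppose also that there is a point $S\in\mathbb{P}^1_x$ at which $\varphi$ has branching index at least $2$ and whose image $\varphi(S)$ does not lie in $\{0,1,\infty\}$. Then at least one of the following holds: 1. $H_1$ has exactly $2$ relevant singular points on $\mathbb{P}^1_z$. Here a singular point is called irrelevant if it is a regular singularity which is not logarithmic and at which the local exponent difference is (up to sign) $1$, and relevant otherwise; a singular point with local parameter $\tau$ is logarithmic if there is only one local solution of the form $\tau^{\lambda}\bigl(1+\sum_{k\ge1}\alpha_k\tau^k\bigr)$ at it. 2. At two of the three points $z=0,1,\infty$, the local exponent difference of $H_1$ is, up to sign, equal to $1/2$. 3. $H_1$ has a basis of solutions that are algebraic functions, i.e. near every point $z_0\in\mathbb{C}\setminus\{0,1\}$ it has two linearly independent local solutions that are algebraic over $\mathbb{C}(z)$. -/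

import Mathlib

open Polynomial Filter Topology
open scoped OnePoint

noncomputable section

namespace HeunPullback

/-- The second order linear differential equation `y'' + p y' + q y = 0` on the projective line,
written in the affine coordinate. -/
structure LinODE where
  p : ℂ → ℂ
  q : ℂ → ℂ

namespace LinODE

/-- `y` satisfies the equation at the point `z`. -/
def HoldsAt (E : LinODE) (y : ℂ → ℂ) (z : ℂ) : Prop :=
  deriv (deriv y) z + E.p z * deriv y z + E.q z * y z = 0

/-- `y` is (the germ of) a holomorphic solution near `z₀`. -/
def IsLocalSolution (E : LinODE) (y : ℂ → ℂ) (z₀ : ℂ) : Prop :=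
  AnalyticAt ℂ y z₀ ∧ ∀ᶠ z in 𝓝 z₀, E.HoldsAt y z

/-- `s` is an ordinary (non-singular) point of the equation: in a local parameter at `s` the two
coefficients extend holomorphically to `s`. At infinity the parameter is `w = 1 / z`, in which the
equation reads `Y'' + (2 / w - p (1 / w) / w ^ 2) Y' + (q (1 / w) / w ^ 4) Y = 0`. -/
def IsOrdinaryPoint (E : LinODE) : OnePoint ℂ → Prop
  | OnePoint.some s => ∃ a b : ℂ → ℂ, AnalyticAt ℂ a s ∧ AnalyticAt ℂ b s ∧
      ∀ᶠ z in 𝓝[≠] s, E.p z = a z ∧ E.q z = b z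
  | ∞ => ∃ a b : ℂ → ℂ, AnalyticAt ℂ a 0 ∧ AnalyticAt ℂ b 0 ∧
      ∀ᶠ w in 𝓝[≠] (0 : ℂ), 2 / w - E.p w⁻¹ / w ^ 2 = a w ∧ E.q w⁻¹ / w ^ 4 = b w

/-- `s` is an ordinary point or a regular singularity, with local exponents `e₁, e₂`: the roots,
with multiplicity, of the indicial polynomial, which is `X (X - 1) + p₀ X + q₀` with
`p₀ = lim (z - s) p`, `q₀ = lim (z - s) ^ 2 q` at a finite point, and
`X (X + 1) - p₀ X + q₀` with `p₀ = lim z p`, `q₀ = lim z ^ 2 q` at infinity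
(an exponent `e` at infinity belongs to solutions that start with `z ^ (-e)`). -/
def HasLocalExponents (E : LinODE) : OnePoint ℂ → ℂ → ℂ → Prop
  | OnePoint.some s, e₁, e₂ => ∃ p₀ q₀ : ℂ,
      Tendsto (fun z => (z - s) * E.p z) (𝓝[≠] s) (𝓝 p₀) ∧
      Tendsto (fun z => (z - s) ^ 2 * E.q z) (𝓝[≠] s) (𝓝 q₀) ∧
      (X * (X - 1) + C p₀ * X + C q₀ : ℂ[X]) = (X - C e₁) * (X - C e₂)
  | ∞, e₁, e₂ => ∃ p₀ q₀ : ℂ,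
      Tendsto (fun z => z * E.p z) (Bornology.cobounded ℂ) (𝓝 p₀) ∧
      Tendsto (fun z => z ^ 2 * E.q z) (Bornology.cobounded ℂ) (𝓝 q₀) ∧
      (X * (X + 1) - C p₀ * X + C q₀ : ℂ[X]) = (X - C e₁) * (X - C e₂)

/-- The local exponent difference at `s` is `δ`. As `e₁` and `e₂` may be interchanged,
it is determined up to sign. -/
def HasExponentDifference (E : LinODE) (s : OnePoint ℂ) (δ : ℂ) : Prop :=
  ∃ e₁ e₂ : ℂ, E.HasLocalExponents s e₁ e₂ ∧ e₁ - e₂ = δ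

/-- The local parameter at a point of the projective line, as a function of `z`. -/
def localParam : OnePoint ℂ → ℂ → ℂ
  | OnePoint.some s, z => z - s
  | ∞, z => z⁻¹

/-- With `τ` the local parameter at `s`, the function `τ ^ μ * h τ`, where `h` is holomorphic at `0`
with `h 0 = 1`, is a solution near `s`. The power is multivalued; the equation is imposed
on its principal branch, that is near `s` off the cut where `τ` is a non-positive real, and so holds
for every branch. -/
def IsFrobeniusSolution (E : LinODE) (s : OnePoint ℂ) (μ : ℂ) (h : ℂ → ℂ) : Prop :=
  AnalyticAt ℂ h 0 ∧ h 0 = 1 ∧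
    ∀ᶠ z in comap (localParam s) (𝓝[Complex.slitPlane] 0),
      E.HoldsAt (fun z => localParam s z ^ μ * h (localParam s z)) z

/-- There is more than one local solution of the form `τ ^ μ * (1 + ∑ αₖ τ ^ k)` at `s`. A singular
point is logarithmic if this fails. -/
def IsNonlogarithmic (E : LinODE) (s : OnePoint ℂ) : Prop :=
  ∃ (μ₁ μ₂ : ℂ) (h₁ h₂ : ℂ → ℂ),
    E.IsFrobeniusSolution s μ₁ h₁ ∧ E.IsFrobeniusSolution s μ₂ h₂ ∧
      ¬ (μ₁ = μ₂ ∧ h₁ =ᶠ[𝓝 0] h₂)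

/-- A regular singularity that is not logarithmic and has exponent difference `1`. -/
def IsIrrelevantSingularity (E : LinODE) (s : OnePoint ℂ) : Prop :=
  ¬ E.IsOrdinaryPoint s ∧ E.IsNonlogarithmic s ∧ E.HasExponentDifference s 1

/-- A singular point that is not an irrelevant singularity. -/
def IsRelevantSingularity (E : LinODE) (s : OnePoint ℂ) : Prop :=
  ¬ E.IsOrdinaryPoint s ∧ ¬ E.IsIrrelevantSingularity s

/-- The germ of `y` at `z₀` is algebraic over `ℂ(z)`. -/
def IsAlgebraicGerm (y : ℂ → ℂ) (z₀ : ℂ) : Prop :=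
  ∃ F : ℂ[X][X], F ≠ 0 ∧ ∀ᶠ z in 𝓝 z₀, F.evalEval z (y z) = 0

/-- Near `z₀` the equation has two linearly independent solutions that are algebraic functions. -/
def HasAlgebraicBasisAt (E : LinODE) (z₀ : ℂ) : Prop :=
  ∃ y₁ y₂ : ℂ → ℂ, E.IsLocalSolution y₁ z₀ ∧ E.IsLocalSolution y₂ z₀ ∧
    (∀ c₁ c₂ : ℂ, (∀ᶠ z in 𝓝 z₀, c₁ * y₁ z + c₂ * y₂ z = 0) → c₁ = 0 ∧ c₂ = 0) ∧
    IsAlgebraicGerm y₁ z₀ ∧ IsAlgebraicGerm y₂ z₀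

end LinODE

/-- The hypergeometric equation. -/
def hypergeometricEq (A B C : ℂ) : LinODE where
  p z := C / z + (A + B - C + 1) / (z - 1)
  q z := A * B / (z * (z - 1))

/-- Heun's equation, with accessory parameter `q`. -/
def heunEq (t q a b c d : ℂ) : LinODE where
  p x := c / x + d / (x - 1) + (a + b - c - d + 1) / (x - t)
  q x := (a * b * x - q) / (x * (x - 1) * (x - t))

/-- The value of a rational function at a point of `ℂ` (meaningful where it has no pole). -/
def ratEval (φ : RatFunc ℂ) (x : ℂ) : ℂ := φ.eval (RingHom.id ℂ) x

/-- A radical function: a formal product `∏ i, (base i) ^ (expo i)` of complex powers of non-zero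
rational functions. -/
structure RadicalFunction where
  n : ℕ
  base : Fin n → RatFunc ℂ
  expo : Fin n → ℂ
  base_ne_zero : ∀ i, base i ≠ 0

/-- `θ` is a holomorphic branch near `x₀` of the radical function, given by
holomorphic logarithms of its factors (so `x₀` is not a zero or a pole of a factor). -/
def RadicalFunction.IsBranchAt (R : RadicalFunction) (θ : ℂ → ℂ) (x₀ : ℂ) : Prop :=
  ∃ L : Fin R.n → ℂ → ℂ,
    (∀ i, AnalyticAt ℂ (L i) x₀ ∧ ∀ᶠ x in 𝓝 x₀, Complex.exp (L i x) = ratEval (R.base i) x) ∧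
    ∀ᶠ x in 𝓝 x₀, θ x = Complex.exp (∑ i, R.expo i * L i x)

/-- The substitution `y(z) ↦ Y(x) = θ(x) y(φ(x))` transforms the equation `E₁` into `E₂`: wherever
everything is regular, it takes the local solutions of `E₁` near `φ(x₀)` to
local solutions of `E₂` near `x₀`. -/
def IsPullbackTransformation (E₁ E₂ : LinODE) (φ : RatFunc ℂ) (R : RadicalFunction) : Prop :=
  ∀ x₀ : ℂ, φ.denom.eval x₀ ≠ 0 →
    AnalyticAt ℂ E₁.p (ratEval φ x₀) → AnalyticAt ℂ E₁.q (ratEval φ x₀) →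
    AnalyticAt ℂ E₂.p x₀ → AnalyticAt ℂ E₂.q x₀ →
    ∀ θ : ℂ → ℂ, R.IsBranchAt θ x₀ →
      ∀ y : ℂ → ℂ, E₁.IsLocalSolution y (ratEval φ x₀) →
        E₂.IsLocalSolution (fun x => θ x * y (ratEval φ x)) x₀

/-- The map of projective lines given by a rational function. Its denominator is normalized to be
monic. -/
def projMap (φ : RatFunc ℂ) : OnePoint ℂ → OnePoint ℂ
  | OnePoint.some x => if φ.denom.eval x = 0 then ∞ else (ratEval φ x : OnePoint ℂ)
  | ∞ => if φ.denom.natDegree < φ.num.natDegree then ∞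
      else (φ.num.coeff φ.denom.natDegree : OnePoint ℂ)

/-- The degree of the covering given by a rational function. -/
def covDegree (φ : RatFunc ℂ) : ℕ := max φ.num.natDegree φ.denom.natDegree

/-- The polynomial whose zeros are the finite points of the fibre over `w`. -/
def fibrePoly (φ : RatFunc ℂ) : OnePoint ℂ → ℂ[X]
  | OnePoint.some w => φ.num - C w * φ.denom
  | ∞ => φ.denom

/-- The branching index at `S`: the multiplicity of `S` in its fibre, a divisor
of degree `covDegree φ`. -/
def branchingIndex (φ : RatFunc ℂ) : OnePoint ℂ → ℕ
  | OnePoint.some x => (fibrePoly φ (projMap φ x)).rootMultiplicity x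
  | ∞ => covDegree φ - (fibrePoly φ (projMap φ ∞)).natDegree

/-- The three singular points of the hypergeometric equation. -/
def sing : Set (OnePoint ℂ) := {((0 : ℂ) : OnePoint ℂ), ((1 : ℂ) : OnePoint ℂ), ∞}

end HeunPullback

end

open HeunPullback

/-! The invariant `2q - p' - p²/2` of `y'' + p y' + q y = 0` does not change under `y ↦ θ y`. Under
`z = φ(x)` it is multiplied by `φ'²` and gains the Schwarzian of `φ`. So the hypothesis becomes an
identity between rational functions in which `θ` no longer occurs: the pull-back along `φ` of the
hypergeometric invariant, which depends only on `δ₀², δ₁², δ_∞²`, is Heun's invariant, and that has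
no finite poles outside `{0, 1, t}` (`schwarzRegular_of_pullback`). Write `φ = f/g` and take `F₀ =
f`, `F₁ = g - f`, `F₂ = -g`. These sum to zero, and their zeros are the finite points of the fibres
over `0, 1, ∞`.

Local expansion of the identity yields two facts. A point of multiplicity `k` over a singular point
with difference `δ`, at which the pull-back has no pole, satisfies `k²δ² = 1`; if `k = 1`, the
squares of the other two differences also agree (`exponent_of_root`). A branching point over an
ordinary point always gives a pole (`not_regular_of_branching`).

So `S` uses up one of the four possible singular points `0, 1, t, ∞` of Heun's equation. Let `D =
deg φ`. By Riemann–Hurwitz the three fibres contain at least `D + 3` points in all, because of the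
extra branching at `S`. At most three of them are singular, so at least `D` are regular
(`natDegree_le_add_card_roots`). In each fibre the regular points share one multiplicity `kᵢ`. If
some `kᵢ = 1`, the equation is degenerate. If two of them are `2`, two differences are `±1/2`.
Otherwise `∑ 1/kᵢ > 1`, and the `kᵢ` are `2, 3, m` with `m = 3, 4, 5` in some order
(`polyhedral_of_branching`).

In the degenerate case the singularity with difference `±1` is irrelevant or absent, and the
equation is elementary: the quotient of two solutions is a power or a logarithm. A non-zero rational
exponent gives an algebraic basis; otherwise the other two singular points are relevant
(`twoRelevantOrAlgebraic_zero` and its analogues). In the polyhedral case Klein's construction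
applies: the quotient map of the tetrahedral, octahedral or icosahedral group pulls the invariant
back to zero, so its local inverse is a quotient of two solutions, both algebraic
(`IsKleinianCovering.hasAlgebraicBasisAt`). -/

namespace HeunPullback

/-! ### The Schwarzian polynomial and its local analysis -/

/-- With `φ = -F₀ / F₂` and `F₀ + F₁ + F₂ = 0`, this is `2 W² (F₀ F₁ F₂)²` times the pull-back along
`φ` of the projective normal form with local parameters `aᵢ = 1 - δᵢ²`, where `W` is
the Wronskian of `F₀` and `F₁`. -/
noncomputable def schwarzPoly (a₀ a₁ a₂ : ℂ) (F₀ F₁ F₂ : ℂ[X]) : ℂ[X] :=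
  (2 * wronskian F₀ F₁ * derivative (derivative (wronskian F₀ F₁))
      - 3 * derivative (wronskian F₀ F₁) ^ 2
      + 4 * wronskian (derivative F₀) (derivative F₁) * wronskian F₀ F₁) * (F₀ * F₁ * F₂) ^ 2
    - wronskian F₀ F₁ ^ 4 * (C a₀ * F₁ * F₂ + C a₁ * F₀ * F₂ + C a₂ * F₀ * F₁)

/-- Away from `P`, the quotient of `schwarzPoly` by `W² (F₀ F₁ F₂)²` has no pole. -/
def SchwarzRegular (P : Set ℂ) (a₀ a₁ a₂ : ℂ) (F₀ F₁ F₂ : ℂ[X]) : Prop :=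
  ∀ x₀ ∉ P, ∀ k : ℕ, (X - C x₀) ^ k ∣ wronskian F₀ F₁ ^ 2 * (F₀ * F₁ * F₂) ^ 2 →
    (X - C x₀) ^ k ∣ schwarzPoly a₀ a₁ a₂ F₀ F₁ F₂

lemma schwarzPoly_swap {a₀ a₁ a₂ : ℂ} {F₀ F₁ F₂ : ℂ[X]} :
    schwarzPoly a₁ a₀ a₂ F₁ F₀ F₂ = schwarzPoly a₀ a₁ a₂ F₀ F₁ F₂ := by
  have h : wronskian F₁ F₀ = - wronskian F₀ F₁ := (wronskian_neg_eq _ _).symm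
  have h' : wronskian (derivative F₁) (derivative F₀)
    = - wronskian (derivative F₀) (derivative F₁) := (wronskian_neg_eq _ _).symm
  simp only [schwarzPoly, h, h', derivative_neg]
  ring

/-- The relation `F₀ + F₁ + F₂ = 0` makes the Wronskians of cyclically consecutive `Fᵢ` equal, and
likewise those of their derivatives. The three fibres therefore play symmetric roles, and local
analysis at zeros of `F₀` suffices. -/
lemma schwarzPoly_rotate {a₀ a₁ a₂ : ℂ} {F₀ F₁ F₂ : ℂ[X]} (h : F₀ + F₁ + F₂ = 0) :
    schwarzPoly a₁ a₂ a₀ F₁ F₂ F₀ = schwarzPoly a₀ a₁ a₂ F₀ F₁ F₂ := by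
  have hd : derivative F₀ + derivative F₁ + derivative F₂ = 0 := by
    simpa using congrArg derivative h
  simp only [schwarzPoly, ← wronskian_eq_of_sum_zero h, ← wronskian_eq_of_sum_zero hd]
  ring

lemma SchwarzRegular.rotate {P : Set ℂ} {a₀ a₁ a₂ : ℂ} {F₀ F₁ F₂ : ℂ[X]}
    (hs : F₀ + F₁ + F₂ = 0)
    (h : SchwarzRegular P a₀ a₁ a₂ F₀ F₁ F₂) : SchwarzRegular P a₁ a₂ a₀ F₁ F₂ F₀ := by
  intro x hx k hk
  rw [schwarzPoly_rotate hs]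
  refine h x hx k ?_
  rw [wronskian_eq_of_sum_zero hs]
  convert hk using 1
  ring

/-- The operator `(X - x₀) d/dX` preserves the power `(X - x₀) ^ m`, which avoids a separate
treatment of the exponent `m - 1` when `m = 0`. -/
lemma X_sub_C_mul_derivative_pow_mul (x₀ : ℂ) (m : ℕ) (w : ℂ[X]) :
    (X - C x₀) * derivative ((X - C x₀) ^ m * w)
      = (X - C x₀) ^ m * ((m : ℂ[X]) * w + (X - C x₀) * derivative w) := by
  cases m with
  | zero => simp
  | succ n =>
    simp only [derivative_mul, derivative_pow, derivative_sub, derivative_X, derivative_C]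
    simp
    ring

lemma X_sub_C_sq_mul_derivative_derivative (x₀ : ℂ) (m : ℕ) (w : ℂ[X]) :
    (X - C x₀) ^ 2 * derivative (derivative ((X - C x₀) ^ m * w))
      = (X - C x₀) ^ m * ((m : ℂ[X]) * ((m : ℂ[X]) - 1) * w + 2 * (m : ℂ[X]) * (X - C x₀) * derivative w
        + (X - C x₀) ^ 2 * derivative (derivative w)) := by
  have h1 := X_sub_C_mul_derivative_pow_mul x₀ m w
  have h2 := X_sub_C_mul_derivative_pow_mul x₀ m ((m : ℂ[X]) * w + (X - C x₀) * derivative w)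
  rw [← h1] at h2
  rw [derivative_mul] at h2
  simp only [derivative_sub, derivative_X, derivative_C] at h2
  rw [derivative_add, derivative_mul (f := (m : ℂ[X])), derivative_mul (f := X - C x₀)] at h2
  simp only [derivative_sub, derivative_X, derivative_C, derivative_natCast] at h2
  linear_combination h2 - h1

lemma X_sub_C_sq_mul_schwarzian {x₀ : ℂ} {m : ℕ} {W V w v : ℂ[X]} (hW : W = (X - C x₀) ^ m * w)
    (hV : (X - C x₀) * V = (X - C x₀) ^ m * v) :
    (X - C x₀) ^ 2 * (2 * W * derivative (derivative W) - 3 * derivative W ^ 2 + 4 * V * W) =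
      (X - C x₀) ^ (2 * m) * (2 * w * ((m : ℂ[X]) * ((m : ℂ[X]) - 1) * w + 2 * (m : ℂ[X]) * (X - C x₀) * derivative w
        + (X - C x₀) ^ 2 * derivative (derivative w))
        - 3 * ((m : ℂ[X]) * w + (X - C x₀) * derivative w) ^ 2 + 4 * (X - C x₀) * v * w) := by
  have h1 := X_sub_C_mul_derivative_pow_mul x₀ m w
  have h2 := X_sub_C_sq_mul_derivative_derivative x₀ m w
  rw [← hW] at h1 h2
  calc _ = 2 * W * ((X - C x₀) ^ 2 * derivative (derivative W))
        - 3 * ((X - C x₀) * derivative W) ^ 2 + 4 * (X - C x₀) * ((X - C x₀) * V) * W := by ring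
    _ = _ := by rw [h1, h2, hV, hW]; ring

/-- At a zero of order `m + 1` of `F₀` where the pull-back has no pole, the local exponent difference
is `±1`. -/
lemma exponent_of_root {P : Set ℂ} {a₀ a₁ a₂ : ℂ} {F₀ F₁ F₂ : ℂ[X]} (hs : F₀ + F₁ + F₂ = 0)
    (hreg : SchwarzRegular P a₀ a₁ a₂ F₀ F₁ F₂) {x₀ : ℂ} (hx₀ : x₀ ∉ P) {m : ℕ} {u : ℂ[X]}
    (hF₀ : F₀ = (X - C x₀) ^ (m + 1) * u) (hu : u.eval x₀ ≠ 0) (h1 : F₁.eval x₀ ≠ 0) :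
    ((m : ℂ) + 1) ^ 2 * (1 - a₀) = 1 ∧ (m = 0 → a₁ = a₂) := by
  set T : ℂ[X] := X - C x₀ with hT
  have hT0 : T ≠ 0 := X_sub_C_ne_zero x₀
  have hTe : T.eval x₀ = 0 := by simp [hT]
  have hF₂ : F₂ = -F₀ - F₁ := by linear_combination hs
  set w : ℂ[X] := T * u * derivative F₁ - (((m + 1 : ℕ) : ℂ[X]) * u + T * derivative u) * F₁ with hw
  set v : ℂ[X] := T * ((((m + 1 : ℕ) : ℂ[X]) * u + T * derivative u)) * derivative (derivative F₁)
    - (((m + 1 : ℕ) : ℂ[X]) * (((m + 1 : ℕ) : ℂ[X]) - 1) * u + 2 * ((m + 1 : ℕ) : ℂ[X]) * T * derivative u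
      + T ^ 2 * derivative (derivative u)) * derivative F₁ with hv
  have hd1 := X_sub_C_mul_derivative_pow_mul x₀ (m + 1) u
  have hd2 := X_sub_C_sq_mul_derivative_derivative x₀ (m + 1) u
  rw [← hT, ← hF₀] at hd1 hd2
  have hW : wronskian F₀ F₁ = T ^ m * w := by
    apply mul_left_cancel₀ hT0
    rw [wronskian, mul_sub, ← mul_assoc T (derivative F₀), hd1, hF₀, hw]
    ring
  have hV : T * wronskian (derivative F₀) (derivative F₁) = T ^ m * v := by
    apply mul_left_cancel₀ hT0
    have : T * (T * wronskian (derivative F₀) (derivative F₁)) =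
      T * ((T * derivative F₀) * derivative (derivative F₁))
        - (T ^ 2 * derivative (derivative F₀)) * derivative F₁ := by
      rw [wronskian]; ring
    rw [this, hd1, hd2, hv]
    ring
  set N : ℂ[X] := 2 * w * ((m : ℂ[X]) * ((m : ℂ[X]) - 1) * w + 2 * (m : ℂ[X]) * T * derivative w
        + T ^ 2 * derivative (derivative w))
        - 3 * ((m : ℂ[X]) * w + T * derivative w) ^ 2 + 4 * T * v * w with hN
  have hloc := X_sub_C_sq_mul_schwarzian hW hV
  rw [← hT, ← hN] at hloc
  set Z : ℂ[X] := N * (u * F₁ * F₂) ^ 2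
    - w ^ 4 * (C a₀ * F₁ * F₂ + T ^ (m + 1) * (C a₁ * u * F₂ + C a₂ * u * F₁)) with hZ
  have hsch : schwarzPoly a₀ a₁ a₂ F₀ F₁ F₂ = T ^ (4 * m) * Z := by
    apply mul_left_cancel₀ (pow_ne_zero 2 hT0)
    rw [schwarzPoly, mul_sub, ← mul_assoc, hloc, hW, hZ]
    simp only [hF₀]
    ring
  -- The denominator vanishes to order `4m + 2`: `2m` from `W²` and `2m + 2` from `F₀²`. Since
  -- `schwarzPoly = T ^ (4m) * Z`, regularity amounts to `T² ∣ Z`: the double and the simple pole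
  -- both cancel.
  have hdvd : T ^ (4 * m + 2) ∣ wronskian F₀ F₁ ^ 2 * (F₀ * F₁ * F₂) ^ 2 := by
    refine ⟨w ^ 2 * (u * F₁ * F₂) ^ 2, ?_⟩
    rw [hW, hF₀]
    ring
  have hdvd2 := hreg x₀ hx₀ _ hdvd
  rw [← hT, hsch, pow_add, mul_dvd_mul_iff_left (pow_ne_zero _ hT0)] at hdvd2
  have hF₀e : F₀.eval x₀ = 0 := by simp [hF₀, hTe]
  have hF₂e : F₂.eval x₀ = - F₁.eval x₀ := by simp [hF₂, hF₀e]
  have hwe : w.eval x₀ = - (((m + 1 : ℕ) : ℂ) * u.eval x₀ * F₁.eval x₀) := by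
    simp [hw, hTe]
  have hm1 : ((m + 1 : ℕ) : ℂ) ≠ 0 := by exact_mod_cast Nat.succ_ne_zero m
  have key : ((m : ℂ) + 1) ^ 2 * (1 - a₀) = 1 := by
    have hZe : Z.eval x₀ = 0 := by
      obtain ⟨r, hr⟩ := (pow_dvd_pow T (by norm_num : 1 ≤ 2)).trans hdvd2
      simp [hr, hTe]
    simp only [hZ, hN, eval_sub, eval_add, eval_mul, eval_pow, hTe, hwe, hF₂e, eval_natCast,
      eval_ofNat, eval_one, eval_C] at hZe
    push_cast at hZe hm1
    -- The Schwarzian contributes `2m(m - 1) - 3m² = 1 - (m + 1)²` and the hypergeometric invariant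
    -- contributes `(m + 1)² a₀`; the remaining factors are units at `x₀`.
    have h0 : ((m : ℂ) + 1) ^ 2 * (u.eval x₀) ^ 4 * (F₁.eval x₀) ^ 6 ≠ 0 := by positivity
    apply mul_left_cancel₀ h0
    linear_combination -hZe
  refine ⟨key, ?_⟩
  rintro rfl
  have ha₀ : a₀ = 0 := by
    simp at key; exact key
  -- With `m = 0` and `a₀ = 0` the double pole is gone. The simple pole has coefficient proportional
  -- to `a₁ - a₂`, because `F₂ = -F₁` at `x₀`.
  have hZ1 : Z = T * (T * (2 * w * derivative (derivative w) - 3 * derivative w ^ 2)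
      * (u * F₁ * F₂) ^ 2 + 4 * v * w * (u * F₁ * F₂) ^ 2
      - w ^ 4 * (C a₁ * u * F₂ + C a₂ * u * F₁)) := by
    rw [hZ, hN, ha₀]
    simp
    ring
  rw [hZ1, pow_two, mul_dvd_mul_iff_left hT0] at hdvd2
  obtain ⟨r, hr⟩ := hdvd2
  have hv0 : v.eval x₀ = 0 := by simp [hv, hTe]
  have he := congrArg (eval x₀) hr
  simp only [eval_sub, eval_add, eval_mul, eval_pow, hTe, hwe, hF₂e, eval_ofNat,
    eval_C, hv0] at he
  push_cast at he
  have h0 : (u.eval x₀) ^ 5 * (F₁.eval x₀) ^ 5 ≠ 0 := by positivity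
  apply mul_left_cancel₀ h0
  linear_combination he

/-- At a point where the Wronskian vanishes and the `Fᵢ` do not, the pull-back has a pole. -/
lemma not_regular_of_branching {P : Set ℂ} {a₀ a₁ a₂ : ℂ} {F₀ F₁ F₂ G : ℂ[X]}
    (hreg : SchwarzRegular P a₀ a₁ a₂ F₀ F₁ F₂) {x₀ : ℂ} (hx₀ : x₀ ∉ P) {m : ℕ} {u : ℂ[X]} {k : ℂ}
    (hG : G = (X - C x₀) ^ (m + 1) * u) (hu : u.eval x₀ ≠ 0) (hGF : G = F₀ - C k * F₁)
    (h0 : F₀.eval x₀ ≠ 0) (h1 : F₁.eval x₀ ≠ 0) (h2 : F₂.eval x₀ ≠ 0) : m = 0 := by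
  set T : ℂ[X] := X - C x₀ with hT
  have hT0 : T ≠ 0 := X_sub_C_ne_zero x₀
  have hTe : T.eval x₀ = 0 := by simp [hT]
  set w : ℂ[X] := T * u * derivative F₁ - (((m + 1 : ℕ) : ℂ[X]) * u + T * derivative u) * F₁ with hw
  set v : ℂ[X] := T * ((((m + 1 : ℕ) : ℂ[X]) * u + T * derivative u)) * derivative (derivative F₁)
    - (((m + 1 : ℕ) : ℂ[X]) * (((m + 1 : ℕ) : ℂ[X]) - 1) * u + 2 * ((m + 1 : ℕ) : ℂ[X]) * T * derivative u
      + T ^ 2 * derivative (derivative u)) * derivative F₁ with hv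
  have hd1 := X_sub_C_mul_derivative_pow_mul x₀ (m + 1) u
  have hd2 := X_sub_C_sq_mul_derivative_derivative x₀ (m + 1) u
  rw [← hT, ← hG] at hd1 hd2
  have hGW : wronskian F₀ F₁ = wronskian G F₁ := by
    simp only [hGF, wronskian, derivative_sub, derivative_mul, derivative_C]
    ring
  have hGV : wronskian (derivative F₀) (derivative F₁)
      = wronskian (derivative G) (derivative F₁) := by
    simp only [hGF, wronskian, derivative_sub, derivative_mul, derivative_C, derivative_add]
    simp
    ring
  have hW : wronskian F₀ F₁ = T ^ m * w := by
    apply mul_left_cancel₀ hT0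
    rw [hGW, wronskian, mul_sub, ← mul_assoc T (derivative G), hd1, hG, hw]
    ring
  have hV : T * wronskian (derivative F₀) (derivative F₁) = T ^ m * v := by
    apply mul_left_cancel₀ hT0
    have : T * (T * wronskian (derivative F₀) (derivative F₁)) =
      T * ((T * derivative G) * derivative (derivative F₁))
        - (T ^ 2 * derivative (derivative G)) * derivative F₁ := by
      rw [hGV, wronskian]; ring
    rw [this, hd1, hd2, hv]
    ring
  set N : ℂ[X] := 2 * w * ((m : ℂ[X]) * ((m : ℂ[X]) - 1) * w + 2 * (m : ℂ[X]) * T * derivative w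
        + T ^ 2 * derivative (derivative w))
        - 3 * ((m : ℂ[X]) * w + T * derivative w) ^ 2 + 4 * T * v * w with hN
  have hloc := X_sub_C_sq_mul_schwarzian hW hV
  rw [← hT, ← hN] at hloc
  have hsch : T ^ 2 * schwarzPoly a₀ a₁ a₂ F₀ F₁ F₂ = T ^ (2 * m) * (N * (F₀ * F₁ * F₂) ^ 2
      - T ^ (2 * m + 2) * w ^ 4 * (C a₀ * F₁ * F₂ + C a₁ * F₀ * F₂ + C a₂ * F₀ * F₁)) := by
    rw [schwarzPoly, mul_sub, ← mul_assoc, hloc, hW]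
    ring
  have hdvd : T ^ (2 * m) ∣ wronskian F₀ F₁ ^ 2 * (F₀ * F₁ * F₂) ^ 2 := by
    refine ⟨w ^ 2 * (F₀ * F₁ * F₂) ^ 2, ?_⟩
    rw [hW]
    ring
  obtain ⟨r, hr⟩ := hreg x₀ hx₀ _ hdvd
  rw [← hT] at hr
  have hr2 : T ^ 2 * r = N * (F₀ * F₁ * F₂) ^ 2
      - T ^ (2 * m + 2) * w ^ 4 * (C a₀ * F₁ * F₂ + C a₁ * F₀ * F₂ + C a₂ * F₀ * F₁) := by
    apply mul_left_cancel₀ (pow_ne_zero (2 * m) hT0)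
    rw [← hsch, hr]
    ring
  have he := congrArg (eval x₀) hr2
  have hwe : w.eval x₀ = - (((m + 1 : ℕ) : ℂ) * u.eval x₀ * F₁.eval x₀) := by
    simp [hw, hTe]
  have hm1 : ((m + 1 : ℕ) : ℂ) ≠ 0 := by exact_mod_cast Nat.succ_ne_zero m
  simp only [hN, eval_sub, eval_add, eval_mul, eval_pow, hTe, hwe, eval_natCast,
      eval_ofNat, eval_one, eval_C, zero_pow (Nat.succ_ne_zero _)] at he
  have hm2 : ((m + 2 : ℕ) : ℂ) ≠ 0 := by exact_mod_cast Nat.succ_ne_zero (m + 1)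
  push_cast at he hm1 hm2
  -- The Schwarzian alone has leading coefficient `2m(m - 1) - 3m² = -m(m + 2)`, and the
  -- hypergeometric term is holomorphic here; so only `m = 0` avoids a pole.
  have hne : ((m : ℂ) + 2) * (((m : ℂ) + 1) * u.eval x₀ * F₁.eval x₀
      * (F₀.eval x₀ * F₁.eval x₀ * F₂.eval x₀)) ^ 2 ≠ 0 := by positivity
  have : (m : ℂ) = 0 := by
    apply mul_left_cancel₀ hne
    linear_combination he
  exact_mod_cast this

/-! ### Riemann–Hurwitz counting and spherical triples -/

section Counting

-- The Mason–Stothers argument, a polynomial form of Riemann–Hurwitz. A root of multiplicity `k` of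
-- the product is a root of multiplicity at least `k - 1` of the Wronskian, so the product divided
-- by its radical divides the Wronskian. A factor `Q` coprime to the product records additional
-- branching away from the three fibres.
open UniqueFactorizationMonoid EuclideanDomain in
lemma natDegree_le_add_card_roots {F₀ F₁ F₂ Q : ℂ[X]} (hs : F₀ + F₁ + F₂ = 0)
    (hc : IsCoprime F₀ F₁) (hW : wronskian F₀ F₁ ≠ 0) (hF : F₀ * F₁ * F₂ ≠ 0)
    (hQ : Q ∣ wronskian F₀ F₁) (hQc : IsCoprime Q (F₀ * F₁ * F₂)) :
    (F₀ * F₁ * F₂).natDegree + Q.natDegree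
      ≤ (wronskian F₀ F₁).natDegree + (F₀ * F₁ * F₂).roots.toFinset.card := by
  classical
  have hF₂ : F₂ = -F₀ - F₁ := by linear_combination hs
  have h02 : IsCoprime F₀ F₂ := by
    obtain ⟨u, v, h⟩ := hc
    exact ⟨u - v, -v, by rw [hF₂]; linear_combination h⟩
  have h12 : IsCoprime F₁ F₂ := by
    obtain ⟨u, v, h⟩ := hc
    exact ⟨v - u, -u, by rw [hF₂]; linear_combination h⟩
  set P := F₀ * F₁ * F₂ with hP
  have hdr : divRadical P ∣ wronskian F₀ F₁ := by
    rw [hP, divRadical_mul (IsCoprime.mul_left h02 h12), divRadical_mul hc]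
    refine IsCoprime.mul_dvd ?_ (IsCoprime.mul_dvd hc.divRadical ?_ ?_) ?_
    · exact IsCoprime.mul_left h02.divRadical h12.divRadical
    · exact divRadical_dvd_wronskian_left _ _
    · exact divRadical_dvd_wronskian_right _ _
    · rw [wronskian_eq_of_sum_zero hs]
      exact divRadical_dvd_wronskian_right _ _
  have hQd : Q * divRadical P ∣ wronskian F₀ F₁ :=
    (hQc.of_isCoprime_of_dvd_right (divRadical_dvd_self P)).mul_dvd hQ hdr
  have hQ0 : Q ≠ 0 := fun h => hW (by simpa [h] using hQ)
  have hle := natDegree_le_of_dvd hQd hW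
  rw [natDegree_mul hQ0 (divRadical_ne_zero hF)] at hle
  have hdeg : P.natDegree = (radical P).natDegree + (divRadical P).natDegree := by
    conv_lhs => rw [← radical_mul_divRadical (a := P)]
    exact natDegree_mul radical_ne_zero (divRadical_ne_zero hF)
  have hrad : (radical P).natDegree ≤ P.roots.toFinset.card := by
    have hnd : (radical P).roots.Nodup :=
      nodup_roots (PerfectField.separable_iff_squarefree.2 squarefree_radical)
    rw [(IsAlgClosed.splits (radical P)).natDegree_eq_card_roots,
      ← Multiset.toFinset_card_of_nodup hnd]
    refine Finset.card_le_card fun x hx => ?_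
    simp only [Multiset.mem_toFinset] at hx ⊢
    exact Multiset.mem_of_le (roots.le_of_dvd hF radical_dvd_self) hx
  omega

/-- If all roots outside `P` have multiplicities `k` with `k ^ 2 * c = 1`, they have the same
multiplicity. -/
lemma card_roots_mul_add_le {F : ℂ[X]} (hF : F ≠ 0) (P : Finset ℂ) (c : ℂ)
    (h : ∀ x, F.IsRoot x → x ∉ P → (F.rootMultiplicity x : ℂ) ^ 2 * c = 1) :
    (F.roots.toFinset \ P).card = 0 ∨ ∃ x ∉ P, F.IsRoot x ∧
      (F.roots.toFinset \ P).card * F.rootMultiplicity x + (F.roots.toFinset ∩ P).card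
        ≤ F.natDegree := by
  classical
  rcases Finset.eq_empty_or_nonempty (F.roots.toFinset \ P) with h0 | ⟨x, hx⟩
  · left; simp [h0]
  right
  simp only [Finset.mem_sdiff, Multiset.mem_toFinset, mem_roots hF] at hx
  refine ⟨x, hx.2, hx.1, ?_⟩
  have hk : ∀ y ∈ F.roots.toFinset \ P, F.rootMultiplicity y = F.rootMultiplicity x := by
    intro y hy
    simp only [Finset.mem_sdiff, Multiset.mem_toFinset, mem_roots hF] at hy
    have h1 := h x hx.1 hx.2
    have h2 := h y hy.1 hy.2
    have hc : c ≠ 0 := by rintro rfl; simp at h1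
    have h3 : (F.rootMultiplicity y : ℂ) ^ 2 = (F.rootMultiplicity x : ℂ) ^ 2 :=
      mul_right_cancel₀ hc (h2.trans h1.symm)
    have h4 : F.rootMultiplicity y ^ 2 = F.rootMultiplicity x ^ 2 := by exact_mod_cast h3
    exact Nat.pow_left_injective (n := 2) (by norm_num) h4
  calc _ ≤ ∑ y ∈ F.roots.toFinset \ P, F.rootMultiplicity y
        + ∑ y ∈ F.roots.toFinset ∩ P, F.rootMultiplicity y := by
        refine add_le_add ?_ ?_
        · rw [Finset.sum_congr rfl hk, Finset.sum_const, smul_eq_mul]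
        · rw [Finset.card_eq_sum_ones]
          refine Finset.sum_le_sum fun y hy => ?_
          simp only [Finset.mem_inter, Multiset.mem_toFinset, mem_roots hF] at hy
          exact (rootMultiplicity_pos hF).2 hy.1
    _ = ∑ y ∈ F.roots.toFinset, F.roots.count y := by
        rw [← Finset.sum_sdiff (Finset.inter_subset_left (s₁ := F.roots.toFinset) (s₂ := P)),
          Finset.sdiff_inter_self_left]
        simp only [count_roots]
    _ = Multiset.card F.roots := Multiset.toFinset_sum_count_eq _
    _ ≤ F.natDegree := card_roots' F

/-- A permutation of `(2, 3, m)` with `m = 3, 4, 5`. -/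
def IsPolyhedralTriple (k₀ k₁ k₂ : ℕ) : Prop :=
  ∃ m, (m = 3 ∨ m = 4 ∨ m = 5) ∧
    (k₀ = 2 ∧ k₁ = 3 ∧ k₂ = m ∨ k₀ = 2 ∧ k₁ = m ∧ k₂ = 3 ∨ k₀ = 3 ∧ k₁ = 2 ∧ k₂ = m ∨
      k₀ = 3 ∧ k₁ = m ∧ k₂ = 2 ∨ k₀ = m ∧ k₁ = 2 ∧ k₂ = 3 ∨ k₀ = m ∧ k₁ = 3 ∧ k₂ = 2)

/-- Here `nᵢ` counts the regular and `sᵢ` the singular points of a fibre. An empty `nᵢ` leaves too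
few points, since `1/2 + 1/3 < 1`. If `∑ 1/kᵢ ≤ 1`, then `∑ nᵢ ≥ D` forces equality and every `sᵢ =
0`, which contradicts the total of at least `D + 2`. This is how the Euclidean triples `(2, 4, 4)`
and `(2, 3, 6)` are excluded. -/
lemma polyhedral_counts_aux {k₁ k₂ n₀ n₁ n₂ s₀ s₁ s₂ D : ℕ} (hD : 1 ≤ D)
    (h0 : n₀ = 0 ∨ n₀ * 2 + s₀ ≤ D)
    (h1 : n₁ = 0 ∨ (k₁ ≠ 1 ∧ k₁ ≠ 0 ∧ n₁ * k₁ + s₁ ≤ D))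
    (h2 : n₂ = 0 ∨ (k₂ ≠ 1 ∧ k₂ ≠ 0 ∧ n₂ * k₂ + s₂ ≤ D))
    (hn : D ≤ n₀ + n₁ + n₂) (hns : D + 2 ≤ n₀ + s₀ + (n₁ + s₁) + (n₂ + s₂))
    (hk₁ : n₁ ≠ 0 → k₁ ≠ 2) (hk₂ : n₂ ≠ 0 → k₂ ≠ 2) :
    n₀ ≠ 0 ∧ n₁ ≠ 0 ∧ n₂ ≠ 0 ∧
      (k₁ = 3 ∧ (k₂ = 3 ∨ k₂ = 4 ∨ k₂ = 5) ∨ (k₁ = 3 ∨ k₁ = 4 ∨ k₁ = 5) ∧ k₂ = 3) := by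
  have mul_le : ∀ {n k : ℕ} (j : ℕ), j ≤ k → n * j ≤ n * k := fun j h => Nat.mul_le_mul_left _ h
  have b1 : n₁ = 0 ∨ n₁ * 3 + s₁ ≤ D := by
    by_cases h : n₁ = 0
    · exact Or.inl h
    · have := mul_le (n := n₁) (k := k₁) 3 (by have := hk₁ h; omega)
      omega
  have b2 : n₂ = 0 ∨ n₂ * 3 + s₂ ≤ D := by
    by_cases h : n₂ = 0
    · exact Or.inl h
    · have := mul_le (n := n₂) (k := k₂) 3 (by have := hk₂ h; omega)
      omega
  have p0 : n₀ ≠ 0 := by omega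
  have p1 : n₁ ≠ 0 := by omega
  have p2 : n₂ ≠ 0 := by omega
  refine ⟨p0, p1, p2, ?_⟩
  replace h0 := h0.resolve_left p0
  obtain ⟨-, -, h1⟩ := h1.resolve_left p1
  obtain ⟨-, -, h2⟩ := h2.resolve_left p2
  replace b1 := b1.resolve_left p1
  replace b2 := b2.resolve_left p2
  have l1 : 3 ≤ k₁ := by have := hk₁ p1; omega
  have l2 : 3 ≤ k₂ := by have := hk₂ p2; omega
  have c3 : k₁ = 3 ∨ k₂ = 3 := by
    by_contra! h
    have e1 := mul_le (n := n₁) (k := k₁) 4 (by omega)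
    have e2 := mul_le (n := n₂) (k := k₂) 4 (by omega)
    omega
  rcases c3 with h | h
  · have : ¬ 6 ≤ k₂ := fun h6 => by
      have e2 := mul_le (n := n₂) 6 h6
      omega
    omega
  · have : ¬ 6 ≤ k₁ := fun h6 => by
      have e1 := mul_le (n := n₁) 6 h6
      omega
    omega

lemma isPolyhedralTriple_of_counts {k₀ k₁ k₂ n₀ n₁ n₂ s₀ s₁ s₂ D : ℕ} (hD : 1 ≤ D)
    (h0 : n₀ = 0 ∨ (k₀ ≠ 1 ∧ k₀ ≠ 0 ∧ n₀ * k₀ + s₀ ≤ D))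
    (h1 : n₁ = 0 ∨ (k₁ ≠ 1 ∧ k₁ ≠ 0 ∧ n₁ * k₁ + s₁ ≤ D))
    (h2 : n₂ = 0 ∨ (k₂ ≠ 1 ∧ k₂ ≠ 0 ∧ n₂ * k₂ + s₂ ≤ D))
    (hn : D ≤ n₀ + n₁ + n₂) (hns : D + 2 ≤ n₀ + s₀ + (n₁ + s₁) + (n₂ + s₂))
    (h01 : ¬ (n₀ ≠ 0 ∧ n₁ ≠ 0 ∧ k₀ = 2 ∧ k₁ = 2)) (h02 : ¬ (n₀ ≠ 0 ∧ n₂ ≠ 0 ∧ k₀ = 2 ∧ k₂ = 2))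
    (h12 : ¬ (n₁ ≠ 0 ∧ n₂ ≠ 0 ∧ k₁ = 2 ∧ k₂ = 2)) :
    n₀ ≠ 0 ∧ n₁ ≠ 0 ∧ n₂ ≠ 0 ∧ IsPolyhedralTriple k₀ k₁ k₂ := by
  by_cases c0 : n₀ ≠ 0 ∧ k₀ = 2
  · obtain ⟨p0, rfl⟩ := c0
    obtain ⟨-, p1, p2, h⟩ := polyhedral_counts_aux hD (h0.imp_right fun h => h.2.2) h1 h2 hn hns
      (fun p q => h01 ⟨p0, p, rfl, q⟩) (fun p q => h02 ⟨p0, p, rfl, q⟩)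
    refine ⟨p0, p1, p2, ?_⟩
    rcases h with ⟨h, h'⟩ | ⟨h', h⟩
    · exact ⟨k₂, h', by simp [h]⟩
    · exact ⟨k₁, h', by simp [h]⟩
  by_cases c1 : n₁ ≠ 0 ∧ k₁ = 2
  · obtain ⟨p1, rfl⟩ := c1
    obtain ⟨-, p0, p2, h⟩ := polyhedral_counts_aux hD (h1.imp_right fun h => h.2.2) h0 h2
      (by linarith) (by linarith) (fun p q => c0 ⟨p, q⟩) (fun p q => h12 ⟨p1, p, rfl, q⟩)
    refine ⟨p0, p1, p2, ?_⟩
    rcases h with ⟨h, h'⟩ | ⟨h', h⟩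
    · exact ⟨k₂, h', by simp [h]⟩
    · exact ⟨k₀, h', by simp [h]⟩
  by_cases c2 : n₂ ≠ 0 ∧ k₂ = 2
  · obtain ⟨p2, rfl⟩ := c2
    obtain ⟨-, p0, p1, h⟩ := polyhedral_counts_aux hD (h2.imp_right fun h => h.2.2) h0 h1
      (by linarith) (by linarith) (fun p q => c0 ⟨p, q⟩) (fun p q => c1 ⟨p, q⟩)
    refine ⟨p0, p1, p2, ?_⟩
    rcases h with ⟨h, h'⟩ | ⟨h', h⟩
    · exact ⟨k₁, h', by simp [h]⟩
    · exact ⟨k₀, h', by simp [h]⟩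
  -- With every multiplicity at least `3`, the bound `∑ nᵢ ≤ D` can only be attained with all `sᵢ =
  -- 0`, again against the total `D + 2`.
  exfalso
  have three : ∀ {n k s : ℕ}, (n = 0 ∨ (k ≠ 1 ∧ k ≠ 0 ∧ n * k + s ≤ D)) → ¬ (n ≠ 0 ∧ k = 2) →
      n = 0 ∨ n * 3 + s ≤ D := by
    intro n k s h c
    by_cases p : n = 0
    · exact Or.inl p
    · have := Nat.mul_le_mul_left n (show 3 ≤ k by omega)
      exact Or.inr (by omega)
  have t0 := three h0 c0
  have t1 := three h1 c1
  have t2 := three h2 c2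
  clear h0 h1 h2 c0 c1 c2 h01 h02 h12 three
  omega

end Counting

/-! ### Exponent differences forced by branching -/

/-- `exponent_of_root` in terms of the root multiplicity. -/
lemma exponent_of_isRoot {P : Set ℂ} {a₀ a₁ a₂ : ℂ} {F₀ F₁ F₂ : ℂ[X]} (hs : F₀ + F₁ + F₂ = 0)
    (hc : IsCoprime F₀ F₁) (hF₀ : F₀ ≠ 0) (hreg : SchwarzRegular P a₀ a₁ a₂ F₀ F₁ F₂) (x : ℂ)
    (hx : F₀.IsRoot x) (hxP : x ∉ P) :
    (F₀.rootMultiplicity x : ℂ) ^ 2 * (1 - a₀) = 1 ∧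
      (F₀.rootMultiplicity x = 1 → a₀ = 0 ∧ a₁ = a₂) := by
  obtain ⟨u, hu, hnd⟩ := exists_eq_pow_rootMultiplicity_mul_and_not_dvd F₀ hF₀ x
  have hpos := (rootMultiplicity_pos hF₀).2 hx
  obtain ⟨m, hm⟩ : ∃ m, F₀.rootMultiplicity x = m + 1 := ⟨_, (Nat.succ_pred hpos.ne').symm⟩
  rw [hm] at hu ⊢
  have h1 : F₁.eval x ≠ 0 := by
    intro h
    obtain ⟨r, s, hrs⟩ := hc
    have := congrArg (eval x) hrs
    simp [h, hx.eq_zero] at this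
  have hue : u.eval x ≠ 0 := by rwa [dvd_iff_isRoot] at hnd
  obtain ⟨h2, h3⟩ := exponent_of_root hs hreg hxP hu hue h1
  refine ⟨by exact_mod_cast h2, fun h => ?_⟩
  obtain rfl : m = 0 := by omega
  refine ⟨?_, h3 rfl⟩
  simp at h2
  exact h2

/-- Replacing `F₀` by `G = F₀ - k F₁`, with `k` the value of `F₀ / F₁` at `x`, does not change the
Wronskian with `F₁`. If `x` were outside `P`, it would be a simple zero of `G` by
`not_regular_of_branching`, and the Wronskian would not vanish there. -/
lemma mem_of_wronskian_eval_eq_zero {P : Set ℂ} {a₀ a₁ a₂ : ℂ} {F₀ F₁ F₂ : ℂ[X]}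
    (hW : wronskian F₀ F₁ ≠ 0) (hreg : SchwarzRegular P a₀ a₁ a₂ F₀ F₁ F₂) {x : ℂ}
    (hx : (wronskian F₀ F₁).eval x = 0) (h0 : F₀.eval x ≠ 0) (h1 : F₁.eval x ≠ 0)
    (h2 : F₂.eval x ≠ 0) : x ∈ P := by
  by_contra hxP
  set k := F₀.eval x / F₁.eval x with hk
  set G := F₀ - C k * F₁ with hG
  have hGW : wronskian F₀ F₁ = wronskian G F₁ := by
    simp only [hG, wronskian, derivative_sub, derivative_mul, derivative_C]
    ring
  have hG0 : G ≠ 0 := by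
    intro h
    rw [hGW, h, wronskian_zero_left] at hW
    exact hW rfl
  have hGx : G.IsRoot x := by
    simp only [IsRoot.def, hG, hk, eval_sub, eval_mul, eval_C]
    field_simp
    simp
  obtain ⟨u, hu, hnd⟩ := exists_eq_pow_rootMultiplicity_mul_and_not_dvd G hG0 x
  have hpos := (rootMultiplicity_pos hG0).2 hGx
  obtain ⟨m, hm⟩ : ∃ m, G.rootMultiplicity x = m + 1 := ⟨_, (Nat.succ_pred hpos.ne').symm⟩
  rw [hm] at hu
  have hue : u.eval x ≠ 0 := by rwa [dvd_iff_isRoot] at hnd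
  obtain rfl := not_regular_of_branching hreg hxP hu hue hG h0 h1 h2
  rw [hGW, hu] at hx
  simp [wronskian] at hx
  exact hx.elim hue h1

/-- The possible exponent differences of a hypergeometric equation with a pull-back that has at most
four singular points, one of which is a branching point not above a singular point. -/
theorem polyhedral_of_branching {P : Finset ℂ} (hP : P.card ≤ 3) {a₀ a₁ a₂ : ℂ} {F₀ F₁ F₂ : ℂ[X]}
    (hs : F₀ + F₁ + F₂ = 0) (hc : IsCoprime F₀ F₁) (hW : wronskian F₀ F₁ ≠ 0)
    (hF₀ : F₀ ≠ 0) (hF₁ : F₁ ≠ 0) (hF₂ : F₂ ≠ 0)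
    (hreg : SchwarzRegular P a₀ a₁ a₂ F₀ F₁ F₂)
    (hbr : (∃ S, (wronskian F₀ F₁).eval S = 0 ∧ (F₀ * F₁ * F₂).eval S ≠ 0) ∨
      (F₁.natDegree = F₀.natDegree ∧ F₂.natDegree = F₀.natDegree ∧
        (wronskian F₀ F₁).natDegree + 3 ≤ 2 * F₀.natDegree)) :
    (a₀ = 0 ∧ a₁ = a₂ ∨ a₁ = 0 ∧ a₂ = a₀ ∨ a₂ = 0 ∧ a₀ = a₁) ∨
    (2 ^ 2 * (1 - a₀) = 1 ∧ 2 ^ 2 * (1 - a₁) = 1 ∨ 2 ^ 2 * (1 - a₀) = 1 ∧ 2 ^ 2 * (1 - a₂) = 1 ∨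
      2 ^ 2 * (1 - a₁) = 1 ∧ 2 ^ 2 * (1 - a₂) = 1) ∨
    ∃ k₀ k₁ k₂ : ℕ, IsPolyhedralTriple k₀ k₁ k₂ ∧ (k₀ : ℂ) ^ 2 * (1 - a₀) = 1 ∧
      (k₁ : ℂ) ^ 2 * (1 - a₁) = 1 ∧ (k₂ : ℂ) ^ 2 * (1 - a₂) = 1 := by
  classical
  by_cases hn1 : a₀ = 0 ∧ a₁ = a₂ ∨ a₁ = 0 ∧ a₂ = a₀ ∨ a₂ = 0 ∧ a₀ = a₁
  · exact Or.inl hn1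
  refine Or.inr (or_iff_not_imp_left.2 fun hn2 => ?_)
  have hF₂e : F₂ = -F₀ - F₁ := by linear_combination hs
  have hs1 : F₁ + F₂ + F₀ = 0 := by linear_combination hs
  have hs2 : F₂ + F₀ + F₁ = 0 := by linear_combination hs
  have h12 : IsCoprime F₁ F₂ := by
    obtain ⟨u, v, h⟩ := hc
    exact ⟨v - u, -u, by rw [hF₂e]; linear_combination h⟩
  have h20 : IsCoprime F₂ F₀ := by
    obtain ⟨u, v, h⟩ := hc
    exact ⟨-v, u - v, by rw [hF₂e]; linear_combination h⟩
  have hreg1 := hreg.rotate hs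
  have hreg2 := hreg1.rotate hs1
  have e0 := exponent_of_isRoot hs hc hF₀ hreg
  have e1 := exponent_of_isRoot hs1 h12 hF₁ hreg1
  have e2 := exponent_of_isRoot hs2 h20 hF₂ hreg2
  have disj : ∀ {F G : ℂ[X]}, IsCoprime F G → Disjoint F.roots.toFinset G.roots.toFinset := by
    intro F G h
    rw [Finset.disjoint_left]
    intro x hx hx'
    simp only [Multiset.mem_toFinset] at hx hx'
    obtain ⟨r, s, hrs⟩ := h
    have := congrArg (eval x) hrs
    simp [(isRoot_of_mem_roots hx).eq_zero, (isRoot_of_mem_roots hx').eq_zero] at this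
  have d01 := disj hc
  have d12 := disj h12
  have d20 := disj h20
  set R₀ := F₀.roots.toFinset with hR₀
  set R₁ := F₁.roots.toFinset with hR₁
  set R₂ := F₂.roots.toFinset with hR₂
  have hF : F₀ * F₁ * F₂ ≠ 0 := mul_ne_zero (mul_ne_zero hF₀ hF₁) hF₂
  have hroots : (F₀ * F₁ * F₂).roots.toFinset = R₀ ∪ R₁ ∪ R₂ := by
    rw [roots_mul hF, roots_mul (mul_ne_zero hF₀ hF₁)]
    simp [Multiset.toFinset_add, hR₀, hR₁, hR₂]
  have hN : (F₀ * F₁ * F₂).roots.toFinset.card = R₀.card + R₁.card + R₂.card := by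
    rw [hroots, Finset.card_union_of_disjoint, Finset.card_union_of_disjoint d01]
    exact Finset.disjoint_union_left.2 ⟨d20.symm, d12⟩
  have hns0 := Finset.card_sdiff_add_card_inter R₀ P
  have hns1 := Finset.card_sdiff_add_card_inter R₁ P
  have hns2 := Finset.card_sdiff_add_card_inter R₂ P
  have hdegP : (F₀ * F₁ * F₂).natDegree = F₀.natDegree + F₁.natDegree + F₂.natDegree := by
    rw [natDegree_mul (mul_ne_zero hF₀ hF₁) hF₂, natDegree_mul hF₀ hF₁]
  have hsP : (R₀ ∩ P).card + (R₁ ∩ P).card + (R₂ ∩ P).card = ((R₀ ∪ R₁ ∪ R₂) ∩ P).card := by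
    rw [Finset.union_inter_distrib_right, Finset.union_inter_distrib_right,
      Finset.card_union_of_disjoint, Finset.card_union_of_disjoint]
    · exact d01.mono Finset.inter_subset_left Finset.inter_subset_left
    · refine Finset.disjoint_union_left.2 ⟨?_, ?_⟩
      · exact d20.symm.mono Finset.inter_subset_left Finset.inter_subset_left
      · exact d12.mono Finset.inter_subset_left Finset.inter_subset_left
  have w01 := natDegree_wronskian_lt_add hW
  have w12 : (wronskian F₀ F₁).natDegree < F₁.natDegree + F₂.natDegree := by
    rw [wronskian_eq_of_sum_zero hs] at hW ⊢
    exact natDegree_wronskian_lt_add hW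
  have w20 : (wronskian F₀ F₁).natDegree < F₂.natDegree + F₀.natDegree := by
    rw [wronskian_eq_of_sum_zero hs, wronskian_eq_of_sum_zero hs1] at hW ⊢
    exact natDegree_wronskian_lt_add hW
  -- As the `Fᵢ` sum to zero, the maximal degree `D` is attained at least twice. If the third degree
  -- is smaller, the defect is the multiplicity of the point at infinity in that fibre.
  have m0 : F₀.natDegree ≤ max F₁.natDegree F₂.natDegree := by
    have : F₀ = -(F₁ + F₂) := by linear_combination hs
    rw [this, natDegree_neg]
    exact natDegree_add_le _ _
  have m1 : F₁.natDegree ≤ max F₂.natDegree F₀.natDegree := by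
    have : F₁ = -(F₂ + F₀) := by linear_combination hs
    rw [this, natDegree_neg]
    exact natDegree_add_le _ _
  have m2 : F₂.natDegree ≤ max F₀.natDegree F₁.natDegree := by
    have : F₂ = -(F₀ + F₁) := by linear_combination hs
    rw [this, natDegree_neg]
    exact natDegree_add_le _ _
  set D := max F₀.natDegree (max F₁.natDegree F₂.natDegree) with hD
  -- Only finite points are counted, so the bound is `D + 2` even when infinity lies in one of the
  -- fibres. A finite `S` takes one place in `P` and leaves at most two singular points in the
  -- fibres. If `S` is infinity, all three elements of `P` may be in the fibres, but the smaller
  -- degree of the Wronskian gives `D + 3` points. In both cases at least `D` points are regular.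
  have hcount : D + 2 ≤ R₀.card + R₁.card + R₂.card ∧
      D + ((R₀ ∩ P).card + (R₁ ∩ P).card + (R₂ ∩ P).card) ≤ R₀.card + R₁.card + R₂.card := by
    rcases hbr with ⟨S, hWS, hFS⟩ | ⟨hd1, hd2, hd3⟩
    · have hSP : S ∈ P := by
        rw [eval_mul, eval_mul] at hFS
        exact mem_of_wronskian_eval_eq_zero hW hreg hWS
          (left_ne_zero_of_mul (left_ne_zero_of_mul hFS))
          (right_ne_zero_of_mul (left_ne_zero_of_mul hFS)) (right_ne_zero_of_mul hFS)
      have hcp : IsCoprime (X - C S) (F₀ * F₁ * F₂) := by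
        rw [(irreducible_X_sub_C S).coprime_iff_not_dvd, dvd_iff_isRoot]
        exact hFS
      have := natDegree_le_add_card_roots hs hc hW hF (dvd_iff_isRoot.2 hWS) hcp
      rw [natDegree_X_sub_C, hdegP, hN] at this
      have hlt : ((R₀ ∪ R₁ ∪ R₂) ∩ P).card ≤ (P.erase S).card := by
        refine Finset.card_le_card fun x hx => ?_
        rw [← hroots, Finset.mem_inter, Multiset.mem_toFinset] at hx
        refine Finset.mem_erase.2 ⟨?_, hx.2⟩
        rintro rfl
        exact hFS (isRoot_of_mem_roots hx.1)
      rw [Finset.card_erase_of_mem hSP, ← hsP] at hlt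
      omega
    · have := natDegree_le_add_card_roots hs hc hW hF (one_dvd _) isCoprime_one_left
      rw [natDegree_one, hdegP, hN] at this
      have hlt : ((R₀ ∪ R₁ ∪ R₂) ∩ P).card ≤ P.card := Finset.card_le_card Finset.inter_subset_right
      rw [← hsP] at hlt
      omega
  have aux : ∀ {F : ℂ[X]} {a b c : ℂ}, F ≠ 0 → F.natDegree ≤ D → ¬ (a = 0 ∧ b = c) →
      (∀ x, F.IsRoot x → x ∉ (P : Set ℂ) → (F.rootMultiplicity x : ℂ) ^ 2 * (1 - a) = 1 ∧
        (F.rootMultiplicity x = 1 → a = 0 ∧ b = c)) →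
      ∃ k : ℕ, (F.roots.toFinset \ P).card = 0 ∨ ((k : ℂ) ^ 2 * (1 - a) = 1 ∧ k ≠ 1 ∧ k ≠ 0 ∧
        (F.roots.toFinset \ P).card * k + (F.roots.toFinset ∩ P).card ≤ D) := by
    intro F a b c hF hFD hne h
    rcases card_roots_mul_add_le hF P (1 - a) (fun x hx hxP => (h x hx hxP).1) with h0 | ⟨x, hxP, hx, hle⟩
    · exact ⟨0, Or.inl h0⟩
    · exact ⟨F.rootMultiplicity x, Or.inr ⟨(h x hx hxP).1, fun h1 => hne ((h x hx hxP).2 h1),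
        ((rootMultiplicity_pos hF).2 hx).ne', hle.trans hFD⟩⟩
  obtain ⟨k₀, hk₀⟩ := aux hF₀ (by omega) (fun h => hn1 (Or.inl h)) e0
  obtain ⟨k₁, hk₁⟩ := aux hF₁ (by omega) (fun h => hn1 (Or.inr (Or.inl h))) e1
  obtain ⟨k₂, hk₂⟩ := aux hF₂ (by omega) (fun h => hn1 (Or.inr (Or.inr h))) e2
  simp only [← hR₀, ← hR₁, ← hR₂] at hk₀ hk₁ hk₂
  have two : ∀ {n k : ℕ} {a : ℂ} {p : Prop}, n ≠ 0 → k = 2 →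
      (n = 0 ∨ ((k : ℂ) ^ 2 * (1 - a) = 1 ∧ p)) → 2 ^ 2 * (1 - a) = 1 := by
    rintro n k a p hn rfl (h | h)
    · exact absurd h hn
    · exact_mod_cast h.1
  obtain ⟨p0, p1, p2, hk⟩ := isPolyhedralTriple_of_counts (D := D) (by omega)
    (hk₀.imp_right And.right) (hk₁.imp_right And.right) (hk₂.imp_right And.right)
    (by omega) (by omega)
    (fun h => hn2 (Or.inl ⟨two h.1 h.2.2.1 hk₀, two h.2.1 h.2.2.2 hk₁⟩))
    (fun h => hn2 (Or.inr (Or.inl ⟨two h.1 h.2.2.1 hk₀, two h.2.1 h.2.2.2 hk₂⟩)))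
    (fun h => hn2 (Or.inr (Or.inr ⟨two h.1 h.2.2.1 hk₁, two h.2.1 h.2.2.2 hk₂⟩)))
  exact ⟨k₀, k₁, k₂, hk, (hk₀.resolve_left p0).1, (hk₁.resolve_left p1).1, (hk₂.resolve_left p2).1⟩

/-! ### Local solutions by power series -/

section PowerSeries

/-- Coefficients with at most exponential growth. -/
def ExpBounded (a : ℕ → ℂ) : Prop := ∃ K M : ℝ, 0 < M ∧ ∀ n, ‖a n‖ ≤ K * M ^ n

lemma ExpBounded.nonneg {a : ℕ → ℂ} {K M : ℝ} (h : ∀ n, ‖a n‖ ≤ K * M ^ n) : 0 ≤ K := by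
  have := (norm_nonneg _).trans (h 0)
  simpa using this

lemma ExpBounded.derivCoeff {a : ℕ → ℂ} (h : ExpBounded a) :
    ExpBounded (fun n => (n + 1) * a (n + 1)) := by
  obtain ⟨K, M, hM, h⟩ := h
  have hK := ExpBounded.nonneg h
  refine ⟨K * M, 2 * M, by positivity, fun n => ?_⟩
  have h2 : ((n : ℝ) + 1) ≤ 2 ^ n := by exact_mod_cast Nat.lt_two_pow_self
  have hn : ‖((n : ℂ) + 1)‖ = (n : ℝ) + 1 := by
    rw [← Nat.cast_one, ← Nat.cast_add, Complex.norm_natCast]; push_cast; rfl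
  rw [norm_mul, hn]
  calc ((n : ℝ) + 1) * ‖a (n + 1)‖ ≤ 2 ^ n * (K * M ^ (n + 1)) := by
        gcongr
        exact h (n + 1)
    _ = K * M * (2 * M) ^ n := by rw [mul_pow, pow_succ]; ring

/-- On the ball of radius `1 / (2 M)` the terms are dominated by a geometric series of ratio `1/2`,
which still converges after the factor `n` produced by differentiation. -/
lemma ExpBounded.exists_hasDerivAt {a : ℕ → ℂ} (h : ExpBounded a) :
    ∃ r > 0, ∀ s ∈ Metric.ball (0 : ℂ) r, HasSum (fun n => a n * s ^ n) (∑' n, a n * s ^ n) ∧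
      HasDerivAt (fun s => ∑' n, a n * s ^ n) (∑' n : ℕ, (n + 1) * a (n + 1) * s ^ n) s := by
  obtain ⟨K, M, hM, h⟩ := h
  have hK := ExpBounded.nonneg h
  have hball : ∀ s ∈ Metric.ball (0 : ℂ) (1 / (2 * M)), ‖s‖ ≤ 1 / (2 * M) := fun s hs => by
    simpa using (mem_ball_zero_iff.1 hs).le
  have hsum : ∀ s ∈ Metric.ball (0 : ℂ) (1 / (2 * M)), Summable (fun n => a n * s ^ n) := by
    intro s hs
    have hg : Summable (fun n : ℕ => K * (1 / 2 : ℝ) ^ n) := summable_geometric_two.mul_left K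
    refine Summable.of_norm_bounded hg fun n => ?_
    rw [norm_mul, norm_pow]
    calc ‖a n‖ * ‖s‖ ^ n ≤ (K * M ^ n) * (1 / (2 * M)) ^ n := by
          gcongr
          · exact h n
          · exact hball s hs
      _ = K * (1 / 2) ^ n := by
          rw [mul_assoc, ← mul_pow]; congr 2; field_simp
  have hM2 : 0 < 1 / (2 * M) := by positivity
  refine ⟨1 / (2 * M), hM2, fun s hs => ⟨(hsum s hs).hasSum, ?_⟩⟩
  have hhalf : ‖(1 / 2 : ℝ)‖ < 1 := by norm_num
  have hu0 : Summable (fun n : ℕ => (n : ℝ) ^ 1 * (1 / 2 : ℝ) ^ n) :=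
    summable_pow_mul_geometric_of_norm_lt_one 1 hhalf
  have hu : Summable (fun n : ℕ => 2 * K * M * ((n : ℝ) ^ 1 * (1 / 2) ^ n)) := hu0.mul_left _
  have hbd : ∀ (n : ℕ) (y : ℂ), y ∈ Metric.ball (0 : ℂ) (1 / (2 * M)) →
      ‖a n * (n * y ^ (n - 1))‖ ≤ 2 * K * M * ((n : ℝ) ^ 1 * (1 / 2) ^ n) := by
    intro n y hy
    rcases n with _ | n
    · simp
    rw [norm_mul, norm_mul, norm_pow, Complex.norm_natCast, Nat.add_sub_cancel]
    calc ‖a (n + 1)‖ * (((n + 1 : ℕ) : ℝ) * ‖y‖ ^ n)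
        ≤ (K * M ^ (n + 1)) * (((n + 1 : ℕ) : ℝ) * (1 / (2 * M)) ^ n) := by
          gcongr
          · exact h _
          · exact hball y hy
      _ = 2 * K * M * (((n + 1 : ℕ) : ℝ) ^ 1 * (1 / 2) ^ (n + 1)) := by
          rw [one_div, mul_inv, mul_pow, inv_pow, inv_pow, one_div, inv_pow, pow_succ, pow_succ]
          field_simp
          ring
  have h0 : (0 : ℂ) ∈ Metric.ball (0 : ℂ) (1 / (2 * M)) := Metric.mem_ball_self (by positivity)
  have hd := hasDerivAt_tsum_of_isPreconnected (g := fun n s => a n * s ^ n)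
    (g' := fun n s => a n * (n * s ^ (n - 1))) hu Metric.isOpen_ball
    (convex_ball _ _).isPreconnected
    (fun n y _ => by simpa using (hasDerivAt_pow n y).const_mul (a n)) hbd h0 (hsum 0 h0) hs
  have hsd : Summable (fun n => a n * (n * s ^ (n - 1))) :=
    Summable.of_norm_bounded hu (fun n => hbd n s hs)
  have he : ∑' n : ℕ, a n * (n * s ^ (n - 1)) = ∑' n : ℕ, (n + 1) * a (n + 1) * s ^ n := by
    rw [hsd.tsum_eq_zero_add]
    simp only [Nat.cast_zero, zero_mul, mul_zero, zero_add, Nat.add_sub_cancel]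
    refine tsum_congr fun n => ?_
    push_cast
    ring
  rw [he] at hd
  exact hd

lemma hasSum_shift {b c : ℕ → ℂ} {s x : ℂ} (h : HasSum (fun n => c n * s ^ n) x) (h0 : b 0 = 0)
    (hb : ∀ n, b (n + 1) = c n) : HasSum (fun n => b n * s ^ n) (s * x) := by
  rw [← hasSum_nat_add_iff' 1]
  simp only [Finset.range_one, Finset.sum_singleton, h0, zero_mul, sub_zero]
  have he : (fun n => b (n + 1) * s ^ (n + 1)) = fun n => s * (c n * s ^ n) := by
    funext n
    rw [hb]; ring
  rw [he]
  exact h.mul_left s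

end PowerSeries

/-- Coefficients of a solution of `(κ + ρ s - s²) y'' + (σ - τ s) y' - ν y = 0`. -/
noncomputable def solCoeff (κ ρ σ τ ν α β : ℂ) : ℕ → ℂ
  | 0 => α
  | 1 => β
  | n + 2 => (-((n + 1) * (ρ * n + σ)) * solCoeff κ ρ σ τ ν α β (n + 1)
      + (n * (n - 1) + τ * n + ν) * solCoeff κ ρ σ τ ν α β n) / (κ * ((n + 2) * (n + 1)))

lemma solCoeff_expBounded {κ ρ σ τ ν α β : ℂ} (hκ : κ ≠ 0) :
    ExpBounded (solCoeff κ ρ σ τ ν α β) := by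
  set a := solCoeff κ ρ σ τ ν α β with ha
  set K₁ : ℝ := (‖ρ‖ + ‖σ‖ + (1 + ‖τ‖ + ‖ν‖)) / ‖κ‖ with hK₁
  have hκ' : 0 < ‖κ‖ := norm_pos_iff.2 hκ
  have hK₁0 : 0 ≤ K₁ := by positivity
  have hrec : ∀ n, ‖a (n + 2)‖ ≤ K₁ * (‖a (n + 1)‖ + ‖a n‖) := by
    intro n
    have e : a (n + 2) = (-((n + 1) * (ρ * n + σ)) * a (n + 1)
      + (n * (n - 1) + τ * n + ν) * a n) / (κ * ((n + 2) * (n + 1))) := by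
      simp only [ha, solCoeff]
    have hn : ‖((n : ℂ) + 1)‖ = (n : ℝ) + 1 := by
      rw [← Nat.cast_one, ← Nat.cast_add, Complex.norm_natCast]; push_cast; rfl
    have hn2 : ‖((n : ℂ) + 2)‖ = (n : ℝ) + 2 := by
      rw [← Nat.cast_ofNat, ← Nat.cast_add, Complex.norm_natCast]; push_cast; rfl
    have hnm : ‖(n : ℂ) - 1‖ ≤ (n : ℝ) + 1 := by
      calc _ ≤ ‖(n : ℂ)‖ + ‖(1 : ℂ)‖ := norm_sub_le _ _
        _ = _ := by rw [Complex.norm_natCast]; simp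
    have hn0 : (0 : ℝ) ≤ n := Nat.cast_nonneg n
    have e1 : ‖ρ * n + σ‖ ≤ (‖ρ‖ + ‖σ‖) * (n + 2) := by
      calc _ ≤ ‖ρ‖ * n + ‖σ‖ := by
            refine (norm_add_le _ _).trans ?_
            rw [norm_mul, Complex.norm_natCast]
        _ ≤ _ := by nlinarith [norm_nonneg ρ, norm_nonneg σ]
    have e2 : ‖(n : ℂ) * (n - 1) + τ * n + ν‖ ≤ (1 + ‖τ‖ + ‖ν‖) * ((n + 2) * (n + 1)) := by
      calc _ ≤ (n : ℝ) * (n + 1) + ‖τ‖ * n + ‖ν‖ := by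
            refine (norm_add₃_le).trans ?_
            rw [norm_mul, norm_mul, Complex.norm_natCast]
            gcongr
        _ ≤ _ := by
          have h1 : (n : ℝ) * (n + 1) ≤ (n + 2) * (n + 1) := by nlinarith
          have h2 : (n : ℝ) ≤ (n + 2) * (n + 1) := by nlinarith
          have h3 : (1 : ℝ) ≤ (n + 2) * (n + 1) := by nlinarith
          nlinarith [mul_le_mul_of_nonneg_left h2 (norm_nonneg τ),
            mul_le_mul_of_nonneg_left h3 (norm_nonneg ν)]
    rw [e, norm_div, norm_mul κ, norm_mul, hn, hn2, div_le_iff₀ (by positivity)]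
    calc _ ≤ ((n : ℝ) + 1) * ((‖ρ‖ + ‖σ‖) * (n + 2)) * ‖a (n + 1)‖
          + (1 + ‖τ‖ + ‖ν‖) * ((n + 2) * (n + 1)) * ‖a n‖ := by
          refine (norm_add_le _ _).trans ?_
          rw [norm_mul, norm_mul, norm_neg, norm_mul, hn]
          gcongr
      _ ≤ (‖ρ‖ + ‖σ‖ + (1 + ‖τ‖ + ‖ν‖)) * (‖a (n + 1)‖ + ‖a n‖) * ((n + 2) * (n + 1)) := by
          have p1 : 0 ≤ (1 + ‖τ‖ + ‖ν‖) * ‖a (n + 1)‖ * ((n + 2 : ℝ) * (n + 1)) := by positivity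
          have p2 : 0 ≤ (‖ρ‖ + ‖σ‖) * ‖a n‖ * ((n + 2 : ℝ) * (n + 1)) := by positivity
          nlinarith
      _ = _ := by rw [hK₁]; field_simp
  -- Chosen so that `K₁ (M + 1) ≤ M²`, which is what the two-term recursion needs.
  set M : ℝ := 2 * K₁ + 1 with hM
  set K : ℝ := ‖α‖ + ‖β‖ with hK
  have hM1 : 1 ≤ M := by linarith
  refine ⟨K, M, by positivity, fun n => ?_⟩
  have : ‖a n‖ ≤ K * M ^ n ∧ ‖a (n + 1)‖ ≤ K * M ^ (n + 1) := by
    induction n with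
    | zero =>
      have h0 : a 0 = α := by simp only [ha, solCoeff]
      have h1 : a 1 = β := by simp only [ha, solCoeff]
      rw [h0, zero_add, h1]
      simp only [pow_zero, pow_one, mul_one]
      refine ⟨by linarith [norm_nonneg β], ?_⟩
      nlinarith [norm_nonneg α, norm_nonneg β]
    | succ n ih =>
      refine ⟨ih.2, (hrec n).trans ?_⟩
      have hKn : 0 ≤ K * M ^ n := by positivity
      calc K₁ * (‖a (n + 1)‖ + ‖a n‖) ≤ K₁ * (K * M ^ (n + 1) + K * M ^ n) := by
            gcongr
            exacts [ih.2, ih.1]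
        _ = (K * M ^ n) * (K₁ * (M + 1)) := by ring
        _ ≤ (K * M ^ n) * (M * M) := by
            refine mul_le_mul_of_nonneg_left ?_ hKn
            rw [hM]
            nlinarith
        _ = K * M ^ (n + 1 + 1) := by ring
  exact this.1

/-- The pull-back hypothesis only speaks about solutions. Solutions with arbitrary initial data are
needed to extract from it a relation between the coefficients of the two equations. -/
theorem exists_isLocalSolution_hypergeometricEq (A B C α β : ℂ) {z₀ : ℂ} (h0 : z₀ ≠ 0)
    (h1 : z₀ ≠ 1) : ∃ y : ℂ → ℂ, (hypergeometricEq A B C).IsLocalSolution y z₀ ∧ y z₀ = α ∧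
      deriv y z₀ = β := by
  have hκ : z₀ * (1 - z₀) ≠ 0 := mul_ne_zero h0 (sub_ne_zero.2 h1.symm)
  set D := A + B - C + 1 with hD
  -- The parameters come from multiplying the equation by `z (1 - z)` and expanding in `s = z - z₀`;
  -- in particular `z (1 - z) = z₀ (1 - z₀) + (1 - 2 z₀) s - s²`.
  set a := solCoeff (z₀ * (1 - z₀)) (1 - 2 * z₀) (C * (1 - z₀) - D * z₀) (C + D) (A * B) α β with ha
  have hrec : ∀ n : ℕ, (z₀ * (1 - z₀)) * ((n + 2) * (n + 1)) * a (n + 2)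
      = -((n + 1) * ((1 - 2 * z₀) * n + (C * (1 - z₀) - D * z₀))) * a (n + 1)
      + (n * (n - 1) + (C + D) * n + A * B) * a n := by
    intro n
    have hn1 : (n : ℂ) + 1 ≠ 0 := by exact_mod_cast Nat.succ_ne_zero n
    have hn2 : (n : ℂ) + 2 ≠ 0 := by exact_mod_cast Nat.succ_ne_zero (n + 1)
    rw [ha, solCoeff, mul_div_cancel₀]
    exact mul_ne_zero hκ (mul_ne_zero hn2 hn1)
  have b0 : ExpBounded a := solCoeff_expBounded hκ
  have b1 := b0.derivCoeff
  have b2 := b1.derivCoeff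
  obtain ⟨r0, hr0, H0⟩ := b0.exists_hasDerivAt
  obtain ⟨r1, hr1, H1⟩ := b1.exists_hasDerivAt
  obtain ⟨r2, hr2, H2⟩ := b2.exists_hasDerivAt
  set Y0 : ℂ → ℂ := fun s => ∑' n, a n * s ^ n with hY0
  set Y1 : ℂ → ℂ := fun s => ∑' n : ℕ, (n + 1) * a (n + 1) * s ^ n with hY1
  set Y2 : ℂ → ℂ := fun s => ∑' n : ℕ, (n + 1) * (((n + 1 : ℕ) + 1) * a (n + 1 + 1)) * s ^ n
    with hY2
  set r := min r0 (min r1 r2) with hr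
  have hrpos : 0 < r := lt_min hr0 (lt_min hr1 hr2)
  have hshift : ∀ z ∈ Metric.ball z₀ r, z - z₀ ∈ Metric.ball (0 : ℂ) r := fun z hz => by
    simpa [dist_eq_norm] using hz
  have sub0 : Metric.ball (0 : ℂ) r ⊆ Metric.ball 0 r0 := Metric.ball_subset_ball (min_le_left _ _)
  have sub1 : Metric.ball (0 : ℂ) r ⊆ Metric.ball 0 r1 :=
    Metric.ball_subset_ball ((min_le_right _ _).trans (min_le_left _ _))
  have sub2 : Metric.ball (0 : ℂ) r ⊆ Metric.ball 0 r2 :=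
    Metric.ball_subset_ball ((min_le_right _ _).trans (min_le_right _ _))
  have D0 : ∀ z ∈ Metric.ball z₀ r, HasDerivAt (fun z => Y0 (z - z₀)) (Y1 (z - z₀)) z := fun z hz =>
    HasDerivAt.comp_sub_const z z₀ (H0 _ (sub0 (hshift z hz))).2
  have D1 : ∀ z ∈ Metric.ball z₀ r, HasDerivAt (fun z => Y1 (z - z₀)) (Y2 (z - z₀)) z := fun z hz =>
    HasDerivAt.comp_sub_const z z₀ (H1 _ (sub1 (hshift z hz))).2
  have hmem : Metric.ball z₀ r ∈ 𝓝 z₀ := Metric.ball_mem_nhds _ hrpos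
  have hderiv : ∀ z ∈ Metric.ball z₀ r, deriv (fun z => Y0 (z - z₀)) z = Y1 (z - z₀) :=
    fun z hz => (D0 z hz).deriv
  have hderiv2 : ∀ z ∈ Metric.ball z₀ r, deriv (deriv (fun z => Y0 (z - z₀))) z = Y2 (z - z₀) := by
    intro z hz
    rw [Filter.EventuallyEq.deriv_eq (f := fun z => Y1 (z - z₀)), (D1 z hz).deriv]
    filter_upwards [Metric.isOpen_ball.mem_nhds hz] with w hw using hderiv w hw
  refine ⟨fun z => Y0 (z - z₀), ⟨?_, ?_⟩, ?_, ?_⟩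
  · refine DifferentiableOn.analyticAt (s := Metric.ball z₀ r) (fun z hz => ?_) hmem
    exact (D0 z hz).differentiableAt.differentiableWithinAt
  · filter_upwards [hmem, isOpen_ne.mem_nhds h0, isOpen_ne.mem_nhds h1] with z hz hz0 hz1
    simp only [LinODE.HoldsAt, hderiv2 z hz, hderiv z hz, hypergeometricEq]
    have hs := hshift z hz
    set s := z - z₀ with hs'
    have S0 := (H0 s (sub0 hs)).1
    have S1 := (H1 s (sub1 hs)).1
    have S2 := (H2 s (sub2 hs)).1
    have T1 := hasSum_shift (b := fun n => n * a n) S1 (by simp) (fun n => by push_cast; rfl)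
    have T2 := hasSum_shift (b := fun n : ℕ => n * ((n + 1) * a (n + 1))) S2 (by simp)
      (fun n => by push_cast; rfl)
    have T3 := hasSum_shift (b := fun n : ℕ => n * ((n - 1) * a n)) T2 (by simp)
      (fun n => by push_cast; ring)
    have key : z₀ * (1 - z₀) * Y2 s + (1 - 2 * z₀) * (s * Y2 s) - s * (s * Y2 s)
        + (C * (1 - z₀) - D * z₀) * Y1 s - (C + D) * (s * Y1 s) - A * B * Y0 s = 0 := by
      have := (((((S2.mul_left (z₀ * (1 - z₀))).add (T2.mul_left (1 - 2 * z₀))).sub T3).add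
        (S1.mul_left (C * (1 - z₀) - D * z₀))).sub (T1.mul_left (C + D))).sub (S0.mul_left (A * B))
      refine this.unique ?_
      convert hasSum_zero using 2 with n
      have := hrec n
      push_cast
      linear_combination s ^ n * this
    have hz : z = z₀ + s := by rw [hs']; ring
    have h1z : z - 1 ≠ 0 := sub_ne_zero.2 hz1
    field_simp
    rw [← hD, hz]
    linear_combination -key
  · simp only [sub_self, hY0]
    rw [tsum_eq_single 0]
    · simp [ha, solCoeff]
    · intro n hn; simp [hn]
  · rw [hderiv z₀ (Metric.mem_ball_self hrpos)]
    simp only [sub_self, hY1]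
    rw [tsum_eq_single 0]
    · simp [ha, solCoeff]
    · intro n hn; simp [hn]

/-! ### The Schwarzian of a rational map -/

section RationalMap

/-- The derivative of `f / g`. -/
noncomputable def ratDeriv (f g : ℂ[X]) (x : ℂ) : ℂ :=
  ((derivative f).eval x * g.eval x - f.eval x * (derivative g).eval x) / g.eval x ^ 2

/-- The logarithmic derivative of the derivative of `f / g`. -/
noncomputable def ratPre (f g : ℂ[X]) (x : ℂ) : ℂ :=
  (derivative (wronskian f g)).eval x / (wronskian f g).eval x
    - 2 * (derivative g).eval x / g.eval x

/-- The derivative of `ratPre`. -/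
noncomputable def ratPreDeriv (f g : ℂ[X]) (x : ℂ) : ℂ :=
  (derivative (derivative (wronskian f g))).eval x / (wronskian f g).eval x
    - (derivative (wronskian f g)).eval x ^ 2 / (wronskian f g).eval x ^ 2
    - 2 * (derivative (derivative g)).eval x / g.eval x
    + 2 * (derivative g).eval x ^ 2 / g.eval x ^ 2

/-- The invariant `2 q - p' - p² / 2` of the hypergeometric equation, with `aᵢ = 1 - δᵢ²`. -/
noncomputable def hypInvariant (a₀ a₁ a₂ z : ℂ) : ℂ :=
  a₀ / (2 * z ^ 2) + a₁ / (2 * (z - 1) ^ 2) + (a₂ - a₀ - a₁) / (2 * (z * (z - 1)))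

lemma wronskian_eval (f g : ℂ[X]) (x : ℂ) : (wronskian f g).eval x =
    f.eval x * (derivative g).eval x - (derivative f).eval x * g.eval x := by
  simp [wronskian]

lemma hasDerivAt_ratMap {f g : ℂ[X]} {x : ℂ} (hg : g.eval x ≠ 0) :
    HasDerivAt (fun x => f.eval x / g.eval x) (ratDeriv f g x) x :=
  (f.hasDerivAt x).div (g.hasDerivAt x) hg

lemma hasDerivAt_ratDeriv {f g : ℂ[X]} {x : ℂ} (hg : g.eval x ≠ 0)
    (hW : (wronskian f g).eval x ≠ 0) :
    HasDerivAt (ratDeriv f g) (ratDeriv f g x * ratPre f g x) x := by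
  have h : HasDerivAt (fun x => - (wronskian f g).eval x / g.eval x ^ 2)
      ((- (derivative (wronskian f g)).eval x * g.eval x ^ 2
        - (- (wronskian f g).eval x) * ((2 : ℕ) * g.eval x ^ (2 - 1) * (derivative g).eval x))
        / (g.eval x ^ 2) ^ 2) x :=
    (((wronskian f g).hasDerivAt x).neg).div ((g.hasDerivAt x).pow 2) (pow_ne_zero 2 hg)
  have hf : ratDeriv f g = fun x => - (wronskian f g).eval x / g.eval x ^ 2 := by
    funext x
    rw [ratDeriv, wronskian_eval]
    ring
  rw [hf]
  convert h using 1
  simp only [ratPre]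
  push_cast
  field_simp
  ring

lemma hasDerivAt_ratPre {f g : ℂ[X]} {x : ℂ} (hg : g.eval x ≠ 0)
    (hW : (wronskian f g).eval x ≠ 0) :
    HasDerivAt (ratPre f g) (ratPreDeriv f g x) x := by
  have h := (((derivative (wronskian f g)).hasDerivAt x).div ((wronskian f g).hasDerivAt x) hW).sub
    ((((derivative g).hasDerivAt x).const_mul 2).div (g.hasDerivAt x) hg)
  refine HasDerivAt.congr_deriv (f := ratPre f g) h ?_
  simp only [ratPreDeriv]
  field_simp
  ring

/-- The last factor is the transformed invariant: `φ'² I(φ)` plus the Schwarzian `(φ''/φ')' -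
(φ''/φ')²/2`, for `φ = f / g`. This links the polynomial analysis with the differential equations.
-/
lemma schwarzPoly_eval {a₀ a₁ a₂ : ℂ} {f g : ℂ[X]} {x : ℂ} (hf : f.eval x ≠ 0) (hg : g.eval x ≠ 0)
    (hfg : (g - f).eval x ≠ 0) (hW : (wronskian f g).eval x ≠ 0) :
    (schwarzPoly a₀ a₁ a₂ f (g - f) (-g)).eval x =
      2 * ((wronskian f (g - f)) ^ 2 * (f * (g - f) * (-g)) ^ 2).eval x *
        (ratDeriv f g x ^ 2 * hypInvariant a₀ a₁ a₂ (f.eval x / g.eval x)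
          + ratPreDeriv f g x - ratPre f g x ^ 2 / 2) := by
  have h1 : wronskian f (g - f) = wronskian f g := by
    simp only [wronskian, derivative_sub]; ring
  have h2 : wronskian (derivative f) (derivative (g - f))
      = wronskian (derivative f) (derivative g) := by
    simp only [wronskian, derivative_sub]; ring
  have hW1 := wronskian_eval f g x
  have hW2 : (derivative (wronskian f g)).eval x = f.eval x * (derivative (derivative g)).eval x
      - (derivative (derivative f)).eval x * g.eval x := by
    simp only [wronskian, derivative_sub, derivative_mul, eval_sub, eval_add, eval_mul]; ring
  have hV : (wronskian (derivative f) (derivative g)).eval x = (derivative f).eval x *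
      (derivative (derivative g)).eval x - (derivative (derivative f)).eval x *
      (derivative g).eval x := wronskian_eval _ _ x
  have hr : ratDeriv f g x = - (wronskian f g).eval x / g.eval x ^ 2 := by
    rw [ratDeriv, wronskian_eval]
    ring
  rw [eval_sub] at hfg
  have hz1 : f.eval x / g.eval x - 1 = - (g.eval x - f.eval x) / g.eval x := by
    field_simp; ring
  rw [hr]
  simp only [schwarzPoly, h1, h2, ratPre, ratPreDeriv, hypInvariant, hz1, eval_sub, eval_add,
    eval_mul, eval_pow, eval_neg, eval_ofNat, eval_C]
  rw [hV]
  have hgW : f.eval x * (derivative g).eval x =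
    (wronskian f g).eval x + (derivative f).eval x * g.eval x := by rw [hW1]; ring
  have hgW2 : f.eval x * (derivative (derivative g)).eval x = (derivative (wronskian f g)).eval x
      + (derivative (derivative f)).eval x * g.eval x := by rw [hW2]; ring
  generalize (derivative (derivative (wronskian f g))).eval x = w2
  generalize hw1 : (derivative (wronskian f g)).eval x = w1 at *
  generalize hw0 : (wronskian f g).eval x = w0 at *
  generalize f.eval x = f0 at *
  generalize g.eval x = g0 at *
  generalize (derivative f).eval x = f1 at *
  generalize (derivative g).eval x = g1 at *
  generalize (derivative (derivative f)).eval x = f2 at *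
  generalize (derivative (derivative g)).eval x = g2 at *
  clear hr hz1 h1 h2 hV
  -- The identity `W(f', g') g = W' g' - W g''` eliminates the derivatives of `f`, so that only `W`,
  -- `g` and their derivatives remain.
  have e : (f1 * g2 - f2 * g1) * g0 = w1 * g1 - w0 * g2 := by rw [hW1, hW2]; ring
  have e' : f1 * g2 - f2 * g1 = (w1 * g1 - w0 * g2) / g0 := by rw [eq_div_iff hg, e]
  rw [e']
  clear hW1 hW2 hgW hgW2 e e'
  field_simp
  ring

end RationalMap

/-! ### From the pull-back transformation to regularity of the invariant -/

lemma deriv_deriv_pullback {θ y Φ : ℂ → ℂ} {x : ℂ} (hθ : AnalyticAt ℂ θ x) (hΦ : AnalyticAt ℂ Φ x)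
    (hy : AnalyticAt ℂ y (Φ x)) :
    deriv (fun x => θ x * y (Φ x)) x = deriv θ x * y (Φ x) + θ x * (deriv y (Φ x) * deriv Φ x) ∧
    deriv (deriv (fun x => θ x * y (Φ x))) x = deriv (deriv θ) x * y (Φ x)
      + (2 * deriv θ x * deriv Φ x + θ x * deriv (deriv Φ) x) * deriv y (Φ x)
      + θ x * deriv Φ x ^ 2 * deriv (deriv y) (Φ x) := by
  have key : ∀ {x : ℂ}, AnalyticAt ℂ θ x → AnalyticAt ℂ Φ x → AnalyticAt ℂ y (Φ x) →
      deriv (fun x => θ x * y (Φ x)) x =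
        deriv θ x * y (Φ x) + θ x * (deriv y (Φ x) * deriv Φ x) := by
    intro x hθ hΦ hy
    exact (hθ.differentiableAt.hasDerivAt.mul
      (hy.differentiableAt.hasDerivAt.comp x hΦ.differentiableAt.hasDerivAt)).deriv
  refine ⟨key hθ hΦ hy, ?_⟩
  have hev : deriv (fun x => θ x * y (Φ x)) =ᶠ[𝓝 x]
      fun x => deriv θ x * y (Φ x) + θ x * (deriv y (Φ x) * deriv Φ x) := by
    filter_upwards [hθ.eventually_analyticAt, hΦ.eventually_analyticAt,
      hΦ.continuousAt.eventually hy.eventually_analyticAt] with z h1 h2 h3 using key h1 h2 h3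
  rw [hev.deriv_eq]
  have hyc := hy.differentiableAt.hasDerivAt.comp x hΦ.differentiableAt.hasDerivAt
  have hyc' := hy.deriv.differentiableAt.hasDerivAt.comp x hΦ.differentiableAt.hasDerivAt
  have h := (hθ.deriv.differentiableAt.hasDerivAt.mul hyc).add
    (hθ.differentiableAt.hasDerivAt.mul (hyc'.mul hΦ.deriv.differentiableAt.hasDerivAt))
  refine h.deriv.trans ?_
  simp only [Function.comp_apply, Pi.mul_apply]
  ring

lemma eq_zero_of_wronskian_ne_zero {α β y₁ y₁' y₂ y₂' : ℂ} (h : y₁ * y₂' - y₁' * y₂ ≠ 0)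
    (h1 : α * y₁ + β * y₁' = 0) (h2 : α * y₂ + β * y₂' = 0) : α = 0 ∧ β = 0 := by
  constructor
  · apply mul_left_cancel₀ h
    linear_combination y₂' * h1 - y₁' * h2
  · apply mul_left_cancel₀ h
    linear_combination y₁ * h2 - y₂ * h1

lemma ratEval_eq (φ : RatFunc ℂ) (x : ℂ) : ratEval φ x = φ.num.eval x / φ.denom.eval x := by
  simp [ratEval, RatFunc.eval, eval₂_eq_eval_map]

lemma analyticAt_eval (f : ℂ[X]) (x : ℂ) : AnalyticAt ℂ (fun x => f.eval x) x :=
  (f.differentiable).analyticAt x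

lemma exists_log {r : ℂ → ℂ} {x₀ : ℂ} (hr : AnalyticAt ℂ r x₀) (h : r x₀ ≠ 0) :
    ∃ L : ℂ → ℂ, AnalyticAt ℂ L x₀ ∧ ∀ᶠ x in 𝓝 x₀, Complex.exp (L x) = r x := by
  -- Division by `r x₀` moves the value at `x₀` to `1`, away from the branch cut.
  refine ⟨fun x => Complex.log (r x / r x₀) + Complex.log (r x₀), ?_, ?_⟩
  · refine (AnalyticAt.clog (hr.div analyticAt_const h) ?_).add analyticAt_const
    simp [div_self h]
  · filter_upwards [hr.continuousAt.eventually_ne h] with x hx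
    rw [Complex.exp_add, Complex.exp_log (div_ne_zero hx h), Complex.exp_log h, div_mul_cancel₀ _ h]

lemma RadicalFunction.exists_isBranchAt (R : RadicalFunction) {x₀ : ℂ}
    (h : ∀ i, (R.base i).num.eval x₀ ≠ 0 ∧ (R.base i).denom.eval x₀ ≠ 0) :
    ∃ θ : ℂ → ℂ, R.IsBranchAt θ x₀ ∧ AnalyticAt ℂ θ x₀ ∧ ∀ x, θ x ≠ 0 := by
  have hL : ∀ i, ∃ L : ℂ → ℂ, AnalyticAt ℂ L x₀ ∧
      ∀ᶠ x in 𝓝 x₀, Complex.exp (L x) = ratEval (R.base i) x := by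
    intro i
    refine exists_log ?_ ?_
    · simp only [funext (ratEval_eq (R.base i))]
      exact (analyticAt_eval _ _).div (analyticAt_eval _ _) (h i).2
    · rw [ratEval_eq]
      exact div_ne_zero (h i).1 (h i).2
  choose L hL using hL
  refine ⟨fun x => Complex.exp (∑ i, R.expo i * L i x), ⟨L, hL, Eventually.of_forall fun _ => rfl⟩,
    ?_, fun x => Complex.exp_ne_zero _⟩
  refine AnalyticAt.cexp ?_
  exact Finset.analyticAt_fun_sum _ fun i _ => analyticAt_const.mul (hL i).1

lemma analyticAt_hypergeometricEq (A B C : ℂ) {z : ℂ} (h0 : z ≠ 0) (h1 : z ≠ 1) :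
    AnalyticAt ℂ (hypergeometricEq A B C).p z ∧ AnalyticAt ℂ (hypergeometricEq A B C).q z := by
  have h1' : z - 1 ≠ 0 := sub_ne_zero.2 h1
  have a1 : AnalyticAt ℂ (fun z : ℂ => z - 1) z := analyticAt_id.sub analyticAt_const
  refine ⟨(analyticAt_const.div analyticAt_id h0).add (analyticAt_const.div a1 h1'),
    analyticAt_const.div (analyticAt_id.mul a1) (mul_ne_zero h0 h1')⟩

lemma analyticAt_heunEq (t q a b c d : ℂ) {x : ℂ} (h0 : x ≠ 0) (h1 : x ≠ 1) (ht : x ≠ t) :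
    AnalyticAt ℂ (heunEq t q a b c d).p x ∧ AnalyticAt ℂ (heunEq t q a b c d).q x := by
  have h1' : x - 1 ≠ 0 := sub_ne_zero.2 h1
  have ht' : x - t ≠ 0 := sub_ne_zero.2 ht
  have a1 : AnalyticAt ℂ (fun z : ℂ => z - 1) x := analyticAt_id.sub analyticAt_const
  have at' : AnalyticAt ℂ (fun z : ℂ => z - t) x := analyticAt_id.sub analyticAt_const
  refine ⟨((analyticAt_const.div analyticAt_id h0).add (analyticAt_const.div a1 h1')).add
      (analyticAt_const.div at' ht'),
    ((analyticAt_const.mul analyticAt_id).sub analyticAt_const).div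
      ((analyticAt_id.mul a1).mul at') (mul_ne_zero (mul_ne_zero h0 h1') ht')⟩

lemma hasDerivAt_const_div_sub (k s : ℂ) {x : ℂ} (h : x - s ≠ 0) :
    HasDerivAt (fun x => k / (x - s)) (-k / (x - s) ^ 2) x := by
  have := (hasDerivAt_const x k).div ((hasDerivAt_id x).sub_const s) h
  refine this.congr_deriv ?_
  simp

/-- The derivative of the coefficient `p` of Heun's equation. -/
lemma hasDerivAt_heunEq_p (t q a b c d : ℂ) {x : ℂ} (h0 : x ≠ 0) (h1 : x ≠ 1) (ht : x ≠ t) :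
    HasDerivAt (heunEq t q a b c d).p
      (-c / x ^ 2 + -d / (x - 1) ^ 2 + -(a + b - c - d + 1) / (x - t) ^ 2) x := by
  have e0 := hasDerivAt_const_div_sub c 0 (x := x) (by simpa using h0)
  simp only [sub_zero] at e0
  exact (e0.add (hasDerivAt_const_div_sub d 1 (sub_ne_zero.2 h1))).add
    (hasDerivAt_const_div_sub _ t (sub_ne_zero.2 ht))

/-- The derivative of the coefficient `p` of the hypergeometric equation. -/
lemma hasDerivAt_hypergeometricEq_p (A B C : ℂ) {z : ℂ} (h0 : z ≠ 0) (h1 : z ≠ 1) :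
    HasDerivAt (hypergeometricEq A B C).p (-C / z ^ 2 + -(A + B - C + 1) / (z - 1) ^ 2) z := by
  have e0 := hasDerivAt_const_div_sub C 0 (x := z) (by simpa using h0)
  simp only [sub_zero] at e0
  exact e0.add (hasDerivAt_const_div_sub _ 1 (sub_ne_zero.2 h1))

lemma hypergeometricEq_invariant (A B C : ℂ) {z : ℂ} (h0 : z ≠ 0) (h1 : z ≠ 1) :
    2 * (hypergeometricEq A B C).q z - (-C / z ^ 2 + -(A + B - C + 1) / (z - 1) ^ 2)
      - (hypergeometricEq A B C).p z ^ 2 / 2 =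
    hypInvariant (1 - (1 - C) ^ 2) (1 - (C - A - B) ^ 2) (1 - (A - B) ^ 2) z := by
  have h1' : z - 1 ≠ 0 := sub_ne_zero.2 h1
  simp only [hypergeometricEq, hypInvariant]
  field_simp
  ring

/-- The numerator of twice the invariant `2 q - p' - p² / 2` of Heun's equation. -/
noncomputable def heunNum (t q a b c d : ℂ) : ℂ[X] :=
  C 4 * (C (a * b) * X - C q) * (X * (X - C 1) * (X - C t))
    + C 2 * (C c * ((X - C 1) * (X - C t)) ^ 2 + C d * (X * (X - C t)) ^ 2
      + C (a + b - c - d + 1) * (X * (X - C 1)) ^ 2)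
    - (C c * ((X - C 1) * (X - C t)) + C d * (X * (X - C t))
      + C (a + b - c - d + 1) * (X * (X - C 1))) ^ 2

lemma heunEq_invariant (t q a b c d : ℂ) {x : ℂ} (h0 : x ≠ 0) (h1 : x ≠ 1) (ht : x ≠ t) :
    2 * ((X * (X - C 1) * (X - C t)) ^ 2 : ℂ[X]).eval x * (2 * (heunEq t q a b c d).q x
      - (-c / x ^ 2 + -d / (x - 1) ^ 2 + -(a + b - c - d + 1) / (x - t) ^ 2)
      - (heunEq t q a b c d).p x ^ 2 / 2) = (heunNum t q a b c d).eval x := by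
  have h1' : x - 1 ≠ 0 := sub_ne_zero.2 h1
  have ht' : x - t ≠ 0 := sub_ne_zero.2 ht
  simp only [heunEq, heunNum, eval_add, eval_sub, eval_mul, eval_pow, eval_C, eval_X]
  field_simp
  ring

/-- How the invariants of two equations related by a pull-back transformation are related. -/
lemma invariant_of_pullback {E₁ E₂ : LinODE} {f g : ℂ[X]} {θ y₁ y₂ p₁' p₂' : ℂ → ℂ} {x₀ : ℂ}
    (hg : g.eval x₀ ≠ 0) (hW : (wronskian f g).eval x₀ ≠ 0)
    (hθ : AnalyticAt ℂ θ x₀) (hθ0 : ∀ x, θ x ≠ 0)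
    (hy₁ : E₁.IsLocalSolution y₁ (f.eval x₀ / g.eval x₀))
    (hy₂ : E₁.IsLocalSolution y₂ (f.eval x₀ / g.eval x₀))
    (hw : y₁ (f.eval x₀ / g.eval x₀) * deriv y₂ (f.eval x₀ / g.eval x₀)
      - deriv y₁ (f.eval x₀ / g.eval x₀) * y₂ (f.eval x₀ / g.eval x₀) ≠ 0)
    (hp₁ : ∀ᶠ z in 𝓝 (f.eval x₀ / g.eval x₀), HasDerivAt E₁.p (p₁' z) z)
    (hp₂ : ∀ᶠ x in 𝓝 x₀, HasDerivAt E₂.p (p₂' x) x)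
    (hY₁ : E₂.IsLocalSolution (fun x => θ x * y₁ (f.eval x / g.eval x)) x₀)
    (hY₂ : E₂.IsLocalSolution (fun x => θ x * y₂ (f.eval x / g.eval x)) x₀) :
    ∀ᶠ x in 𝓝 x₀, 2 * E₂.q x - p₂' x - E₂.p x ^ 2 / 2 =
      ratDeriv f g x ^ 2 * (2 * E₁.q (f.eval x / g.eval x) - p₁' (f.eval x / g.eval x)
        - E₁.p (f.eval x / g.eval x) ^ 2 / 2) + ratPreDeriv f g x - ratPre f g x ^ 2 / 2 := by
  set Φ : ℂ → ℂ := fun x => f.eval x / g.eval x with hΦ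
  have hΦa : AnalyticAt ℂ Φ x₀ := (analyticAt_eval f x₀).div (analyticAt_eval g x₀) hg
  have egW : ∀ᶠ x in 𝓝 x₀, g.eval x ≠ 0 ∧ (wronskian f g).eval x ≠ 0 :=
    ((analyticAt_eval g x₀).continuousAt.eventually_ne hg).and
      ((analyticAt_eval _ x₀).continuousAt.eventually_ne hW)
  have hwc : ContinuousAt (fun z => y₁ z * deriv y₂ z - deriv y₁ z * y₂ z) (Φ x₀) :=
    (hy₁.1.continuousAt.mul hy₂.1.deriv.continuousAt).sub
      (hy₁.1.deriv.continuousAt.mul hy₂.1.continuousAt)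
  have good : ∀ᶠ x in 𝓝 x₀, (g.eval x ≠ 0 ∧ (wronskian f g).eval x ≠ 0) ∧ AnalyticAt ℂ θ x ∧
      (HasDerivAt E₁.p (p₁' (Φ x)) (Φ x) ∧ HasDerivAt E₂.p (p₂' x) x) ∧
      2 * deriv θ x * ratDeriv f g x + θ x * (ratDeriv f g x * ratPre f g x)
        - θ x * ratDeriv f g x ^ 2 * E₁.p (Φ x) + E₂.p x * (θ x * ratDeriv f g x) = 0 ∧
      deriv (deriv θ) x - θ x * ratDeriv f g x ^ 2 * E₁.q (Φ x) + E₂.p x * deriv θ x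
        + E₂.q x * θ x = 0 := by
    filter_upwards [egW, egW.eventually_nhds, hθ.eventually_analyticAt, hΦa.eventually_analyticAt,
      hΦa.continuousAt.eventually hp₁, hp₂,
      hΦa.continuousAt.eventually hy₁.1.eventually_analyticAt,
      hΦa.continuousAt.eventually hy₂.1.eventually_analyticAt,
      hΦa.continuousAt.eventually hy₁.2, hΦa.continuousAt.eventually hy₂.2,
      hΦa.continuousAt.eventually (hwc.eventually_ne hw), hY₁.2, hY₂.2]
      with x h1 h1n h2 h3 h4 h5 h6 h7 h8 h9 h10 h11 h12
    refine ⟨h1, h2, ⟨h4, h5⟩, ?_⟩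
    have d1 : deriv Φ x = ratDeriv f g x := (hasDerivAt_ratMap h1.1).deriv
    have d2 : deriv (deriv Φ) x = ratDeriv f g x * ratPre f g x := by
      have : deriv Φ =ᶠ[𝓝 x] ratDeriv f g := by
        filter_upwards [h1n] with w hw' using (hasDerivAt_ratMap hw'.1).deriv
      rw [this.deriv_eq, (hasDerivAt_ratDeriv h1.1 h1.2).deriv]
    obtain ⟨e1, e2⟩ := deriv_deriv_pullback h2 h3 h6
    obtain ⟨e3, e4⟩ := deriv_deriv_pullback h2 h3 h7
    simp only [LinODE.HoldsAt, hΦ] at h8 h9 h11 h12 e1 e2 e3 e4 d1 d2 h10 ⊢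
    rw [e1, e2, d1, d2] at h11
    rw [e3, e4, d1, d2] at h12
    -- After `y''` is eliminated, the equation for `θ · y(φ)` is linear in `y` and `y'` at `φ(x)`.
    -- Two solutions with non-zero Wronskian force both coefficients to vanish.
    refine (eq_zero_of_wronskian_ne_zero h10 ?_ ?_).symm
    · linear_combination h11 - θ x * ratDeriv f g x ^ 2 * h8
    · linear_combination h12 - θ x * ratDeriv f g x ^ 2 * h9
  have hψ : ∀ {x}, g.eval x ≠ 0 → (wronskian f g).eval x ≠ 0 → ratDeriv f g x ≠ 0 := by
    intro x h1 h2
    have : ratDeriv f g x = - (wronskian f g).eval x / g.eval x ^ 2 := by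
      rw [ratDeriv, wronskian_eval]; ring
    rw [this]
    exact div_ne_zero (neg_ne_zero.2 h2) (pow_ne_zero 2 h1)
  -- The vanishing coefficient of `y'` prescribes the logarithmic derivative of `θ`; inserting it in
  -- the coefficient of `y` removes `θ`.
  set u : ℂ → ℂ := fun x => (E₁.p (Φ x) * ratDeriv f g x - ratPre f g x - E₂.p x) / 2 with hu
  have hθu : ∀ᶠ x in 𝓝 x₀, deriv θ x = θ x * u x := by
    filter_upwards [good] with x ⟨h1, _, _, h3, _⟩
    have hψx := hψ h1.1 h1.2
    apply mul_left_cancel₀ (mul_ne_zero two_ne_zero hψx)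
    simp only [hu]
    linear_combination h3
  filter_upwards [good, hθu.eventually_nhds] with x ⟨h1, h2, ⟨h3, h4⟩, h5, h6⟩ h7
  have hux : HasDerivAt u ((p₁' (Φ x) * ratDeriv f g x * ratDeriv f g x
      + E₁.p (Φ x) * (ratDeriv f g x * ratPre f g x) - ratPreDeriv f g x - p₂' x) / 2) x :=
    ((((h3.comp x (hasDerivAt_ratMap h1.1)).mul (hasDerivAt_ratDeriv h1.1 h1.2)).sub
      (hasDerivAt_ratPre h1.1 h1.2)).sub h4).div_const 2
  have hθ2 : deriv (deriv θ) x = _ :=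
    (show deriv θ =ᶠ[𝓝 x] fun x => θ x * u x from h7).deriv_eq.trans
      (h2.differentiableAt.hasDerivAt.mul hux).deriv
  rw [hθ2, h7.self_of_nhds] at h6
  apply mul_left_cancel₀ (hθ0 x)
  simp only [hu] at h6 ⊢
  linear_combination 2 * h6

lemma wronskian_num_denom_ne_zero {φ : RatFunc ℂ} (hφ : ∀ k : ℂ, φ ≠ RatFunc.C k) :
    wronskian φ.num φ.denom ≠ 0 := by
  intro h
  obtain ⟨h1, h2⟩ := (RatFunc.isCoprime_num_denom φ).wronskian_eq_zero_iff.1 h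
  obtain ⟨k, hk⟩ := natDegree_eq_zero.1 (derivative_eq_zero.1 h1)
  obtain ⟨l, hl⟩ := natDegree_eq_zero.1 (derivative_eq_zero.1 h2)
  apply hφ (k / l)
  rw [← RatFunc.num_div_denom φ, ← hk, ← hl]
  simp

/-- The invariant of Heun's equation has no poles outside `{0, 1, t}`. -/
theorem schwarzRegular_of_pullback {A B C t q a b c d : ℂ} {φ : RatFunc ℂ}
    (hφ : ∀ k : ℂ, φ ≠ RatFunc.C k) {R : RadicalFunction}
    (hpull : IsPullbackTransformation (hypergeometricEq A B C) (heunEq t q a b c d) φ R) :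
    SchwarzRegular {0, 1, t} (1 - (1 - C) ^ 2) (1 - (C - A - B) ^ 2) (1 - (A - B) ^ 2)
      φ.num (φ.denom - φ.num) (-φ.denom) := by
  set f := φ.num with hf
  set g := φ.denom with hg
  have hW : wronskian f g ≠ 0 := wronskian_num_denom_ne_zero hφ
  have hf0 : f ≠ 0 := by rintro h; simp [h] at hW
  have hg0 : g ≠ 0 := by rintro h; simp [h] at hW
  have hgf0 : g - f ≠ 0 := by
    intro h
    rw [sub_eq_zero.1 h, wronskian_self_eq_zero] at hW
    exact hW rfl
  set P : ℂ[X] := X * (X - Polynomial.C 1) * (X - Polynomial.C t) with hP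
  have hP0 : P ≠ 0 := mul_ne_zero (mul_ne_zero X_ne_zero (X_sub_C_ne_zero _)) (X_sub_C_ne_zero _)
  -- The zeros of this non-zero polynomial include every point where one of the two equations, `φ`,
  -- a factor of `θ` or the local inversion of `φ` could fail to be regular. Any non-root is a
  -- suitable base point.
  set bad : ℂ[X] := P * (f * g * (g - f) * wronskian f g) *
    ∏ i, ((R.base i).num * (R.base i).denom) with hbad
  have hbad0 : bad ≠ 0 := by
    refine mul_ne_zero (mul_ne_zero hP0 (mul_ne_zero (mul_ne_zero (mul_ne_zero hf0 hg0) hgf0) hW)) ?_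
    refine Finset.prod_ne_zero_iff.2 fun i _ => mul_ne_zero ?_ (RatFunc.denom_ne_zero _)
    exact RatFunc.num_ne_zero (R.base_ne_zero i)
  obtain ⟨x₀, hx₀⟩ := exists_eval_ne_zero_of_natDegree_lt_card bad hbad0 (by
    rw [Cardinal.mk_complex]; exact Cardinal.nat_lt_continuum _)
  have hx₀' := hx₀
  simp only [hbad, hP, eval_mul, eval_prod, mul_ne_zero_iff, Finset.prod_ne_zero_iff, eval_sub,
    eval_X, eval_C, sub_ne_zero] at hx₀'
  obtain ⟨⟨⟨⟨hx0, hx1⟩, hxt⟩, ⟨⟨hfx, hgx⟩, hgfx⟩, hWx⟩, hbase⟩ := hx₀'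
  obtain ⟨θ, hθb, hθa, hθ0⟩ := R.exists_isBranchAt (x₀ := x₀)
    fun i => hbase i (Finset.mem_univ i)
  have hz0 : f.eval x₀ / g.eval x₀ ≠ 0 := div_ne_zero hfx hgx
  have hz1 : f.eval x₀ / g.eval x₀ ≠ 1 := by
    rw [Ne, div_eq_one_iff_eq hgx]; exact fun h => hgfx h.symm
  obtain ⟨y₁, hy₁, hy₁0, hy₁1⟩ := exists_isLocalSolution_hypergeometricEq A B C 1 0 hz0 hz1
  obtain ⟨y₂, hy₂, hy₂0, hy₂1⟩ := exists_isLocalSolution_hypergeometricEq A B C 0 1 hz0 hz1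
  have hev : ratEval φ = fun x => f.eval x / g.eval x := funext (ratEval_eq φ)
  have pull : ∀ y, (hypergeometricEq A B C).IsLocalSolution y (f.eval x₀ / g.eval x₀) →
      (heunEq t q a b c d).IsLocalSolution (fun x => θ x * y (f.eval x / g.eval x)) x₀ := by
    intro y hy
    have h1 := analyticAt_hypergeometricEq A B C hz0 hz1
    have h2 := analyticAt_heunEq t q a b c d hx0 hx1 hxt
    have := hpull x₀ hgx (by rw [hev]; exact h1.1) (by rw [hev]; exact h1.2) h2.1 h2.2 θ hθb y
      (by rw [hev]; exact hy)
    rw [hev] at this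
    exact this
  have hinv := invariant_of_pullback hgx hWx hθa hθ0 hy₁ hy₂ (by simp [hy₁0, hy₁1, hy₂0, hy₂1])
    (p₁' := fun z => -C / z ^ 2 + -(A + B - C + 1) / (z - 1) ^ 2)
    (p₂' := fun x => -c / x ^ 2 + -d / (x - 1) ^ 2 + -(a + b - c - d + 1) / (x - t) ^ 2)
    (by filter_upwards [isOpen_ne.mem_nhds hz0, isOpen_ne.mem_nhds hz1] with z h0 h1 using
          hasDerivAt_hypergeometricEq_p A B C h0 h1)
    (by filter_upwards [isOpen_ne.mem_nhds hx0, isOpen_ne.mem_nhds hx1, isOpen_ne.mem_nhds hxt]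
          with x h0 h1 ht using hasDerivAt_heunEq_p t q a b c d h0 h1 ht)
    (pull y₁ hy₁) (pull y₂ hy₂)
  set Sch := schwarzPoly (1 - (1 - C) ^ 2) (1 - (C - A - B) ^ 2) (1 - (A - B) ^ 2)
      f (g - f) (-g) with hSch
  set WP := wronskian f (g - f) ^ 2 * (f * (g - f) * (-g)) ^ 2 with hWP
  -- The two sides agree on a neighbourhood of `x₀` apart from nothing that matters for polynomials:
  -- infinitely many points are enough. The local relation thus becomes global.
  have hpoly : P ^ 2 * Sch = WP * heunNum t q a b c d := by
    refine eq_of_infinite_eval_eq _ _ (Set.Infinite.mono ?_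
      (infinite_of_mem_nhds x₀ (Filter.inter_mem hinv
        ((analyticAt_eval bad x₀).continuousAt.eventually_ne hx₀))))
    rintro x ⟨hx, hxb⟩
    simp only [Set.mem_ofPred_eq] at hx hxb ⊢
    have hxb' := hxb
    simp only [hbad, hP, eval_mul, eval_prod, mul_ne_zero_iff, Finset.prod_ne_zero_iff, eval_sub,
      eval_X, eval_C, sub_ne_zero] at hxb'
    obtain ⟨⟨⟨⟨hx0, hx1⟩, hxt⟩, ⟨⟨hfx, hgx⟩, hgfx⟩, hWx⟩, -⟩ := hxb'
    have hz0 : f.eval x / g.eval x ≠ 0 := div_ne_zero hfx hgx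
    have hz1 : f.eval x / g.eval x ≠ 1 := by
      rw [Ne, div_eq_one_iff_eq hgx]; exact fun h => hgfx h.symm
    rw [eval_mul, eval_mul, ← heunEq_invariant t q a b c d hx0 hx1 hxt, hx,
      hypergeometricEq_invariant A B C hz0 hz1,
      schwarzPoly_eval hfx hgx (by rw [eval_sub]; exact sub_ne_zero.2 hgfx) hWx]
    ring
  intro x hx k hk
  simp only [Set.mem_insert_iff, Set.mem_singleton_iff, not_or] at hx
  have hcop : IsCoprime ((X - Polynomial.C x) ^ k) (P ^ 2) := by
    refine IsCoprime.pow ?_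
    rw [(irreducible_X_sub_C x).coprime_iff_not_dvd, dvd_iff_isRoot]
    simp only [hP, IsRoot.def, eval_mul, eval_sub, eval_X, eval_C, mul_eq_zero, sub_eq_zero]
    exact fun h => h.elim (fun h => h.elim hx.1 hx.2.1) hx.2.2
  refine hcop.dvd_of_dvd_mul_left ?_
  rw [hpoly]
  exact hk.mul_right _

/-- A branching point that is not above `0, 1, ∞`, seen on the Wronskian. -/
lemma wronskian_of_branching {φ : RatFunc ℂ} (hφ : ∀ k : ℂ, φ ≠ RatFunc.C k) {S : OnePoint ℂ}
    (hbranch : 2 ≤ branchingIndex φ S) (hS : projMap φ S ∉ sing) :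
    (∃ S, (wronskian φ.num (φ.denom - φ.num)).eval S = 0 ∧
        (φ.num * (φ.denom - φ.num) * (-φ.denom)).eval S ≠ 0) ∨
      ((φ.denom - φ.num).natDegree = φ.num.natDegree ∧ (-φ.denom).natDegree = φ.num.natDegree ∧
        (wronskian φ.num (φ.denom - φ.num)).natDegree + 3 ≤ 2 * φ.num.natDegree) := by
  have hW0 := wronskian_num_denom_ne_zero hφ
  have hg0 := RatFunc.denom_ne_zero φ
  have hWeq : wronskian φ.num (φ.denom - φ.num) = wronskian φ.num φ.denom := by
    simp only [wronskian, derivative_sub]; ring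
  rw [hWeq]
  have hWk : ∀ k : ℂ, wronskian φ.num φ.denom = wronskian (φ.num - C k * φ.denom) φ.denom := by
    intro k
    simp only [wronskian, derivative_sub, derivative_mul, derivative_C]; ring
  simp only [sing, Set.mem_insert_iff, Set.mem_singleton_iff, not_or] at hS
  induction S using OnePoint.rec with
  | infty =>
    right
    simp only [branchingIndex] at hbranch
    by_cases hlt : φ.denom.natDegree < φ.num.natDegree
    · exact absurd (by simp [projMap, hlt]) hS.2.2
    set k := φ.num.coeff φ.denom.natDegree with hk
    have hproj : projMap φ ∞ = ((k : ℂ) : OnePoint ℂ) := by simp [projMap, hlt, hk]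
    rw [hproj] at hS hbranch
    have hk0 : k ≠ 0 := by simpa [OnePoint.coe_eq_coe] using hS.1
    have hk1 : k ≠ 1 := by simpa [OnePoint.coe_eq_coe] using hS.2.1
    have hdeg : φ.num.natDegree = φ.denom.natDegree :=
      le_antisymm (not_lt.1 hlt) (le_natDegree_of_ne_zero hk0)
    -- The denominator is monic, so `k` is the value of `φ` at infinity and `1 - k ≠ 0` is the top
    -- coefficient of `φ.denom - φ.num`.
    have hmonic : φ.denom.coeff φ.denom.natDegree = 1 := RatFunc.monic_denom φ
    have hsub : (φ.denom - φ.num).natDegree = φ.num.natDegree := by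
      apply le_antisymm
      · refine (natDegree_sub_le _ _).trans ?_
        simp [hdeg]
      · rw [hdeg]
        apply le_natDegree_of_ne_zero
        rw [coeff_sub, hmonic, ← hk]
        exact sub_ne_zero.2 hk1.symm
    refine ⟨hsub, by rw [natDegree_neg, hdeg], ?_⟩
    have hcov : covDegree φ = φ.num.natDegree := by simp [covDegree, hdeg]
    have hfib : fibrePoly φ (k : OnePoint ℂ) = φ.num - C k * φ.denom := rfl
    rw [hcov, hfib] at hbranch
    -- Branching at infinity lowers the degree of `φ.num - k φ.denom` by at least two. The Wronskian
    -- has degree strictly below the sum of the degrees, which accounts for the third unit in `+ 3`.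
    have := natDegree_wronskian_lt_add (hWk k ▸ hW0)
    rw [← hWk k] at this
    omega
  | coe x =>
    left
    by_cases hd : φ.denom.eval x = 0
    · exact absurd (by simp [projMap, hd]) hS.2.2
    set k := ratEval φ x with hk
    have hproj : projMap φ (x : OnePoint ℂ) = ((k : ℂ) : OnePoint ℂ) := by simp [projMap, hd, hk]
    rw [hproj] at hS
    have hk0 : k ≠ 0 := by simpa [OnePoint.coe_eq_coe] using hS.1
    have hk1 : k ≠ 1 := by simpa [OnePoint.coe_eq_coe] using hS.2.1
    rw [hk, ratEval_eq] at hk0 hk1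
    have hfib : branchingIndex φ (x : OnePoint ℂ)
      = (φ.num - C k * φ.denom).rootMultiplicity x := by
      simp only [branchingIndex, hproj]
      rfl
    rw [hfib] at hbranch
    obtain ⟨u, hu⟩ := (pow_dvd_pow (X - C x) hbranch).trans (pow_rootMultiplicity_dvd _ _)
    refine ⟨x, ?_, ?_⟩
    · rw [hWk k, hu, wronskian]
      simp [derivative_pow]
    · have h1 : φ.num.eval x ≠ 0 := fun h => hk0 (by simp [h])
      have h2 : φ.denom.eval x - φ.num.eval x ≠ 0 := fun h => hk1 (by
        rw [← sub_eq_zero.1 h, div_self hd])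
      simpa [h1, hd] using h2

/-! ### Local exponents and relevant singularities -/

namespace LinODE

lemma HasLocalExponents.symm {E : LinODE} {s : OnePoint ℂ} {e₁ e₂ : ℂ}
    (h : E.HasLocalExponents s e₁ e₂) : E.HasLocalExponents s e₂ e₁ := by
  induction s using OnePoint.rec with
  | infty =>
    obtain ⟨p, q, h1, h2, h3⟩ := h
    exact ⟨p, q, h1, h2, h3.trans (mul_comm _ _)⟩
  | coe x =>
    obtain ⟨p, q, h1, h2, h3⟩ := h
    exact ⟨p, q, h1, h2, h3.trans (mul_comm _ _)⟩

lemma HasLocalExponents.hasExponentDifference {E : LinODE} {s : OnePoint ℂ} {e₁ e₂ δ : ℂ}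
    (h : E.HasLocalExponents s e₁ e₂) (hδ : (e₁ - e₂) ^ 2 = δ ^ 2) :
    E.HasExponentDifference s δ := by
  rcases sq_eq_sq_iff_eq_or_eq_neg.1 hδ with h' | h'
  · exact ⟨e₁, e₂, h, h'⟩
  · exact ⟨e₂, e₁, h.symm, by linear_combination -h'⟩

lemma sub_sq_eq_of_factor_eq {e₁ e₂ e₁' e₂' : ℂ}
    (h : ((X - C e₁) * (X - C e₂) : ℂ[X]) = (X - C e₁') * (X - C e₂')) :
    (e₁ - e₂) ^ 2 = (e₁' - e₂') ^ 2 := by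
  have h0 := congrArg (eval 0) h
  have h1 := congrArg (eval 1) h
  simp only [eval_mul, eval_sub, eval_X, eval_C] at h0 h1
  have hs : e₁ + e₂ = e₁' + e₂' := by linear_combination h0 - h1
  linear_combination (e₁ + e₂ + e₁' + e₂') * hs - 4 * h0

lemma HasLocalExponents.sub_sq_eq {E : LinODE} {s : OnePoint ℂ} {e₁ e₂ e₁' e₂' : ℂ}
    (h : E.HasLocalExponents s e₁ e₂) (h' : E.HasLocalExponents s e₁' e₂') :
    (e₁ - e₂) ^ 2 = (e₁' - e₂') ^ 2 := by
  induction s using OnePoint.rec with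
  | infty =>
    obtain ⟨p, q, h1, h2, h3⟩ := h
    obtain ⟨p', q', h1', h2', h3'⟩ := h'
    rw [tendsto_nhds_unique h1 h1', tendsto_nhds_unique h2 h2'] at h3
    exact sub_sq_eq_of_factor_eq (h3.symm.trans h3')
  | coe x =>
    obtain ⟨p, q, h1, h2, h3⟩ := h
    obtain ⟨p', q', h1', h2', h3'⟩ := h'
    rw [tendsto_nhds_unique h1 h1', tendsto_nhds_unique h2 h2'] at h3
    exact sub_sq_eq_of_factor_eq (h3.symm.trans h3')

/-- Solutions at an ordinary point start with `1` or with the local parameter. Hence a point whose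
exponent difference is not `±1` cannot be ordinary, and relevance can be read off the exponents. -/
lemma IsOrdinaryPoint.hasLocalExponents {E : LinODE} {s : OnePoint ℂ} (h : E.IsOrdinaryPoint s) :
    E.HasLocalExponents s 1 0 := by
  induction s using OnePoint.rec with
  | infty =>
    obtain ⟨a, b, ha, hb, hab⟩ := h
    have hid : Tendsto (fun w : ℂ => w) (𝓝[≠] 0) (𝓝 0) := tendsto_nhdsWithin_of_tendsto_nhds tendsto_id
    have ha' := ha.continuousAt.tendsto.mono_left (nhdsWithin_le_nhds (s := {0}ᶜ))
    have hb' := hb.continuousAt.tendsto.mono_left (nhdsWithin_le_nhds (s := {0}ᶜ))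
    have hne : ∀ᶠ w in 𝓝[≠] (0 : ℂ), w ≠ 0 := eventually_mem_nhdsWithin
    have h1 : Tendsto (fun w : ℂ => w⁻¹ * E.p w⁻¹) (𝓝[≠] 0) (𝓝 2) := by
      have := (tendsto_const_nhds (x := (2 : ℂ))).sub (hid.mul ha')
      rw [zero_mul, sub_zero] at this
      refine this.congr' ?_
      filter_upwards [hab, hne] with w hw hw0
      rw [← hw.1]
      field_simp
      ring
    have h2 : Tendsto (fun w : ℂ => w⁻¹ ^ 2 * E.q w⁻¹) (𝓝[≠] 0) (𝓝 0) := by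
      have := (hid.pow 2).mul hb'
      rw [zero_pow two_ne_zero, zero_mul] at this
      refine this.congr' ?_
      filter_upwards [hab, hne] with w hw hw0
      rw [← hw.2]
      field_simp
    refine ⟨2, 0, ?_, ?_, ?_⟩
    · simpa [Function.comp_def] using h1.comp tendsto_inv₀_cobounded'
    · simpa [Function.comp_def] using h2.comp tendsto_inv₀_cobounded'
    · simp only [map_ofNat, map_zero, map_one]; ring
  | coe x =>
    obtain ⟨a, b, ha, hb, hab⟩ := h
    have hid : Tendsto (fun w : ℂ => w - x) (𝓝[≠] x) (𝓝 0) := by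
      have : Tendsto (fun w : ℂ => w - x) (𝓝 x) (𝓝 (x - x)) :=
        (continuous_id.sub continuous_const).tendsto x
      rw [sub_self] at this
      exact tendsto_nhdsWithin_of_tendsto_nhds this
    have ha' := ha.continuousAt.tendsto.mono_left (nhdsWithin_le_nhds (s := {x}ᶜ))
    have hb' := hb.continuousAt.tendsto.mono_left (nhdsWithin_le_nhds (s := {x}ᶜ))
    refine ⟨0, 0, ?_, ?_, ?_⟩
    · have := hid.mul ha'
      rw [zero_mul] at this
      refine this.congr' ?_
      filter_upwards [hab] with w hw
      rw [hw.1]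
    · have := (hid.pow 2).mul hb'
      rw [zero_pow two_ne_zero, zero_mul] at this
      refine this.congr' ?_
      filter_upwards [hab] with w hw
      rw [hw.2]
    · simp only [map_zero, map_one]; ring

lemma HasLocalExponents.isRelevantSingularity {E : LinODE} {s : OnePoint ℂ} {e₁ e₂ : ℂ}
    (h : E.HasLocalExponents s e₁ e₂) (hne : (e₁ - e₂) ^ 2 ≠ 1) : E.IsRelevantSingularity s := by
  refine ⟨fun ho => hne ?_, fun ⟨_, _, hd⟩ => hne ?_⟩
  · simpa using h.sub_sq_eq ho.hasLocalExponents
  · obtain ⟨e₁', e₂', h', hd⟩ := hd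
    rw [h.sub_sq_eq h', hd, one_pow]

lemma not_isRelevantSingularity_of_isNonlogarithmic {E : LinODE} {s : OnePoint ℂ} {e₁ e₂ : ℂ}
    (h : E.HasLocalExponents s e₁ e₂) (he : (e₁ - e₂) ^ 2 = 1) (hn : E.IsNonlogarithmic s) :
    ¬ E.IsRelevantSingularity s :=
  fun ⟨h1, h2⟩ => h2 ⟨h1, hn, h.hasExponentDifference (by rw [he, one_pow])⟩

lemma holdsAt_of_hasDerivAt {E : LinODE} {y y₁ : ℂ → ℂ} {y₂ z : ℂ}
    (h1 : ∀ᶠ w in 𝓝 z, HasDerivAt y (y₁ w) w) (h2 : HasDerivAt y₁ y₂ z)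
    (h : y₂ + E.p z * y₁ z + E.q z * y z = 0) : E.HoldsAt y z := by
  have : deriv y =ᶠ[𝓝 z] y₁ := by filter_upwards [h1] with w hw using hw.deriv
  rw [HoldsAt, this.deriv_eq, h2.deriv, this.self_of_nhds, h]

/-- For `y' = m y` the equation reduces to the Riccati equation for `m`. -/
lemma holdsAt_of_logDeriv {E : LinODE} {y m : ℂ → ℂ} {m' z : ℂ}
    (h1 : ∀ᶠ w in 𝓝 z, HasDerivAt y (m w * y w) w) (h2 : HasDerivAt m m' z)
    (h : m' + m z ^ 2 + E.p z * m z + E.q z = 0) : E.HoldsAt y z := by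
  refine holdsAt_of_hasDerivAt h1 (h2.mul h1.self_of_nhds) ?_
  linear_combination y z * h

end LinODE

/-! ### Singular points of the hypergeometric equation -/

lemma hypergeometricEq_comm (A B C : ℂ) : hypergeometricEq A B C = hypergeometricEq B A C := by
  simp only [hypergeometricEq]
  congr 1
  · funext z; ring
  · funext z; ring

lemma tendsto_div_sub_one : Tendsto (fun z : ℂ => z / (z - 1)) (𝓝[≠] 0) (𝓝 0) := by
  have : ContinuousAt (fun z : ℂ => z / (z - 1)) 0 :=
    continuousAt_id.div (continuousAt_id.sub continuousAt_const) (by simp)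
  simpa using this.tendsto.mono_left nhdsWithin_le_nhds

lemma hasLocalExponents_zero (A B C : ℂ) :
    (hypergeometricEq A B C).HasLocalExponents ((0 : ℂ) : OnePoint ℂ) 0 (1 - C) := by
  have hne : ∀ᶠ w in 𝓝[≠] (0 : ℂ), w ≠ 0 := eventually_mem_nhdsWithin
  refine ⟨C, 0, ?_, ?_, ?_⟩
  · have := (tendsto_div_sub_one.const_mul (A + B - C + 1)).const_add C
    rw [mul_zero, add_zero] at this
    refine this.congr' ?_
    filter_upwards [hne] with z hz
    simp only [hypergeometricEq, sub_zero]
    field_simp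
  · have := tendsto_div_sub_one.const_mul (A * B)
    rw [mul_zero] at this
    refine this.congr' ?_
    filter_upwards [hne] with z hz
    simp only [hypergeometricEq, sub_zero]
    field_simp
  · simp only [map_sub, map_zero, map_one]; ring

lemma hasLocalExponents_one (A B C : ℂ) :
    (hypergeometricEq A B C).HasLocalExponents ((1 : ℂ) : OnePoint ℂ) 0 (C - A - B) := by
  have hne : ∀ᶠ w in 𝓝[≠] (1 : ℂ), w - 1 ≠ 0 := by
    filter_upwards [eventually_mem_nhdsWithin] with w hw using sub_ne_zero.2 hw
  have ht : Tendsto (fun z : ℂ => (z - 1) / z) (𝓝[≠] 1) (𝓝 0) := by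
    have : ContinuousAt (fun z : ℂ => (z - 1) / z) 1 :=
      (continuousAt_id.sub continuousAt_const).div continuousAt_id (by simp)
    simpa using this.tendsto.mono_left nhdsWithin_le_nhds
  refine ⟨A + B - C + 1, 0, ?_, ?_, ?_⟩
  · have := (ht.const_mul C).const_add (A + B - C + 1)
    rw [mul_zero, add_zero] at this
    refine this.congr' ?_
    filter_upwards [hne] with z hz
    simp only [hypergeometricEq]
    field_simp
    ring
  · have := ht.const_mul (A * B)
    rw [mul_zero] at this
    refine this.congr' ?_
    filter_upwards [hne] with z hz
    simp only [hypergeometricEq]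
    field_simp
  · simp only [map_sub, map_zero, map_one, map_add]; ring

lemma hasLocalExponents_infty (A B C : ℂ) :
    (hypergeometricEq A B C).HasLocalExponents ∞ A B := by
  have hinv : Tendsto (fun z : ℂ => z⁻¹) (Bornology.cobounded ℂ) (𝓝 0) := tendsto_inv₀_cobounded
  have hne : ∀ᶠ z : ℂ in Bornology.cobounded ℂ, z⁻¹ ≠ 0 ∧ z⁻¹ ≠ 1 :=
    ((tendsto_inv₀_cobounded' (α := ℂ)).eventually eventually_mem_nhdsWithin).and
      (hinv.eventually_ne zero_ne_one)
  have ht : Tendsto (fun z : ℂ => z / (z - 1)) (Bornology.cobounded ℂ) (𝓝 1) := by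
    have := ((tendsto_const_nhds (x := (1 : ℂ))).sub hinv).inv₀ (by simp)
    rw [sub_zero, inv_one] at this
    refine this.congr' ?_
    filter_upwards [hne] with z hz
    have hz0 : z ≠ 0 := fun h => hz.1 (by simp [h])
    rw [← inv_div, sub_div, div_self hz0, one_div]
  refine ⟨A + B + 1, A * B, ?_, ?_, ?_⟩
  · have := (ht.const_mul (A + B - C + 1)).const_add C
    rw [mul_one] at this
    convert this.congr' ?_ using 2
    · ring
    filter_upwards [hne] with z hz
    have hz0 : z ≠ 0 := fun h => hz.1 (by simp [h])
    simp only [hypergeometricEq]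
    field_simp
  · have := ht.const_mul (A * B)
    rw [mul_one] at this
    refine this.congr' ?_
    filter_upwards [hne] with z hz
    have hz0 : z ≠ 0 := fun h => hz.1 (by simp [h])
    simp only [hypergeometricEq]
    field_simp
  · simp only [map_mul, map_one, map_add]; ring

lemma isOrdinaryPoint_of_ne {A B C : ℂ} {z : ℂ} (h0 : z ≠ 0) (h1 : z ≠ 1) :
    (hypergeometricEq A B C).IsOrdinaryPoint (z : OnePoint ℂ) :=
  ⟨_, _, (analyticAt_hypergeometricEq A B C h0 h1).1, (analyticAt_hypergeometricEq A B C h0 h1).2,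
    Eventually.of_forall fun _ => ⟨rfl, rfl⟩⟩

lemma ncard_relevant_eq_two {E : LinODE} {s s₁ s₂ : OnePoint ℂ} (hE : ∀ w ∉ sing, E.IsOrdinaryPoint w)
    (hs : sing = {s, s₁, s₂}) (hne : s₁ ≠ s₂) (h : ¬ E.IsRelevantSingularity s)
    (h1 : E.IsRelevantSingularity s₁) (h2 : E.IsRelevantSingularity s₂) :
    {s : OnePoint ℂ | E.IsRelevantSingularity s}.ncard = 2 := by
  have : {s : OnePoint ℂ | E.IsRelevantSingularity s} = {s₁, s₂} := by
    ext w
    simp only [Set.mem_ofPred_eq, Set.mem_insert_iff, Set.mem_singleton_iff]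
    constructor
    · intro hw
      have hwS : w ∈ sing := by
        by_contra hn
        exact hw.1 (hE w hn)
      rw [hs] at hwS
      rcases hwS with rfl | hwS
      · exact absurd hw h
      · exact hwS
    · rintro (rfl | rfl)
      exacts [h1, h2]
  rw [this, Set.ncard_pair hne]

lemma isOrdinaryPoint_of_notMem_sing {A B C : ℂ} (w : OnePoint ℂ) (hw : w ∉ sing) :
    (hypergeometricEq A B C).IsOrdinaryPoint w := by
  simp only [sing, Set.mem_insert_iff, Set.mem_singleton_iff, not_or] at hw
  induction w using OnePoint.rec with
  | infty => exact absurd rfl hw.2.2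
  | coe x =>
    exact isOrdinaryPoint_of_ne (by simpa [OnePoint.coe_eq_coe] using hw.1)
      (by simpa [OnePoint.coe_eq_coe] using hw.2.1)

/-- A primitive of `(1 + ε z) ^ (-B)`. -/
lemma exists_primitive_cpow (ε B : ℂ) (hε : ‖ε‖ ≤ 1) : ∃ v : ℂ → ℂ, v 0 = 1 ∧
    ∀ z ∈ Metric.ball (0 : ℂ) 1, 1 + ε * z ∈ Complex.slitPlane ∧
      HasDerivAt v ((1 + ε * z) ^ (-B)) z := by
  have hs : ∀ z ∈ Metric.ball (0 : ℂ) 1, 1 + ε * z ∈ Complex.slitPlane := by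
    intro z hz
    apply Complex.mem_slitPlane_of_norm_lt_one
    rw [mem_ball_zero_iff] at hz
    rw [norm_mul]
    nlinarith [norm_nonneg ε, norm_nonneg z]
  have hd : DifferentiableOn ℂ (fun z => (1 + ε * z) ^ (-B)) (Metric.ball 0 1) := by
    intro z hz
    have : DifferentiableAt ℂ (fun z => 1 + ε * z) z := by fun_prop
    exact (this.cpow (differentiableAt_const _) (hs z hz)).differentiableWithinAt
  obtain ⟨v, hv0, hv⟩ := hd.isExactOn_ball.with_val_at 0 1
  exact ⟨v, hv0, fun z hz => ⟨hs z hz, hv z hz⟩⟩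

lemma hasDerivAt_one_add_cpow {ε B z : ℂ} (hz : 1 + ε * z ∈ Complex.slitPlane) :
    HasDerivAt (fun z => (1 + ε * z) ^ (-B)) (-B * ε / (1 + ε * z) * (1 + ε * z) ^ (-B)) z := by
  have h1 : HasDerivAt (fun z => 1 + ε * z) ε z := by
    simpa using ((hasDerivAt_id z).const_mul ε).const_add 1
  refine (h1.cpow_const hz).congr_deriv ?_
  rw [Complex.cpow_sub _ _ (Complex.slitPlane_ne_zero hz), Complex.cpow_one]
  ring

lemma not_eventuallyEq_one_of_hasDerivAt {v : ℂ → ℂ} {v' : ℂ} (h : HasDerivAt v v' 0)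
    (hv : v' ≠ 0) : ¬ ((fun _ => (1 : ℂ)) =ᶠ[𝓝 0] v) := by
  intro he
  apply hv
  rw [← h.deriv, ← he.deriv_eq, deriv_const]

section Nonlogarithmic

lemma isFrobeniusSolution_neg_one {E : LinODE} {s : ℂ} {h h₁ h₂ : ℂ → ℂ} (h0 : h 0 = 1)
    (hd : ∀ τ ∈ Metric.ball (0 : ℂ) 1, HasDerivAt h (h₁ τ) τ)
    (hd₁ : ∀ τ ∈ Metric.ball (0 : ℂ) 1, HasDerivAt h₁ (h₂ τ) τ)
    (heq : ∀ τ ∈ Metric.ball (0 : ℂ) 1, τ ≠ 0 → h₂ τ / τ - 2 * h₁ τ / τ ^ 2 + 2 * h τ / τ ^ 3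
      + E.p (τ + s) * (h₁ τ / τ - h τ / τ ^ 2) + E.q (τ + s) * (h τ / τ) = 0) :
    E.IsFrobeniusSolution (s : OnePoint ℂ) (-1) h := by
  have hball : Metric.ball (0 : ℂ) 1 ∈ 𝓝 (0 : ℂ) := Metric.ball_mem_nhds _ one_pos
  refine ⟨DifferentiableOn.analyticAt (s := Metric.ball 0 1)
    (fun τ hτ => (hd τ hτ).differentiableAt.differentiableWithinAt) hball, h0, ?_⟩
  have hev : ∀ᶠ τ in 𝓝[Complex.slitPlane] (0 : ℂ), τ ∈ Metric.ball (0 : ℂ) 1 ∧ τ ≠ 0 := by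
    filter_upwards [nhdsWithin_le_nhds hball, eventually_mem_nhdsWithin] with τ h1 h2
    exact ⟨h1, Complex.slitPlane_ne_zero h2⟩
  filter_upwards [tendsto_comap.eventually hev] with z hz
  change z - s ∈ _ ∧ z - s ≠ 0 at hz
  change E.HoldsAt (fun z => (z - s) ^ (-1 : ℂ) * h (z - s)) z
  have hopen : ∀ᶠ w in 𝓝 z, w - s ∈ Metric.ball (0 : ℂ) 1 ∧ w - s ≠ 0 := by
    have hc : ContinuousAt (fun w : ℂ => w - s) z := continuousAt_id.sub continuousAt_const
    exact (hc.eventually (Metric.isOpen_ball.mem_nhds hz.1)).and (hc.eventually_ne hz.2)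
  have hinv : ∀ w, w - s ≠ 0 → HasDerivAt (fun w => (w - s)⁻¹) (-1 / (w - s) ^ 2) w := fun w hw =>
    ((hasDerivAt_id w).sub_const s).inv hw
  have hsh : ∀ w, w - s ∈ Metric.ball (0 : ℂ) 1 → HasDerivAt (fun w => h (w - s)) (h₁ (w - s)) w :=
    fun w hw => HasDerivAt.comp_sub_const w s (hd _ hw)
  have hsh₁ : ∀ w, w - s ∈ Metric.ball (0 : ℂ) 1 →
      HasDerivAt (fun w => h₁ (w - s)) (h₂ (w - s)) w :=
    fun w hw => HasDerivAt.comp_sub_const w s (hd₁ _ hw)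
  refine LinODE.holdsAt_of_hasDerivAt (y₁ := fun w => -(w - s)⁻¹ * (w - s)⁻¹ * h (w - s)
    + (w - s)⁻¹ * h₁ (w - s)) ?_
    (((((hinv z hz.2).neg).mul (hinv z hz.2)).mul (hsh z hz.1)).add
      ((hinv z hz.2).mul (hsh₁ z hz.1))) ?_
  · filter_upwards [hopen] with w hw
    simp only [Complex.cpow_neg_one]
    refine ((hinv w hw.2).mul (hsh w hw.1)).congr_deriv ?_
    field_simp
  · have := heq _ hz.1 hz.2
    rw [sub_add_cancel] at this
    simp only [Complex.cpow_neg_one, Pi.mul_apply, Pi.neg_apply]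
    rw [← this]
    have hz2 := hz.2
    generalize E.p z = P
    generalize E.q z = Q
    generalize z - s = τ at *
    field_simp
    ring

/-- Reduction of order. The first condition says that `1/τ` is a solution. The second says that `v'
= (1 + ετ)^(-B)` satisfies the first-order equation making `v/τ` a solution. Both begin with
exponent `-1`, and normalising `v 0 = 1` with `v' 0 = 1` makes them distinct. -/
lemma isNonlogarithmic_of_cpow {E : LinODE} {s ε B : ℂ} (hε : ‖ε‖ ≤ 1)
    (h1 : ∀ τ ∈ Metric.ball (0 : ℂ) 1, τ ≠ 0 →
      2 / τ ^ 3 - E.p (τ + s) / τ ^ 2 + E.q (τ + s) / τ = 0)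
    (h2 : ∀ τ ∈ Metric.ball (0 : ℂ) 1, τ ≠ 0 →
      -B * ε / (1 + ε * τ) - 2 / τ + E.p (τ + s) = 0) :
    E.IsNonlogarithmic (s : OnePoint ℂ) := by
  obtain ⟨v, hv0, hv⟩ := exists_primitive_cpow ε B hε
  refine ⟨-1, -1, fun _ => 1, v, ?_, ?_, ?_⟩
  · refine isFrobeniusSolution_neg_one (h₁ := fun _ => 0) (h₂ := fun _ => 0) rfl
      (fun τ _ => hasDerivAt_const _ _) (fun τ _ => hasDerivAt_const _ _) fun τ hτ hτ0 => ?_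
    linear_combination h1 τ hτ hτ0
  · refine isFrobeniusSolution_neg_one hv0 (fun τ hτ => (hv τ hτ).2)
      (fun τ hτ => hasDerivAt_one_add_cpow (hv τ hτ).1) fun τ hτ hτ0 => ?_
    linear_combination v τ * h1 τ hτ hτ0 + (1 + ε * τ) ^ (-B) / τ * h2 τ hτ hτ0
  · rintro ⟨-, h⟩
    refine not_eventuallyEq_one_of_hasDerivAt (hv 0 (Metric.mem_ball_self one_pos)).2 ?_ h
    simp

lemma isNonlogarithmic_zero (B : ℂ) :
    (hypergeometricEq 1 B 2).IsNonlogarithmic ((0 : ℂ) : OnePoint ℂ) := by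
  have hne : ∀ τ ∈ Metric.ball (0 : ℂ) 1, τ - 1 ≠ 0 := by
    rintro τ hτ h
    rw [sub_eq_zero.1 h] at hτ
    simp at hτ
  refine isNonlogarithmic_of_cpow (ε := -1) (B := B) (by simp) (fun τ hτ h0 => ?_)
    (fun τ hτ h0 => ?_)
  · have := hne τ hτ
    simp only [hypergeometricEq, add_zero]
    field_simp
    ring
  · have := hne τ hτ
    have h1 : 1 + -1 * τ = -(τ - 1) := by ring
    simp only [hypergeometricEq, add_zero, h1]
    field_simp
    ring

lemma isNonlogarithmic_one (B : ℂ) :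
    (hypergeometricEq 1 B B).IsNonlogarithmic ((1 : ℂ) : OnePoint ℂ) := by
  have hne : ∀ τ ∈ Metric.ball (0 : ℂ) 1, 1 + τ ≠ 0 := by
    rintro τ hτ h
    rw [eq_neg_of_add_eq_zero_right h] at hτ
    simp at hτ
  refine isNonlogarithmic_of_cpow (ε := 1) (B := B) (by simp) (fun τ hτ h0 => ?_)
    (fun τ hτ h0 => ?_)
  · have := hne τ hτ
    simp only [hypergeometricEq, add_comm τ 1, add_sub_cancel_left]
    field_simp
    ring
  · have := hne τ hτ
    simp only [hypergeometricEq, add_comm τ 1, add_sub_cancel_left, one_mul]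
    field_simp
    ring

/-- In the parameter `τ = 1/z` the powers `z^(1-C)` and `(z-1)^(1-C)` both start with `τ^(C-1)`;
they are solutions, and they differ because `C ≠ 1`. -/
lemma isNonlogarithmic_infty {C : ℂ} (hC : C ≠ 1) :
    (hypergeometricEq C (C - 1) C).IsNonlogarithmic ∞ := by
  have hball : Metric.ball (0 : ℂ) 1 ∈ 𝓝 (0 : ℂ) := Metric.ball_mem_nhds _ one_pos
  have hslit : ∀ τ ∈ Metric.ball (0 : ℂ) 1, 1 + (-1) * τ ∈ Complex.slitPlane := by
    intro τ hτ
    apply Complex.mem_slitPlane_of_norm_lt_one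
    simpa using hτ
  have hev : ∀ᶠ τ in 𝓝[Complex.slitPlane] (0 : ℂ),
      τ ∈ Metric.ball (0 : ℂ) 1 ∧ τ ∈ Complex.slitPlane := by
    filter_upwards [nhdsWithin_le_nhds hball, eventually_mem_nhdsWithin] with τ h1 h2
    exact ⟨h1, h2⟩
  have hopen : ∀ z : ℂ, z⁻¹ ∈ Metric.ball (0 : ℂ) 1 ∧ z⁻¹ ∈ Complex.slitPlane →
      ∀ᶠ w in 𝓝 z, w⁻¹ ∈ Metric.ball (0 : ℂ) 1 ∧ w⁻¹ ∈ Complex.slitPlane := by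
    intro z hz
    have hz0 : z ≠ 0 := fun h => Complex.slitPlane_ne_zero hz.2 (by simp [h])
    have hc : ContinuousAt (fun w : ℂ => w⁻¹) z := continuousAt_inv₀ hz0
    exact (hc.eventually (Metric.isOpen_ball.mem_nhds hz.1)).and
      (hc.eventually (Complex.isOpen_slitPlane.mem_nhds hz.2))
  have hne : ∀ z : ℂ, z⁻¹ ∈ Metric.ball (0 : ℂ) 1 ∧ z⁻¹ ∈ Complex.slitPlane →
      z ≠ 0 ∧ z - 1 ≠ 0 := by
    intro z hz
    refine ⟨fun h => Complex.slitPlane_ne_zero hz.2 (by simp [h]), fun h => ?_⟩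
    rw [sub_eq_zero.1 h] at hz
    simp at hz
  have hpow : ∀ z : ℂ, z⁻¹ ∈ Metric.ball (0 : ℂ) 1 ∧ z⁻¹ ∈ Complex.slitPlane →
      HasDerivAt (fun w : ℂ => w⁻¹ ^ (C - 1)) (-(C - 1) / z * z⁻¹ ^ (C - 1)) z := by
    intro z hz
    have hz0 := (hne z hz).1
    refine ((hasDerivAt_inv hz0).cpow_const hz.2).congr_deriv ?_
    rw [Complex.cpow_sub _ _ (inv_ne_zero hz0), Complex.cpow_one]
    field_simp
  refine ⟨C - 1, C - 1, fun _ => 1, fun τ => (1 + (-1) * τ) ^ (-(C - 1)),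
    ⟨analyticAt_const, rfl, ?_⟩, ⟨?_, by simp, ?_⟩, ?_⟩
  · filter_upwards [tendsto_comap.eventually hev] with z hz
    change z⁻¹ ∈ _ ∧ z⁻¹ ∈ _ at hz
    change LinODE.HoldsAt _ (fun w : ℂ => w⁻¹ ^ (C - 1) * 1) z
    obtain ⟨h0, h1⟩ := hne z hz
    refine LinODE.holdsAt_of_logDeriv (m := fun w => -(C - 1) / (w - 0)) ?_
      (hasDerivAt_const_div_sub _ 0 (by simpa using h0)) ?_
    · filter_upwards [hopen z hz] with w hw
      simpa using hpow w hw
    · simp only [hypergeometricEq, sub_zero]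
      field_simp
      ring
  · have : AnalyticAt ℂ (fun τ : ℂ => 1 + (-1) * τ) 0 := by fun_prop
    exact this.cpow analyticAt_const (hslit 0 (Metric.mem_ball_self one_pos))
  · filter_upwards [tendsto_comap.eventually hev] with z hz
    change z⁻¹ ∈ _ ∧ z⁻¹ ∈ _ at hz
    change LinODE.HoldsAt _ (fun w : ℂ => w⁻¹ ^ (C - 1) * (1 + (-1) * w⁻¹) ^ (-(C - 1))) z
    obtain ⟨h0, h1⟩ := hne z hz
    refine LinODE.holdsAt_of_logDeriv (m := fun w => -(C - 1) / (w - 1)) ?_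
      (hasDerivAt_const_div_sub _ 1 h1) ?_
    · filter_upwards [hopen z hz] with w hw
      obtain ⟨h0, h1⟩ := hne w hw
      have h2 := (hasDerivAt_one_add_cpow (ε := -1) (B := C - 1) (hslit _ hw.1)).comp w
        (hasDerivAt_inv h0)
      refine ((hpow w hw).mul h2).congr_deriv ?_
      have h3 : 1 + -1 * w⁻¹ = (w - 1) / w := by field_simp; ring
      simp only [Function.comp_apply, h3]
      field_simp
      ring
    · simp only [hypergeometricEq]
      field_simp
      ring
  · rintro ⟨-, h⟩
    refine not_eventuallyEq_one_of_hasDerivAt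
      (hasDerivAt_one_add_cpow (hslit 0 (Metric.mem_ball_self one_pos))) ?_ h
    simpa using sub_ne_zero.2 hC

end Nonlogarithmic

section NotRelevant

variable {A B C : ℂ}

/-- Either `C = 0`, and the second hypothesis becomes `AB = 0`, so that the pole at `0` disappears;
or `C = 2`, and it becomes `(A-1)(B-1) = 0`, where an explicit pair of solutions excludes
logarithms. -/
lemma not_isRelevantSingularity_zero (h : (1 - C) ^ 2 = 1) (h' : (C - A - B) ^ 2 = (A - B) ^ 2) :
    ¬ (hypergeometricEq A B C).IsRelevantSingularity ((0 : ℂ) : OnePoint ℂ) := by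
  have hC : C * (C - 2) = 0 := by linear_combination h
  rcases mul_eq_zero.1 hC with rfl | hC
  · refine fun hr => hr.1 ?_
    have hAB : A * B = 0 := by linear_combination h' / 4
    refine ⟨fun z => (A + B + 1) / (z - 1), fun _ => 0, ?_, analyticAt_const,
      Eventually.of_forall fun z => ?_⟩
    · exact analyticAt_const.div (analyticAt_id.sub analyticAt_const) (by simp)
    · simp [hypergeometricEq, hAB]
  · obtain rfl : C = 2 := sub_eq_zero.1 hC
    have hAB : (A - 1) * (B - 1) = 0 := by linear_combination h' / 4
    refine LinODE.not_isRelevantSingularity_of_isNonlogarithmic (hasLocalExponents_zero A B 2)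
      (by norm_num) ?_
    rcases mul_eq_zero.1 hAB with hA | hB
    · rw [sub_eq_zero.1 hA]
      exact isNonlogarithmic_zero B
    · rw [sub_eq_zero.1 hB, hypergeometricEq_comm]
      exact isNonlogarithmic_zero A

lemma not_isRelevantSingularity_one (h : (C - A - B) ^ 2 = 1) (h' : (A - B) ^ 2 = (1 - C) ^ 2) :
    ¬ (hypergeometricEq A B C).IsRelevantSingularity ((1 : ℂ) : OnePoint ℂ) := by
  have hC : (C - (A + B + 1)) * (C - (A + B - 1)) = 0 := by linear_combination h
  rcases mul_eq_zero.1 hC with hC | hC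
  · refine fun hr => hr.1 ?_
    obtain rfl : C = A + B + 1 := sub_eq_zero.1 hC
    have hAB : A * B = 0 := by linear_combination -h' / 4
    refine ⟨fun z => (A + B + 1) / z, fun _ => 0, ?_, analyticAt_const,
      Eventually.of_forall fun z => ?_⟩
    · exact analyticAt_const.div analyticAt_id (by simp)
    · simp [hypergeometricEq, hAB]
  · obtain rfl : C = A + B - 1 := sub_eq_zero.1 hC
    have hAB : (A - 1) * (B - 1) = 0 := by linear_combination -h' / 4
    refine LinODE.not_isRelevantSingularity_of_isNonlogarithmic (hasLocalExponents_one A B _)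
      (by linear_combination h) ?_
    rcases mul_eq_zero.1 hAB with hA | hB
    · rw [sub_eq_zero.1 hA, add_sub_cancel_left]
      exact isNonlogarithmic_one B
    · rw [sub_eq_zero.1 hB, hypergeometricEq_comm, add_sub_cancel_right]
      exact isNonlogarithmic_one A

lemma isOrdinaryPoint_infty : (hypergeometricEq 1 0 C).IsOrdinaryPoint ∞ := by
  refine ⟨fun w => -(2 - C) / (1 - w), fun _ => 0, ?_, analyticAt_const, ?_⟩
  · exact analyticAt_const.div (analyticAt_const.sub analyticAt_id) (by simp)
  · have h1 : ∀ᶠ w in 𝓝[≠] (0 : ℂ), 1 - w ≠ 0 := by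
      refine nhdsWithin_le_nhds (ContinuousAt.eventually_ne ?_ (by simp))
      exact continuousAt_const.sub continuousAt_id
    filter_upwards [h1, eventually_mem_nhdsWithin] with w hw (hw0 : w ≠ 0)
    have : w⁻¹ - 1 = (1 - w) / w := by field_simp
    refine ⟨?_, by simp [hypergeometricEq]⟩
    simp only [hypergeometricEq, this]
    field_simp
    ring

lemma not_isRelevantSingularity_infty_aux (h : A - B = 1) (h' : (1 - C) ^ 2 = (C - A - B) ^ 2) :
    ¬ (hypergeometricEq A B C).IsRelevantSingularity ∞ := by
  obtain rfl : A = B + 1 := by linear_combination h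
  have hBC : B * (C - (B + 1)) = 0 := by linear_combination h' / 4
  rcases mul_eq_zero.1 hBC with rfl | hC
  · rw [zero_add]
    exact fun hr => hr.1 isOrdinaryPoint_infty
  · obtain rfl : C = B + 1 := sub_eq_zero.1 hC
    by_cases hB : B = 0
    · subst hB
      rw [zero_add]
      exact fun hr => hr.1 isOrdinaryPoint_infty
    refine LinODE.not_isRelevantSingularity_of_isNonlogarithmic (hasLocalExponents_infty _ _ _)
      (by ring) ?_
    have := isNonlogarithmic_infty (C := B + 1) (by simpa using hB)
    rwa [add_sub_cancel_right] at this

lemma not_isRelevantSingularity_infty (h : (A - B) ^ 2 = 1) (h' : (1 - C) ^ 2 = (C - A - B) ^ 2) :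
    ¬ (hypergeometricEq A B C).IsRelevantSingularity ∞ := by
  rcases sq_eq_sq_iff_eq_or_eq_neg.1 (h.trans (one_pow 2).symm) with h1 | h1
  · exact not_isRelevantSingularity_infty_aux h1 h'
  · rw [hypergeometricEq_comm]
    exact not_isRelevantSingularity_infty_aux (by linear_combination -h1) (by rw [h']; ring)

end NotRelevant

/-! ### Algebraic germs -/

section AlgebraicGerms

/-- Polynomials as germs of functions. -/
noncomputable def polyGerm (z₀ : ℂ) : ℂ[X] →+* Germ (𝓝 z₀) ℂ :=
  (Germ.coeRingHom (𝓝 z₀)).comp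
    (RingHom.pi fun z => Polynomial.evalRingHom z)

/-- Germs of functions as an algebra over the polynomials. -/
noncomputable abbrev germAlgebra (z₀ : ℂ) : Algebra ℂ[X] (Germ (𝓝 z₀) ℂ) := (polyGerm z₀).toAlgebra

attribute [local instance] germAlgebra

lemma aeval_germ {z₀ : ℂ} (F : ℂ[X][X]) (y : ℂ → ℂ) :
    aeval (y : Germ (𝓝 z₀) ℂ) F = ((fun z => F.evalEval z (y z) : ℂ → ℂ) : Germ (𝓝 z₀) ℂ) := by
  induction F using Polynomial.induction_on' with
  | add p q hp hq =>
    rw [map_add, hp, hq, ← Germ.coe_add]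
    congr 1
    funext z
    simp [evalEval]
  | monomial n a =>
    have h1 : algebraMap ℂ[X] (Germ (𝓝 z₀) ℂ) a
        = ((fun z => a.eval z : ℂ → ℂ) : Germ (𝓝 z₀) ℂ) := rfl
    rw [aeval_monomial, h1, ← Germ.coe_pow, ← Germ.coe_mul]
    congr 1
    funext z
    simp [evalEval]

/-- Viewing germs as an algebra over `ℂ[X]` gives closure under sums, products, inverses and roots
from the general theory of algebraic elements. -/
lemma isAlgebraicGerm_iff {z₀ : ℂ} {y : ℂ → ℂ} :
    LinODE.IsAlgebraicGerm y z₀ ↔ IsAlgebraic ℂ[X] (y : Germ (𝓝 z₀) ℂ) := by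
  refine exists_congr fun F => and_congr_right fun _ => ?_
  rw [aeval_germ, ← Germ.coe_zero, Germ.coe_eq]
  rfl

namespace LinODE.IsAlgebraicGerm

variable {z₀ : ℂ} {y w : ℂ → ℂ}

lemma congr (h : IsAlgebraicGerm y z₀) (he : y =ᶠ[𝓝 z₀] w) : IsAlgebraicGerm w z₀ := by
  rw [isAlgebraicGerm_iff] at h ⊢
  rwa [Germ.coe_eq.2 he] at h

lemma mul (hy : IsAlgebraicGerm y z₀) (hw : IsAlgebraicGerm w z₀) :
    IsAlgebraicGerm (fun z => y z * w z) z₀ := by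
  rw [isAlgebraicGerm_iff] at hy hw ⊢
  exact IsAlgebraic.mul hy hw

lemma add (hy : IsAlgebraicGerm y z₀) (hw : IsAlgebraicGerm w z₀) :
    IsAlgebraicGerm (fun z => y z + w z) z₀ := by
  rw [isAlgebraicGerm_iff] at hy hw ⊢
  exact IsAlgebraic.add hy hw

lemma pow (hy : IsAlgebraicGerm y z₀) (n : ℕ) : IsAlgebraicGerm (fun z => y z ^ n) z₀ := by
  rw [isAlgebraicGerm_iff] at hy ⊢
  exact IsAlgebraic.pow hy n

lemma of_pow {n : ℕ} (hn : 0 < n) (hy : IsAlgebraicGerm (fun z => y z ^ n) z₀) :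
    IsAlgebraicGerm y z₀ := by
  rw [isAlgebraicGerm_iff] at hy ⊢
  exact IsAlgebraic.of_pow hn hy

lemma inv (hy : IsAlgebraicGerm y z₀) (h0 : ∀ᶠ z in 𝓝 z₀, y z ≠ 0) :
    IsAlgebraicGerm (fun z => (y z)⁻¹) z₀ := by
  rw [isAlgebraicGerm_iff] at hy ⊢
  have h1 : ((fun z => (y z)⁻¹ : ℂ → ℂ) : Germ (𝓝 z₀) ℂ) * (y : Germ (𝓝 z₀) ℂ) = 1 := by
    rw [← Germ.coe_mul, ← Germ.coe_one, Germ.coe_eq]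
    filter_upwards [h0] with z hz
    simp [hz]
  let _ : Invertible (y : Germ (𝓝 z₀) ℂ) := ⟨_, h1, by rw [mul_comm, h1]⟩
  exact hy.invOf

lemma polynomial (P : ℂ[X]) : IsAlgebraicGerm (fun z => P.eval z) z₀ := by
  refine ⟨X - Polynomial.C P, X_sub_C_ne_zero _, Eventually.of_forall fun z => ?_⟩
  simp [evalEval]

lemma eval_comp (hy : IsAlgebraicGerm y z₀) (P : ℂ[X]) :
    IsAlgebraicGerm (fun z => P.eval (y z)) z₀ := by
  induction P using Polynomial.induction_on' with
  | add p q hp hq => simpa using hp.add hq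
  | monomial n a =>
    have := (polynomial (z₀ := z₀) (Polynomial.C a)).mul (hy.pow n)
    simpa using this

/-- Rational powers of algebraic germs are algebraic. -/
lemma exp_rat_mul {L r : ℂ → ℂ} (hr : IsAlgebraicGerm r z₀)
    (hL : ∀ᶠ z in 𝓝 z₀, Complex.exp (L z) = r z) (e : ℚ) :
    IsAlgebraicGerm (fun z => Complex.exp (e * L z)) z₀ := by
  have hr0 : ∀ᶠ z in 𝓝 z₀, r z ≠ 0 := by
    filter_upwards [hL] with z hz
    rw [← hz]; exact Complex.exp_ne_zero _
  refine of_pow e.pos ?_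
  -- Raising to the denominator turns the rational power into the integer power `r ^ e.num`, and a
  -- root of an algebraic germ is algebraic.
  have hz : ∀ z, Complex.exp (e * L z) ^ e.den = Complex.exp (L z) ^ e.num := by
    intro z
    rw [← Complex.exp_nat_mul, ← Complex.exp_int_mul, ← mul_assoc]
    congr 2
    have := Rat.den_mul_eq_num e
    exact_mod_cast congrArg (Rat.cast (K := ℂ)) this
  simp only [hz]
  rcases Int.eq_nat_or_neg e.num with ⟨n, hn | hn⟩
  · refine (hr.pow n).congr ?_
    filter_upwards [hL] with z hz
    rw [hn, hz, zpow_natCast]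
  · refine ((hr.pow n).inv ?_).congr ?_
    · filter_upwards [hr0] with z hz using pow_ne_zero n hz
    · filter_upwards [hL] with z hz
      rw [hn, hz, zpow_neg, zpow_natCast]

end LinODE.IsAlgebraicGerm

end AlgebraicGerms

lemma hasDerivAt_of_exp_eq {L r : ℂ → ℂ} {r' x : ℂ} (hL : AnalyticAt ℂ L x)
    (h : ∀ᶠ z in 𝓝 x, Complex.exp (L z) = r z) (hr : HasDerivAt r r' x) :
    HasDerivAt L (r' / r x) x := by
  have h1 := hL.differentiableAt.hasDerivAt
  have h2 : Complex.exp (L x) * deriv L x = r' :=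
    (h1.cexp.congr_of_eventuallyEq (EventuallyEq.symm h)).unique hr
  rw [h.self_of_nhds] at h2
  have h0 : r x ≠ 0 := by rw [← h.self_of_nhds]; exact Complex.exp_ne_zero _
  rwa [← h2, mul_div_cancel_left₀ _ h0]

/-- A linear relation between `y` and `ρ y` with non-zero coefficient of `ρ y` would make `ρ`
constant near `z₀`, against the non-vanishing of `ρ'` at points arbitrarily close to `z₀`. -/
lemma LinODE.HasAlgebraicBasisAt.of_ratio {E : LinODE} {y ρ ρ' : ℂ → ℂ} {z₀ : ℂ}
    (h1 : E.IsLocalSolution y z₀) (h2 : E.IsLocalSolution (fun z => ρ z * y z) z₀)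
    (hy : ∀ z, y z ≠ 0) (hρ : ∀ᶠ z in 𝓝 z₀, HasDerivAt ρ (ρ' z) z)
    (hρ' : ∃ᶠ z in 𝓝 z₀, ρ' z ≠ 0) (a1 : IsAlgebraicGerm y z₀) (a2 : IsAlgebraicGerm ρ z₀) :
    E.HasAlgebraicBasisAt z₀ := by
  refine ⟨y, fun z => ρ z * y z, h1, h2, fun c₁ c₂ hc => ?_, a1, a2.mul a1⟩
  have hc' : ∀ᶠ z in 𝓝 z₀, c₁ + c₂ * ρ z = 0 := by
    filter_upwards [hc] with z hz
    apply mul_right_cancel₀ (hy z)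
    linear_combination hz
  have hc₂ : c₂ = 0 := by
    obtain ⟨z, hz, hz1, hz2⟩ := (hρ'.and_eventually (hρ.and hc'.eventually_nhds)).exists
    have hd := (hz1.const_mul c₂).const_add c₁
    have h0 := hd.congr_of_eventuallyEq (f₁ := fun _ => 0) (by
      filter_upwards [hz2] with w hw using hw.symm)
    exact (mul_eq_zero.1 (h0.unique (hasDerivAt_const z 0))).resolve_right hz
  refine ⟨?_, hc₂⟩
  have := hc'.self_of_nhds
  simpa [hc₂] using this

/-! ### Solutions `z ^ α (z - 1) ^ β` -/

section Monomials

/-- Logarithms of `z` and `z - 1` near `z₀`. -/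
lemma exists_logs {z₀ : ℂ} (h0 : z₀ ≠ 0) (h1 : z₀ ≠ 1) : ∃ L₀ L₁ : ℂ → ℂ,
    (AnalyticAt ℂ L₀ z₀ ∧ AnalyticAt ℂ L₁ z₀) ∧
    (∀ᶠ z in 𝓝 z₀, Complex.exp (L₀ z) = z) ∧ (∀ᶠ z in 𝓝 z₀, Complex.exp (L₁ z) = z - 1) ∧
    (∀ᶠ z in 𝓝 z₀, HasDerivAt L₀ (1 / z) z ∧ HasDerivAt L₁ (1 / (z - 1)) z) := by
  have hr0 : AnalyticAt ℂ (fun z : ℂ => z) z₀ := analyticAt_id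
  have hr1 : AnalyticAt ℂ (fun z : ℂ => z - 1) z₀ := by fun_prop
  obtain ⟨L₀, ha0, he0⟩ := exists_log hr0 h0
  obtain ⟨L₁, ha1, he1⟩ := exists_log hr1 (sub_ne_zero.2 h1)
  refine ⟨L₀, L₁, ⟨ha0, ha1⟩, he0, he1, ?_⟩
  filter_upwards [ha0.eventually_analyticAt, ha1.eventually_analyticAt, he0.eventually_nhds,
    he1.eventually_nhds] with z h1 h2 h3 h4
  have d0 : HasDerivAt (fun z : ℂ => z) 1 z := hasDerivAt_id z
  have d1 : HasDerivAt (fun z : ℂ => z - 1) 1 z := d0.sub_const 1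
  have e0 := hasDerivAt_of_exp_eq h1 h3 d0
  have e1 := hasDerivAt_of_exp_eq h2 h4 d1
  exact ⟨e0, e1⟩

/-- The condition for `z ^ α (z - 1) ^ β` to be a solution. -/
def IsMonomialSolution (A B C α β : ℂ) : Prop :=
  α ^ 2 - α + C * α = 0 ∧ β ^ 2 - β + (A + B - C + 1) * β = 0 ∧
    2 * α * β + C * β + (A + B - C + 1) * α + A * B = 0

lemma IsMonomialSolution.isLocalSolution {A B C α β z₀ : ℂ} (h : IsMonomialSolution A B C α β)
    (h0 : z₀ ≠ 0) (h1 : z₀ ≠ 1) {L₀ L₁ : ℂ → ℂ} (ha0 : AnalyticAt ℂ L₀ z₀)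
    (ha1 : AnalyticAt ℂ L₁ z₀)
    (hd : ∀ᶠ z in 𝓝 z₀, HasDerivAt L₀ (1 / z) z ∧ HasDerivAt L₁ (1 / (z - 1)) z) :
    (hypergeometricEq A B C).IsLocalSolution
      (fun z => Complex.exp (α * L₀ z + β * L₁ z)) z₀ := by
  refine ⟨((analyticAt_const.mul ha0).add (analyticAt_const.mul ha1)).cexp, ?_⟩
  filter_upwards [hd.eventually_nhds, isOpen_ne.mem_nhds h0, isOpen_ne.mem_nhds h1] with z hz hz0 hz1
  have hz1' : z - 1 ≠ 0 := sub_ne_zero.2 hz1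
  refine LinODE.holdsAt_of_logDeriv (m := fun z => α / (z - 0) + β / (z - 1)) ?_
    ((hasDerivAt_const_div_sub α 0 (by simpa using hz0)).add (hasDerivAt_const_div_sub β 1 hz1')) ?_
  · filter_upwards [hz] with w hw
    refine ((hw.1.const_mul α).add (hw.2.const_mul β)).cexp.congr_deriv ?_
    simp only [Pi.add_apply, sub_zero]
    ring
  · obtain ⟨e1, e2, e3⟩ := h
    simp only [hypergeometricEq, sub_zero]
    field_simp
    linear_combination (z - 1) ^ 2 * e1 + z ^ 2 * e2 + z * (z - 1) * e3

lemma hasAlgebraicBasisAt_of_monomials {A B C z₀ : ℂ} (h0 : z₀ ≠ 0) (h1 : z₀ ≠ 1)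
    {α β γ δ : ℚ} (h : IsMonomialSolution A B C α β)
    (h' : IsMonomialSolution A B C (α + γ : ℚ) (β + δ : ℚ)) (hne : γ ≠ 0 ∨ δ ≠ 0) :
    (hypergeometricEq A B C).HasAlgebraicBasisAt z₀ := by
  obtain ⟨L₀, L₁, ⟨ha0, ha1⟩, he0, he1, hd⟩ := exists_logs h0 h1
  have s1 := h.isLocalSolution h0 h1 ha0 ha1 hd
  have s2 := h'.isLocalSolution h0 h1 ha0 ha1 hd
  have alg : ∀ α β : ℚ, LinODE.IsAlgebraicGerm
      (fun z => Complex.exp ((α : ℂ) * L₀ z + (β : ℂ) * L₁ z)) z₀ := by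
    intro α β
    have := ((LinODE.IsAlgebraicGerm.polynomial X).exp_rat_mul (by simpa using he0) α).mul
      ((LinODE.IsAlgebraicGerm.polynomial (X - Polynomial.C 1)).exp_rat_mul
        (by simpa using he1) β)
    simpa only [Complex.exp_add] using this
  refine LinODE.HasAlgebraicBasisAt.of_ratio
    (ρ := fun z => Complex.exp ((γ : ℂ) * L₀ z + (δ : ℂ) * L₁ z))
    (ρ' := fun z => Complex.exp ((γ : ℂ) * L₀ z + (δ : ℂ) * L₁ z) * (γ * (1 / z) + δ * (1 / (z - 1))))
    s1 ?_ (fun z => Complex.exp_ne_zero _) ?_ ?_ (alg α β) (alg γ δ)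
  · convert s2 using 2 with z
    rw [← Complex.exp_add]
    push_cast
    ring_nf
  · filter_upwards [hd] with z hz
    exact ((hz.1.const_mul _).add (hz.2.const_mul _)).cexp
  · intro hev
    -- If the derivative of the ratio `z^γ (z-1)^δ` vanished near `z₀`, the numerator of its
    -- logarithmic derivative would be the zero polynomial; its values at `0` and `1` are `-γ` and
    -- `δ`.
    have hpoly : (Polynomial.C (γ : ℂ) * (X - Polynomial.C 1) + Polynomial.C (δ : ℂ) * X : ℂ[X])
        = 0 := by
      refine eq_of_infinite_eval_eq _ _ (Set.Infinite.mono ?_ (infinite_of_mem_nhds z₀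
        (Filter.inter_mem hev (Filter.inter_mem (isOpen_ne.mem_nhds h0) (isOpen_ne.mem_nhds h1)))))
      rintro z ⟨hz, hz0, hz1⟩
      have hz1' : z - 1 ≠ 0 := sub_ne_zero.2 hz1
      have hz0' : z ≠ 0 := hz0
      have hz' := (mul_eq_zero.1 (not_not.1 hz)).resolve_left (Complex.exp_ne_zero _)
      simp only [Set.mem_ofPred_eq, eval_add, eval_mul, eval_sub, eval_C, eval_X, eval_zero]
      field_simp at hz'
      linear_combination hz'
    have e0 := congrArg (eval 0) hpoly
    have e1 := congrArg (eval 1) hpoly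
    simp at e0 e1
    exact hne.elim (fun h => h e0) (fun h => h e1)

end Monomials

/-! ### An exponent difference `±1` without logarithms -/

section Degenerate

variable {A B C : ℂ}

/-- The conclusion for an equation with at most two relevant singular points. -/
def TwoRelevantOrAlgebraic (E : LinODE) : Prop :=
  {s : OnePoint ℂ | E.IsRelevantSingularity s}.ncard = 2 ∨
    ∀ z₀ : ℂ, z₀ ≠ 0 → z₀ ≠ 1 → E.HasAlgebraicBasisAt z₀

lemma sq_ne_one_of_not_rational {δ : ℂ} (h : ¬ ∃ r : ℚ, r ≠ 0 ∧ (r : ℂ) = δ) : δ ^ 2 ≠ 1 := by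
  intro h1
  rcases sq_eq_sq_iff_eq_or_eq_neg.1 (h1.trans (one_pow 2).symm) with h2 | h2
  · exact h ⟨1, one_ne_zero, by simp [h2]⟩
  · exact h ⟨-1, by norm_num, by simp [h2]⟩

lemma algebraic_zero_aux {r : ℚ} (hr : r ≠ 0) (hAB : (r : ℂ) = A - B)
    (h : C = 0 ∧ A = 0 ∨ C = 2 ∧ A = 1) {z₀ : ℂ} (h0 : z₀ ≠ 0) (h1 : z₀ ≠ 1) :
    (hypergeometricEq A B C).HasAlgebraicBasisAt z₀ := by
  have hB : B = A - r := by rw [hAB]; ring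
  rcases h with ⟨rfl, rfl⟩ | ⟨rfl, rfl⟩
  · refine hasAlgebraicBasisAt_of_monomials h0 h1 (α := 0) (β := 0) (γ := 0) (δ := r) ?_ ?_
      (Or.inr hr) <;>
    · simp only [IsMonomialSolution, hB]; push_cast; refine ⟨?_, ?_, ?_⟩ <;> ring
  · refine hasAlgebraicBasisAt_of_monomials h0 h1 (α := -1) (β := 0) (γ := 0) (δ := r) ?_ ?_
      (Or.inr hr) <;>
    · simp only [IsMonomialSolution, hB]; push_cast; refine ⟨?_, ?_, ?_⟩ <;> ring

/-- When `A - B = r` is rational and non-zero, two monomial solutions with ratio `(z-1)^r` form an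
algebraic basis. Otherwise `(A-B)² ≠ 1`, so `1` and `∞` are relevant while `0` is not. The value `r
= 0` belongs to the second case: it is rational, but the ratio would be constant. -/
theorem twoRelevantOrAlgebraic_zero (h : (1 - C) ^ 2 = 1) (h' : (C - A - B) ^ 2 = (A - B) ^ 2) :
    TwoRelevantOrAlgebraic (hypergeometricEq A B C) := by
  by_cases hr : ∃ r : ℚ, r ≠ 0 ∧ (r : ℂ) = A - B
  · obtain ⟨r, hr, hAB⟩ := hr
    refine Or.inr fun z₀ h0 h1 => ?_
    have hr' : ((-r : ℚ) : ℂ) = B - A := by push_cast; rw [hAB]; ring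
    have hC : C * (C - 2) = 0 := by linear_combination h
    rcases mul_eq_zero.1 hC with rfl | hC
    · have hAB0 : A * B = 0 := by linear_combination h' / 4
      rcases mul_eq_zero.1 hAB0 with hA | hB
      · exact algebraic_zero_aux hr hAB (Or.inl ⟨rfl, hA⟩) h0 h1
      · rw [hypergeometricEq_comm]
        exact algebraic_zero_aux (neg_ne_zero.2 hr) hr' (Or.inl ⟨rfl, hB⟩) h0 h1
    · obtain rfl : C = 2 := sub_eq_zero.1 hC
      have hAB0 : (A - 1) * (B - 1) = 0 := by linear_combination h' / 4
      rcases mul_eq_zero.1 hAB0 with hA | hB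
      · exact algebraic_zero_aux hr hAB (Or.inr ⟨rfl, sub_eq_zero.1 hA⟩) h0 h1
      · rw [hypergeometricEq_comm]
        exact algebraic_zero_aux (neg_ne_zero.2 hr) hr' (Or.inr ⟨rfl, sub_eq_zero.1 hB⟩) h0 h1
  · have hne := sq_ne_one_of_not_rational hr
    refine Or.inl (ncard_relevant_eq_two isOrdinaryPoint_of_notMem_sing rfl
      (OnePoint.coe_ne_infty _) (not_isRelevantSingularity_zero h h') ?_ ?_)
    · refine (hasLocalExponents_one A B C).isRelevantSingularity ?_
      rwa [zero_sub, neg_sq, h']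
    · exact (hasLocalExponents_infty A B C).isRelevantSingularity hne

lemma algebraic_one_aux {r : ℚ} (hr : r ≠ 0) (hAB : (r : ℂ) = A - B)
    (h : C = A + B + 1 ∧ A = 0 ∨ C = A + B - 1 ∧ A = 1) {z₀ : ℂ} (h0 : z₀ ≠ 0) (h1 : z₀ ≠ 1) :
    (hypergeometricEq A B C).HasAlgebraicBasisAt z₀ := by
  have hB : B = A - r := by rw [hAB]; ring
  rcases h with ⟨rfl, rfl⟩ | ⟨rfl, rfl⟩
  · refine hasAlgebraicBasisAt_of_monomials h0 h1 (α := 0) (β := 0) (γ := r) (δ := 0) ?_ ?_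
      (Or.inl hr) <;>
    · simp only [IsMonomialSolution, hB]; push_cast; refine ⟨?_, ?_, ?_⟩ <;> ring
  · refine hasAlgebraicBasisAt_of_monomials h0 h1 (α := 0) (β := -1) (γ := r) (δ := 0) ?_ ?_
      (Or.inl hr) <;>
    · simp only [IsMonomialSolution, hB]; push_cast; refine ⟨?_, ?_, ?_⟩ <;> ring

theorem twoRelevantOrAlgebraic_one (h : (C - A - B) ^ 2 = 1) (h' : (A - B) ^ 2 = (1 - C) ^ 2) :
    TwoRelevantOrAlgebraic (hypergeometricEq A B C) := by
  by_cases hr : ∃ r : ℚ, r ≠ 0 ∧ (r : ℂ) = A - B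
  · obtain ⟨r, hr, hAB⟩ := hr
    refine Or.inr fun z₀ h0 h1 => ?_
    have hr' : ((-r : ℚ) : ℂ) = B - A := by push_cast; rw [hAB]; ring
    have hC : (C - (A + B + 1)) * (C - (A + B - 1)) = 0 := by linear_combination h
    rcases mul_eq_zero.1 hC with hC | hC
    · obtain hC := sub_eq_zero.1 hC
      have hAB0 : A * B = 0 := by rw [hC] at h'; linear_combination -h' / 4
      rcases mul_eq_zero.1 hAB0 with hA | hB
      · exact algebraic_one_aux hr hAB (Or.inl ⟨hC, hA⟩) h0 h1
      · rw [hypergeometricEq_comm]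
        exact algebraic_one_aux (neg_ne_zero.2 hr) hr' (Or.inl ⟨by rw [hC]; ring, hB⟩) h0 h1
    · obtain hC := sub_eq_zero.1 hC
      have hAB0 : (A - 1) * (B - 1) = 0 := by rw [hC] at h'; linear_combination -h' / 4
      rcases mul_eq_zero.1 hAB0 with hA | hB
      · exact algebraic_one_aux hr hAB (Or.inr ⟨hC, sub_eq_zero.1 hA⟩) h0 h1
      · rw [hypergeometricEq_comm]
        exact algebraic_one_aux (neg_ne_zero.2 hr) hr'
          (Or.inr ⟨by rw [hC]; ring, sub_eq_zero.1 hB⟩) h0 h1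
  · have hne := sq_ne_one_of_not_rational hr
    refine Or.inl (ncard_relevant_eq_two isOrdinaryPoint_of_notMem_sing
      (Set.insert_comm _ _ _) (OnePoint.coe_ne_infty _) (not_isRelevantSingularity_one h h') ?_ ?_)
    · refine (hasLocalExponents_zero A B C).isRelevantSingularity ?_
      rwa [zero_sub, neg_sq, ← h']
    · exact (hasLocalExponents_infty A B C).isRelevantSingularity hne

/-- The solutions are `1` and `(z/(z-1))^r` if `B = 0`, and `z^r` and `(z-1)^r` if `C = A`. -/
lemma algebraic_infty_aux {r : ℚ} (hr : r ≠ 0) (hrC : (r : ℂ) = 1 - C) (h : A - B = 1)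
    (h' : (1 - C) ^ 2 = (C - A - B) ^ 2) {z₀ : ℂ} (h0 : z₀ ≠ 0) (h1 : z₀ ≠ 1) :
    (hypergeometricEq A B C).HasAlgebraicBasisAt z₀ := by
  obtain rfl : A = B + 1 := by linear_combination h
  have hC : C = 1 - r := by rw [hrC]; ring
  have hBC : B * (C - (B + 1)) = 0 := by linear_combination h' / 4
  rcases mul_eq_zero.1 hBC with rfl | hC'
  · refine hasAlgebraicBasisAt_of_monomials h0 h1 (α := 0) (β := 0) (γ := r) (δ := -r) ?_ ?_
      (Or.inl hr) <;>
    · simp only [IsMonomialSolution, hC]; push_cast; refine ⟨?_, ?_, ?_⟩ <;> ring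
  · have hB : B = -r := by linear_combination hC - hC'
    refine hasAlgebraicBasisAt_of_monomials h0 h1 (α := r) (β := 0) (γ := -r) (δ := r) ?_ ?_
      (Or.inr hr) <;>
    · simp only [IsMonomialSolution, hC, hB]; push_cast; refine ⟨?_, ?_, ?_⟩ <;> ring

theorem twoRelevantOrAlgebraic_infty (h : (A - B) ^ 2 = 1) (h' : (1 - C) ^ 2 = (C - A - B) ^ 2) :
    TwoRelevantOrAlgebraic (hypergeometricEq A B C) := by
  by_cases hr : ∃ r : ℚ, r ≠ 0 ∧ (r : ℂ) = 1 - C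
  · obtain ⟨r, hr, hrC⟩ := hr
    refine Or.inr fun z₀ h0 h1 => ?_
    rcases sq_eq_sq_iff_eq_or_eq_neg.1 (h.trans (one_pow 2).symm) with h2 | h2
    · exact algebraic_infty_aux hr hrC h2 h' h0 h1
    · rw [hypergeometricEq_comm]
      exact algebraic_infty_aux hr hrC (by linear_combination -h2) (by rw [h']; ring) h0 h1
  · have hne := sq_ne_one_of_not_rational hr
    refine Or.inl (ncard_relevant_eq_two (s := ∞) (s₁ := ((0 : ℂ) : OnePoint ℂ))
      (s₂ := ((1 : ℂ) : OnePoint ℂ)) isOrdinaryPoint_of_notMem_sing ?_ ?_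
      (not_isRelevantSingularity_infty h h') ?_ ?_)
    · rw [sing, Set.pair_comm _ ∞, Set.insert_comm]
    · simp
    · refine (hasLocalExponents_zero A B C).isRelevantSingularity ?_
      rwa [zero_sub, neg_sq]
    · refine (hasLocalExponents_one A B C).isRelevantSingularity ?_
      rwa [zero_sub, neg_sq, ← h']

end Degenerate

/-! ### Klein's construction of algebraic solutions -/

section Klein

variable {a₀ a₁ a₂ : ℂ} {F₀ F₁ F₂ : ℂ[X]}

/-- The covering given by `F₀ + F₁ + F₂ = 0` pulls back the hypergeometric
equation with `1 - δᵢ² = aᵢ` to an equation without singularities on the affine line. -/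
structure IsKleinianCovering (a₀ a₁ a₂ : ℂ) (F₀ F₁ F₂ : ℂ[X]) : Prop where
  sum_eq_zero : F₀ + F₁ + F₂ = 0
  no_common_root : ∀ x, F₀.eval x = 0 → F₁.eval x = 0 → F₂.eval x ≠ 0
  wronskian_ne_zero : ∀ x, F₀.eval x ≠ 0 → F₁.eval x ≠ 0 → F₂.eval x ≠ 0 →
    (wronskian F₀ F₁).eval x ≠ 0
  nonconstant : ∀ c₀ c₁ c₂ : ℂ, ¬ (c₀ = c₁ ∧ c₁ = c₂) →
    (C c₀ * F₀ + C c₁ * F₁ + C c₂ * F₂).natDegree ≠ 0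
  schwarzPoly_eq_zero : ∀ x, F₀.eval x ≠ 0 → F₁.eval x ≠ 0 → F₂.eval x ≠ 0 →
    (schwarzPoly a₀ a₁ a₂ F₀ F₁ F₂).eval x = 0

lemma IsKleinianCovering.swap (h : IsKleinianCovering a₀ a₁ a₂ F₀ F₁ F₂) :
    IsKleinianCovering a₁ a₀ a₂ F₁ F₀ F₂ where
  sum_eq_zero := by rw [← h.sum_eq_zero]; ring
  no_common_root x h1 h2 := h.no_common_root x h2 h1
  wronskian_ne_zero x h1 h2 h3 := by
    rw [← wronskian_neg_eq, eval_neg, neg_ne_zero]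
    exact h.wronskian_ne_zero x h2 h1 h3
  nonconstant c₀ c₁ c₂ hc := by
    rw [add_comm (C c₀ * F₁)]
    exact h.nonconstant c₁ c₀ c₂ fun ⟨h1, h2⟩ => hc ⟨h1.symm, h1.trans h2⟩
  schwarzPoly_eq_zero x h1 h2 h3 := by
    rw [schwarzPoly_swap]
    exact h.schwarzPoly_eq_zero x h2 h1 h3

lemma IsKleinianCovering.rotate (h : IsKleinianCovering a₀ a₁ a₂ F₀ F₁ F₂) :
    IsKleinianCovering a₁ a₂ a₀ F₁ F₂ F₀ where
  sum_eq_zero := by rw [← h.sum_eq_zero]; ring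
  no_common_root x h1 h2 h3 := h.no_common_root x h3 h1 h2
  wronskian_ne_zero x h1 h2 h3 := by
    rw [← wronskian_eq_of_sum_zero h.sum_eq_zero]
    exact h.wronskian_ne_zero x h3 h1 h2
  nonconstant c₀ c₁ c₂ hc := by
    rw [add_comm, ← add_assoc]
    exact h.nonconstant c₂ c₀ c₁ fun ⟨h1, h2⟩ => hc ⟨h2, (h1.trans h2).symm⟩
  schwarzPoly_eq_zero x h1 h2 h3 := by
    rw [schwarzPoly_rotate h.sum_eq_zero]
    exact h.schwarzPoly_eq_zero x h3 h1 h2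

/-- The affine line covers all points of the projective line but `0, 1, ∞`. -/
lemma IsKleinianCovering.exists_preimage (h : IsKleinianCovering a₀ a₁ a₂ F₀ F₁ F₂) {z₀ : ℂ}
    (h0 : z₀ ≠ 0) (h1 : z₀ ≠ 1) : ∃ x, F₀.eval x = z₀ * (-F₂).eval x ∧
      F₀.eval x ≠ 0 ∧ F₁.eval x ≠ 0 ∧ F₂.eval x ≠ 0 := by
  have hdeg := h.nonconstant 1 0 z₀ (by simp)
  obtain ⟨x, hx⟩ := IsAlgClosed.exists_root _ (fun hd => hdeg (natDegree_eq_of_degree_eq_some hd))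
  have hx' : F₀.eval x + z₀ * F₂.eval x = 0 := by simpa using hx
  have hs : F₀.eval x + F₁.eval x + F₂.eval x = 0 := by
    simpa using congrArg (eval x) h.sum_eq_zero
  have h2 : F₂.eval x ≠ 0 := by
    intro h2
    have e0 : F₀.eval x = 0 := by simpa [h2] using hx'
    exact h.no_common_root x e0 (by simpa [h2, e0] using hs) h2
  refine ⟨x, by rw [eval_neg]; linear_combination hx', fun e => ?_, fun e => ?_, h2⟩
  · rw [e, zero_add] at hx'
    exact mul_ne_zero h0 h2 hx'
  · have : (z₀ - 1) * F₂.eval x = 0 := by rw [e] at hs; linear_combination hx' - hs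
    exact mul_ne_zero (sub_ne_zero.2 h1) h2 this

/-- A local inverse of `f / g` is analytic and algebraic. -/
lemma exists_ratMap_localInverse {f g : ℂ[X]} {x₀ : ℂ} (hg : g.eval x₀ ≠ 0)
    (hW : (wronskian f g).eval x₀ ≠ 0) : ∃ G : ℂ → ℂ,
      AnalyticAt ℂ G (f.eval x₀ / g.eval x₀) ∧ G (f.eval x₀ / g.eval x₀) = x₀ ∧
      (∀ᶠ z in 𝓝 (f.eval x₀ / g.eval x₀), f.eval (G z) / g.eval (G z) = z) := by
  have ha : AnalyticAt ℂ (fun x => f.eval x / g.eval x) x₀ :=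
    (analyticAt_eval f x₀).div (analyticAt_eval g x₀) hg
  have hd : deriv (fun x => f.eval x / g.eval x) x₀ ≠ 0 := by
    rw [(hasDerivAt_ratMap hg).deriv, ratDeriv]
    refine div_ne_zero (fun e => hW ?_) (pow_ne_zero 2 hg)
    rw [wronskian_eval]
    linear_combination -e
  exact ⟨ha.hasStrictDerivAt.localInverse _ _ _ hd, ha.analyticAt_localInverse hd,
    HasStrictFDerivAt.localInverse_apply_image _,
    ha.hasStrictDerivAt.eventually_right_inverse hd⟩

lemma isAlgebraicGerm_of_ratMap_eq {f g : ℂ[X]} {G : ℂ → ℂ} {z₀ x₀ : ℂ} (hf : f.eval x₀ ≠ 0)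
    (hg : ∀ᶠ z in 𝓝 z₀, g.eval (G z) ≠ 0)
    (hG : ∀ᶠ z in 𝓝 z₀, f.eval (G z) / g.eval (G z) = z) : LinODE.IsAlgebraicGerm G z₀ := by
  -- The germ `G` is a root in `Y` of `f(Y) - X g(Y)`, which is non-zero since its value at `X = 0`,
  -- `Y = x₀` is `f(x₀)`.
  refine ⟨f.map Polynomial.C - Polynomial.C X * g.map Polynomial.C, fun e => hf ?_, ?_⟩
  · have := congrArg (evalEval 0 x₀) e
    simpa [evalEval, eval_map, eval₂_at_apply] using this
  · filter_upwards [hg, hG] with z h1 h2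
    have h3 : f.eval (G z) = g.eval (G z) * z := (div_eq_iff h1).1 h2 |>.trans (mul_comm _ _)
    simp [evalEval, eval_map, eval₂_at_apply, h3]

/-- Reduction of order: `ρ y` is a solution as soon as `H = ρ'` satisfies `H' = -(2 y'/y + p) H`. -/
lemma LinODE.holdsAt_mul_of_logDeriv {E : LinODE} {y m ρ H : ℂ → ℂ} {z m' : ℂ}
    (h1 : ∀ᶠ w in 𝓝 z, HasDerivAt y (m w * y w) w) (h2 : HasDerivAt m m' z)
    (h : m' + m z ^ 2 + E.p z * m z + E.q z = 0) (h3 : ∀ᶠ w in 𝓝 z, HasDerivAt ρ (H w) w)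
    (h4 : HasDerivAt H (-(2 * m z + E.p z) * H z) z) : E.HoldsAt (fun z => ρ z * y z) z := by
  refine LinODE.holdsAt_of_hasDerivAt (y₁ := fun w => H w * y w + ρ w * (m w * y w)) ?_
    ((h4.mul h1.self_of_nhds).add (h3.self_of_nhds.mul (h2.mul h1.self_of_nhds))) ?_
  · filter_upwards [h1, h3] with w e1 e3 using e3.mul e1
  · linear_combination ρ z * y z * h

lemma ratDeriv_ne_zero {f g : ℂ[X]} {x : ℂ} (hg : g.eval x ≠ 0)
    (hW : (wronskian f g).eval x ≠ 0) : ratDeriv f g x ≠ 0 := by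
  refine div_ne_zero (fun e => hW ?_) (pow_ne_zero 2 hg)
  rw [wronskian_eval]
  linear_combination -e

/-- Klein's construction: the local inverses of a Kleinian covering are quotients of algebraic
solutions. -/
theorem IsKleinianCovering.hasAlgebraicBasisAt {A B C : ℂ}
    (h : IsKleinianCovering (1 - (1 - C) ^ 2) (1 - (C - A - B) ^ 2) (1 - (A - B) ^ 2) F₀ F₁ F₂)
    {c d : ℚ} (hc : (c : ℂ) = C) (hd : (d : ℂ) = A + B - C + 1) {z₀ : ℂ}
    (h0 : z₀ ≠ 0) (h1 : z₀ ≠ 1) : (hypergeometricEq A B C).HasAlgebraicBasisAt z₀ := by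
  obtain ⟨x₀, hx, hf0, hf1, hf2⟩ := h.exists_preimage h0 h1
  obtain ⟨g, rfl⟩ : ∃ g, F₂ = -g := ⟨-F₂, by simp⟩
  obtain rfl : F₁ = g - F₀ := by linear_combination h.sum_eq_zero
  rename' F₀ => f
  rw [neg_neg] at hx
  have hWeq : wronskian f (g - f) = wronskian f g := by
    simp only [wronskian, derivative_sub]; ring
  have hgne : ∀ {x : ℂ}, (-g).eval x ≠ 0 → g.eval x ≠ 0 := fun h e => h (by simp [e])
  have hgx := hgne hf2
  have hz : f.eval x₀ / g.eval x₀ = z₀ := by rw [hx, mul_div_cancel_right₀ _ hgx]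
  obtain ⟨G, hGa, hGx, hG⟩ := exists_ratMap_localInverse hgx
    (hWeq ▸ h.wronskian_ne_zero x₀ hf0 hf1 hf2)
  rw [hz] at hGa hGx hG
  have hreg : ∀ᶠ z in 𝓝 z₀, f.eval (G z) ≠ 0 ∧ (g - f).eval (G z) ≠ 0 ∧ (-g).eval (G z) ≠ 0 := by
    refine hGa.continuousAt.eventually (p := fun x => f.eval x ≠ 0 ∧ (g - f).eval x ≠ 0 ∧
      (-g).eval x ≠ 0) ?_
    rw [hGx]
    exact (f.continuous.continuousAt.eventually_ne hf0).and
      (((g - f).continuous.continuousAt.eventually_ne hf1).and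
        ((-g).continuous.continuousAt.eventually_ne hf2))
  have hψ : ∀ᶠ z in 𝓝 z₀, g.eval (G z) ≠ 0 ∧ (wronskian f g).eval (G z) ≠ 0 ∧
      ratDeriv f g (G z) ≠ 0 := by
    filter_upwards [hreg] with z ⟨e0, e1, e2⟩
    have e3 := hWeq ▸ h.wronskian_ne_zero _ e0 e1 e2
    exact ⟨hgne e2, e3, ratDeriv_ne_zero (hgne e2) e3⟩
  have hGd : ∀ᶠ z in 𝓝 z₀, HasDerivAt G (ratDeriv f g (G z))⁻¹ z := by
    filter_upwards [hψ, hG.eventually_nhds, hGa.eventually_analyticAt] with z ⟨e1, _, e3⟩ e4 e5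
    exact (hasDerivAt_ratMap e1).of_local_left_inverse e5.continuousAt e3 e4
  have hψd : ∀ᶠ z in 𝓝 z₀, HasDerivAt (fun z => ratDeriv f g (G z)) (ratPre f g (G z)) z := by
    filter_upwards [hψ, hGd] with z ⟨e1, e2, e3⟩ e4
    refine ((hasDerivAt_ratDeriv e1 e2).comp z e4).congr_deriv ?_
    field_simp
  have hψa : AnalyticAt ℂ (fun z => ratDeriv f g (G z)) z₀ := by
    have e : ∀ P : ℂ[X], AnalyticAt ℂ (fun z => P.eval (G z)) z₀ := fun P =>
      (analyticAt_eval P (G z₀)).comp hGa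
    exact (((e _).mul (e _)).sub ((e _).mul (e _))).div ((e g).pow 2)
      (pow_ne_zero 2 (by rwa [hGx]))
  obtain ⟨Λ, hΛa, hΛ⟩ := exists_log hψa hψ.self_of_nhds.2.2
  obtain ⟨L₀, L₁, ⟨ha0, ha1⟩, he0, he1, hLd⟩ := exists_logs h0 h1
  have hΛd : ∀ᶠ z in 𝓝 z₀, HasDerivAt Λ (ratPre f g (G z) / ratDeriv f g (G z)) z := by
    filter_upwards [hΛa.eventually_analyticAt, hΛ.eventually_nhds, hψd] with z e1 e2 e3
    have e := hasDerivAt_of_exp_eq e1 e2 e3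
    exact e
  -- This is `(φ'(G))^(1/2) z^(-C/2) (z-1)^(-(A+B-C+1)/2)`. The power of `φ'(G)` is the solution
  -- `(G')^(-1/2)` of the normal form when `G` is a quotient of solutions; the other factors restore
  -- the first-order term. Rationality of `c` and `d` makes it algebraic.
  set y : ℂ → ℂ := fun z => Complex.exp (((1 / 2 : ℚ) : ℂ) * Λ z) *
    Complex.exp (((-c / 2 : ℚ) : ℂ) * L₀ z) * Complex.exp (((-d / 2 : ℚ) : ℂ) * L₁ z) with hy
  set m : ℂ → ℂ := fun z => 1 / 2 * (ratPre f g (G z) / ratDeriv f g (G z))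
    + (-C / 2 / (z - 0) + -(A + B - C + 1) / 2 / (z - 1)) with hm
  have hya : AnalyticAt ℂ y z₀ := ((analyticAt_const.mul hΛa).cexp.mul
    (analyticAt_const.mul ha0).cexp).mul (analyticAt_const.mul ha1).cexp
  have hy0 : ∀ z, y z ≠ 0 := fun z => mul_ne_zero (mul_ne_zero (Complex.exp_ne_zero _)
    (Complex.exp_ne_zero _)) (Complex.exp_ne_zero _)
  have hyd : ∀ᶠ z in 𝓝 z₀, HasDerivAt y (m z * y z) z := by
    filter_upwards [hΛd, hLd] with z e1 ⟨e2, e3⟩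
    refine (((e1.const_mul _).cexp.mul (e2.const_mul _).cexp).mul
      (e3.const_mul _).cexp).congr_deriv ?_
    simp only [hy, hm, Pi.mul_apply]
    push_cast
    rw [hc, hd]
    ring
  have hmd : ∀ᶠ z in 𝓝 z₀, ∃ m', HasDerivAt m m' z ∧
      m' + m z ^ 2 + (hypergeometricEq A B C).p z * m z + (hypergeometricEq A B C).q z = 0 := by
    filter_upwards [hψ, hreg, hG, hGd, hψd, isOpen_ne.mem_nhds h0, isOpen_ne.mem_nhds h1] with z
      ⟨e1, e2, e3⟩ ⟨r1, r2, r3⟩ e4 e5 e6 z0 z1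
    have z0' : z ≠ 0 := z0
    have z1' : z - 1 ≠ 0 := sub_ne_zero.2 z1
    refine ⟨_, ((((hasDerivAt_ratPre e1 e2).comp z e5).div e6 e3).const_mul (1 / 2)).add
      ((hasDerivAt_const_div_sub _ 0 (by simpa using z0')).add
        (hasDerivAt_const_div_sub _ 1 z1')), ?_⟩
    -- Zero pulled-back invariant means `φ'² I(φ)` is minus the Schwarzian of `φ`; divided by
    -- `2φ'²`, this is the Riccati equation for `m`.
    have hS := h.schwarzPoly_eq_zero _ r1 r2 r3
    rw [schwarzPoly_eval r1 e1 r2 e2, e4, ← hypergeometricEq_invariant A B C z0 z1] at hS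
    have hS' := (mul_eq_zero.1 hS).resolve_left (mul_ne_zero two_ne_zero (by
      simp only [eval_mul, eval_pow, hWeq]
      exact mul_ne_zero (pow_ne_zero 2 e2) (pow_ne_zero 2 (mul_ne_zero (mul_ne_zero r1 r2) r3))))
    simp only [hm, Function.comp_apply, hypergeometricEq, sub_zero] at hS' ⊢
    generalize ratDeriv f g (G z) = u at *
    generalize ratPre f g (G z) = v at *
    generalize ratPreDeriv f g (G z) = w at *
    linear_combination (norm := skip) 1 / (2 * u ^ 2) * hS'
    field_simp
    ring
  -- Here `G' = 1/φ'(G)` satisfies the first-order equation of reduction of order, so `G y` is the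
  -- second solution.
  have hHd : ∀ᶠ z in 𝓝 z₀, HasDerivAt (fun z => (ratDeriv f g (G z))⁻¹)
      (-(2 * m z + (hypergeometricEq A B C).p z) * (ratDeriv f g (G z))⁻¹) z := by
    filter_upwards [hψd, hψ] with z e1 ⟨_, _, e2⟩
    refine (e1.inv e2).congr_deriv ?_
    simp only [hm, hypergeometricEq, sub_zero]
    field_simp
    ring
  have halg : LinODE.IsAlgebraicGerm G z₀ :=
    isAlgebraicGerm_of_ratMap_eq hf0 (hψ.mono fun z hz => hz.1) hG
  have hψalg : LinODE.IsAlgebraicGerm (fun z => ratDeriv f g (G z)) z₀ := by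
    have e := (halg.eval_comp (derivative f * g - f * derivative g)).mul
      (((halg.eval_comp g).pow 2).inv (hψ.mono fun z hz => pow_ne_zero 2 hz.1))
    simpa only [ratDeriv, div_eq_mul_inv, eval_sub, eval_mul] using e
  have hyalg : LinODE.IsAlgebraicGerm y z₀ :=
    ((hψalg.exp_rat_mul hΛ _).mul ((LinODE.IsAlgebraicGerm.polynomial X).exp_rat_mul
      (by simpa using he0) _)).mul ((LinODE.IsAlgebraicGerm.polynomial
        (X - Polynomial.C 1)).exp_rat_mul (by simpa using he1) _)
  refine LinODE.HasAlgebraicBasisAt.of_ratio ⟨hya, ?_⟩ ⟨hGa.mul hya, ?_⟩ hy0 hGd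
    (hψ.mono fun z hz => inv_ne_zero hz.2.2).frequently hyalg halg
  · filter_upwards [hyd.eventually_nhds, hmd] with z e1 ⟨m', e2, e3⟩
    exact LinODE.holdsAt_of_logDeriv e1 e2 e3
  · filter_upwards [hyd.eventually_nhds, hmd, hGd.eventually_nhds, hHd] with z e1 ⟨m', e2, e3⟩ e4 e5
    exact LinODE.holdsAt_mul_of_logDeriv e1 e2 e3 e4 e5

end Klein

/-! ### Coverings from polyhedral invariants -/

section Polyhedra

variable {k : ℕ} {c₀ c₁ c₂ κ : ℤ} {G₀ G₁ G₂ : ℂ[X]}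

/-- The conditions on the invariants of a polyhedral group, `c₀ G₀² + c₁ G₁³ + c₂ G₂^(k+2) = 0`,
for the corresponding covering to be Kleinian. -/
structure IsPolyhedralSystem (k : ℕ) (c₀ c₁ c₂ κ : ℤ) (G₀ G₁ G₂ : ℂ[X]) : Prop where
  ne_zero : c₀ ≠ 0 ∧ c₁ ≠ 0 ∧ c₂ ≠ 0 ∧ κ ≠ 0
  sq_eq : κ ^ 2 = ((k + 2) * (c₀ * c₁ * c₂)) ^ 2
  sum_eq_zero : c₀ * G₀ ^ 2 + c₁ * G₁ ^ 3 + c₂ * G₂ ^ (k + 2) = 0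
  wronskian_eq : c₀ * c₁ * (3 * G₀ * derivative G₁ - 2 * derivative G₀ * G₁) = κ * G₂ ^ (k + 1)
  no_common_root : ∀ x, G₀.eval x = 0 → G₁.eval x = 0 → G₂.eval x ≠ 0
  natDegree_pos : 0 < G₂.natDegree
  natDegree_lt : (k + 2) * G₂.natDegree < 2 * G₀.natDegree
  schwarz_eq : 72 * ((derivative (derivative G₀) * G₀ - derivative G₀ ^ 2) * (G₁ * G₂) ^ 2
      + 2 * ((derivative (derivative G₁) * G₁ - derivative G₁ ^ 2) * (G₀ * G₂) ^ 2)
      - (k + 3) * ((derivative (derivative G₂) * G₂ - derivative G₂ ^ 2) * (G₀ * G₁) ^ 2))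
      - 36 * (derivative G₀ * (G₁ * G₂) + 2 * (derivative G₁ * (G₀ * G₂))
        - (k + 3) * (derivative G₂ * (G₀ * G₁))) ^ 2
    = (k + 2) ^ 2 * (27 * (c₁ * c₂ * (G₁ ^ 3 * G₂ ^ (k + 2)))
      + 32 * (c₀ * c₂ * (G₀ ^ 2 * G₂ ^ (k + 2)))) + 36 * (((k + 2) ^ 2 - 1) *
        (c₀ * c₁ * (G₀ ^ 2 * G₁ ^ 3)))

namespace IsPolyhedralSystem

lemma wronskian_covering (h : IsPolyhedralSystem k c₀ c₁ c₂ κ G₀ G₁ G₂) :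
    wronskian ((c₀ : ℂ[X]) * G₀ ^ 2) ((c₁ : ℂ[X]) * G₁ ^ 3) = (κ : ℂ[X]) * (G₀ * G₁ ^ 2 * G₂ ^ (k + 1)) := by
  simp only [wronskian, derivative_mul, derivative_intCast, derivative_pow]
  simp only [Nat.cast_ofNat, Nat.add_one_sub_one, map_ofNat, zero_mul, zero_add, pow_one]
  linear_combination G₀ * G₁ ^ 2 * h.wronskian_eq

/-- The derivative of the covering is a constant times `G₀ G₁² / G₂^(k+3)`: the Wronskian
contributes `G₂^(k+1)` and the squared denominator `G₂^(2k+4)`. Thus the logarithmic derivative only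
involves those of the `Gᵢ`. -/
lemma ratPre_eq (h : IsPolyhedralSystem k c₀ c₁ c₂ κ G₀ G₁ G₂) {x : ℂ} (h0 : G₀.eval x ≠ 0)
    (h1 : G₁.eval x ≠ 0) (h2 : G₂.eval x ≠ 0) :
    ratPre ((c₀ : ℂ[X]) * G₀ ^ 2) (-((c₂ : ℂ[X]) * G₂ ^ (k + 2))) x = (derivative G₀).eval x / G₀.eval x
      + 2 * ((derivative G₁).eval x / G₁.eval x)
      - (k + 3) * ((derivative G₂).eval x / G₂.eval x) := by
  have hc₂ : (c₂ : ℂ) ≠ 0 := by exact_mod_cast h.ne_zero.2.2.1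
  have hκ : (κ : ℂ) ≠ 0 := by exact_mod_cast h.ne_zero.2.2.2
  have hW : wronskian ((c₀ : ℂ[X]) * G₀ ^ 2) (-((c₂ : ℂ[X]) * G₂ ^ (k + 2)))
      = (κ : ℂ[X]) * (G₀ * G₁ ^ 2 * G₂ ^ (k + 1)) := by
    rw [← h.wronskian_covering]
    have e : -((c₂ : ℂ[X]) * G₂ ^ (k + 2)) = c₀ * G₀ ^ 2 + c₁ * G₁ ^ 3 := by
      linear_combination -h.sum_eq_zero
    rw [e]
    simp only [wronskian, derivative_add]
    ring
  rw [ratPre, hW]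
  simp only [derivative_mul, derivative_intCast, derivative_pow, derivative_neg, eval_mul, eval_add,
    eval_neg, eval_pow, eval_intCast, eval_C, zero_mul, zero_add, Nat.add_one_sub_one]
  push_cast
  simp only [pow_succ, pow_zero, one_mul]
  field_simp
  ring

lemma ratPreDeriv_eq (h : IsPolyhedralSystem k c₀ c₁ c₂ κ G₀ G₁ G₂) {x : ℂ} (h0 : G₀.eval x ≠ 0)
    (h1 : G₁.eval x ≠ 0) (h2 : G₂.eval x ≠ 0)
    (hg : (-((c₂ : ℂ[X]) * G₂ ^ (k + 2)) : ℂ[X]).eval x ≠ 0)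
    (hW : (wronskian ((c₀ : ℂ[X]) * G₀ ^ 2) (-((c₂ : ℂ[X]) * G₂ ^ (k + 2)))).eval x ≠ 0) :
    ratPreDeriv ((c₀ : ℂ[X]) * G₀ ^ 2) (-((c₂ : ℂ[X]) * G₂ ^ (k + 2))) x =
      ((derivative (derivative G₀)).eval x * G₀.eval x - (derivative G₀).eval x ^ 2)
        / G₀.eval x ^ 2
      + 2 * (((derivative (derivative G₁)).eval x * G₁.eval x - (derivative G₁).eval x ^ 2)
        / G₁.eval x ^ 2)
      - (k + 3) * (((derivative (derivative G₂)).eval x * G₂.eval x - (derivative G₂).eval x ^ 2)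
        / G₂.eval x ^ 2) := by
  have e : ∀ G : ℂ[X], G.eval x ≠ 0 → HasDerivAt (fun x => (derivative G).eval x / G.eval x)
      (((derivative (derivative G)).eval x * G.eval x - (derivative G).eval x ^ 2)
        / G.eval x ^ 2) x := fun G hG =>
    (((derivative G).hasDerivAt x).div (G.hasDerivAt x) hG).congr_deriv (by ring)
  have hd := ((e G₀ h0).add ((e G₁ h1).const_mul 2)).sub ((e G₂ h2).const_mul ((k : ℂ) + 3))
  refine (hasDerivAt_ratPre hg hW).unique (hd.congr_of_eventuallyEq ?_)
  filter_upwards [G₀.continuous.continuousAt.eventually_ne h0,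
    G₁.continuous.continuousAt.eventually_ne h1, G₂.continuous.continuousAt.eventually_ne h2]
    with w w0 w1 w2
  exact h.ratPre_eq w0 w1 w2

theorem isKleinianCovering (h : IsPolyhedralSystem k c₀ c₁ c₂ κ G₀ G₁ G₂) :
    IsKleinianCovering (3 / 4) (8 / 9) (1 - 1 / ((k : ℂ) + 2) ^ 2) ((c₀ : ℂ[X]) * G₀ ^ 2) ((c₁ : ℂ[X]) * G₁ ^ 3)
      ((c₂ : ℂ[X]) * G₂ ^ (k + 2)) := by
  obtain ⟨hc₀, hc₁, hc₂, hκ⟩ := h.ne_zero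
  have hc₀' : (c₀ : ℂ) ≠ 0 := by exact_mod_cast hc₀
  have hc₁' : (c₁ : ℂ) ≠ 0 := by exact_mod_cast hc₁
  have hc₂' : (c₂ : ℂ) ≠ 0 := by exact_mod_cast hc₂
  have hκ' : (κ : ℂ) ≠ 0 := by exact_mod_cast hκ
  have hG : ∀ {c : ℤ} {G : ℂ[X]} {x : ℂ} {n : ℕ}, (c * G ^ (n + 1) : ℂ[X]).eval x ≠ 0 →
      G.eval x ≠ 0 := by
    intro c G x n h e
    exact h (by simp [e])
  have hG' : ∀ {c : ℤ} {G : ℂ[X]} {x : ℂ} {n : ℕ}, (c : ℂ) ≠ 0 →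
      (c * G ^ n : ℂ[X]).eval x = 0 → G.eval x = 0 := by
    intro c G x n hc h
    rw [eval_mul, eval_intCast, eval_pow] at h
    by_contra hne
    exact mul_ne_zero hc (pow_ne_zero n hne) h
  have hW : ∀ x, ((c₀ : ℂ[X]) * G₀ ^ 2 : ℂ[X]).eval x ≠ 0 → ((c₁ : ℂ[X]) * G₁ ^ 3 : ℂ[X]).eval x ≠ 0 →
      ((c₂ : ℂ[X]) * G₂ ^ (k + 2) : ℂ[X]).eval x ≠ 0 →
      (wronskian ((c₀ : ℂ[X]) * G₀ ^ 2) ((c₁ : ℂ[X]) * G₁ ^ 3)).eval x ≠ 0 := by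
    intro x h0 h1 h2
    rw [h.wronskian_covering]
    simp only [eval_mul, eval_intCast, eval_pow]
    exact mul_ne_zero hκ' (mul_ne_zero (mul_ne_zero (hG h0) (pow_ne_zero _ (hG h1)))
      (pow_ne_zero _ (hG h2)))
  refine ⟨h.sum_eq_zero, fun x h0 h1 h2 => h.no_common_root x (hG' hc₀' h0) (hG' hc₁' h1)
    (hG' hc₂' h2), hW, ?_, ?_⟩
  · intro b₀ b₁ b₂ hb
    have hd : ∀ {c : ℤ} (G : ℂ[X]) (n : ℕ) {b : ℂ}, (c : ℂ) ≠ 0 → b ≠ 0 →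
        (C b * (c * G ^ n) : ℂ[X]).natDegree = n * G.natDegree := by
      intro c G n b hc hb
      rw [natDegree_C_mul hb, ← C_eq_intCast, natDegree_C_mul hc, natDegree_pow]
    have e : C b₀ * ((c₀ : ℂ[X]) * G₀ ^ 2) + C b₁ * ((c₁ : ℂ[X]) * G₁ ^ 3) + C b₂ * ((c₂ : ℂ[X]) * G₂ ^ (k + 2))
        = C (b₀ - b₁) * ((c₀ : ℂ[X]) * G₀ ^ 2) + C (b₂ - b₁) * ((c₂ : ℂ[X]) * G₂ ^ (k + 2)) := by
      simp only [C_sub]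
      linear_combination C b₁ * h.sum_eq_zero
    rw [e]
    have hpos := Nat.mul_pos (Nat.succ_pos (k + 1)) h.natDegree_pos
    by_cases h01 : b₀ = b₁
    · have h21 : b₂ - b₁ ≠ 0 := fun h => hb ⟨h01, (sub_eq_zero.1 h).symm⟩
      rw [h01, sub_self, C_0, zero_mul, zero_add, hd _ _ hc₂' h21]
      exact hpos.ne'
    · have h01' := sub_ne_zero.2 h01
      -- The strict degree inequality expresses that infinity lies over `z = ∞`: it is a vertex
      -- missing from the roots of `G₂`.
      have hlt : (C (b₂ - b₁) * ((c₂ : ℂ[X]) * G₂ ^ (k + 2)) : ℂ[X]).natDegree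
          < (C (b₀ - b₁) * ((c₀ : ℂ[X]) * G₀ ^ 2) : ℂ[X]).natDegree := by
        rw [hd G₀ 2 hc₀' h01']
        rcases eq_or_ne (b₂ - b₁) 0 with h21 | h21
        · rw [h21, C_0, zero_mul, natDegree_zero]
          exact hpos.trans h.natDegree_lt
        · rw [hd G₂ _ hc₂' h21]
          exact h.natDegree_lt
      rw [natDegree_add_eq_left_of_natDegree_lt hlt, hd G₀ 2 hc₀' h01']
      exact (hpos.trans h.natDegree_lt).ne'
  · intro x h0 h1 h2
    have e1 : ((c₁ : ℂ[X]) * G₁ ^ 3 : ℂ[X]) = -((c₂ : ℂ[X]) * G₂ ^ (k + 2)) - c₀ * G₀ ^ 2 := by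
      linear_combination h.sum_eq_zero
    have hg : (-((c₂ : ℂ[X]) * G₂ ^ (k + 2)) : ℂ[X]).eval x ≠ 0 := by rwa [eval_neg, neg_ne_zero]
    have hWx := hW x h0 h1 h2
    have hWe : wronskian ((c₀ : ℂ[X]) * G₀ ^ 2) (-((c₂ : ℂ[X]) * G₂ ^ (k + 2)))
        = (κ : ℂ[X]) * (G₀ * G₁ ^ 2 * G₂ ^ (k + 1)) := by
      rw [← h.wronskian_covering, e1]
      simp only [wronskian, derivative_sub]
      ring
    rw [h.wronskian_covering, ← hWe] at hWx
    have hs := congrArg (eval x) h.sum_eq_zero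
    have hS := congrArg (eval x) h.schwarz_eq
    have hWr := hWe ▸ wronskian_eval ((c₀ : ℂ[X]) * G₀ ^ 2) (-((c₂ : ℂ[X]) * G₂ ^ (k + 2))) x
    have h1' := e1 ▸ h1
    have key := schwarzPoly_eval (a₀ := 3 / 4) (a₁ := 8 / 9) (a₂ := 1 - 1 / ((k : ℂ) + 2) ^ 2)
      h0 hg h1' hWx
    rw [← e1, neg_neg] at key
    rw [key]
    refine mul_eq_zero_of_right _ ?_
    have hψ : ratDeriv ((c₀ : ℂ[X]) * G₀ ^ 2) (-((c₂ : ℂ[X]) * G₂ ^ (k + 2))) x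
      = - ((κ : ℂ[X]) * (G₀ * G₁ ^ 2 * G₂ ^ (k + 1)) : ℂ[X]).eval x
        / (-((c₂ : ℂ[X]) * G₂ ^ (k + 2)) : ℂ[X]).eval x ^ 2 := by
      rw [ratDeriv, hWr]
      ring
    have hz1 : ((c₀ : ℂ[X]) * G₀ ^ 2 : ℂ[X]).eval x / (-((c₂ : ℂ[X]) * G₂ ^ (k + 2)) : ℂ[X]).eval x - 1
      = ((c₁ : ℂ[X]) * G₁ ^ 3 : ℂ[X]).eval x / ((c₂ : ℂ[X]) * G₂ ^ (k + 2) : ℂ[X]).eval x := by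
      rw [e1]
      simp only [eval_sub, eval_neg]
      field_simp
      ring
    have hW' : ((κ : ℂ[X]) * (G₀ * G₁ ^ 2 * G₂ ^ (k + 1))).eval x =
        κ / (c₀ * c₁ * c₂) / (G₀.eval x * G₁.eval x * G₂.eval x) *
        (((c₀ : ℂ[X]) * G₀ ^ 2).eval x * ((c₁ : ℂ[X]) * G₁ ^ 3).eval x *
          ((c₂ : ℂ[X]) * G₂ ^ (k + 2)).eval x) := by
      have g0 := hG h0
      have g1 := hG h1
      have g2 := hG h2
      simp only [eval_mul, eval_pow, eval_intCast]
      field_simp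
      ring
    have hk : (k : ℂ) + 2 ≠ 0 := by exact_mod_cast (Nat.succ_ne_zero (k + 1))
    -- The normalisation of `κ` turns the constant in `φ'²` into `(k+2)²`; after clearing
    -- denominators, the vanishing of the invariant is `schwarz_eq`.
    have hκc : ((κ : ℂ) / (c₀ * c₁ * c₂)) ^ 2 = (k + 2) ^ 2 := by
      have : (κ : ℂ) ^ 2 = ((k + 2) * (c₀ * c₁ * c₂)) ^ 2 := by exact_mod_cast h.sq_eq
      rw [div_pow, this]
      field_simp
    rw [h.ratPreDeriv_eq (hG h0) (hG h1) (hG h2) hg hWx, h.ratPre_eq (hG h0) (hG h1) (hG h2), hψ,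
      hypInvariant, hz1, hW']
    have hP : (c₀ : ℂ) * G₀.eval x ^ 2 = ((c₀ : ℂ[X]) * G₀ ^ 2).eval x := by simp
    have hQ : (c₁ : ℂ) * G₁.eval x ^ 3 = ((c₁ : ℂ[X]) * G₁ ^ 3).eval x := by simp
    have hR : (c₂ : ℂ) * G₂.eval x ^ (k + 2) = ((c₂ : ℂ[X]) * G₂ ^ (k + 2)).eval x := by simp
    have g0 := hG h0
    have g1 := hG h1
    have g2 := hG h2
    clear hW hWx hWe hψ hz1 key hWr e1 h1' hg hG hG' hW'
    simp only [eval_add, eval_zero, eval_neg] at hs ⊢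
    simp only [eval_add, eval_sub, eval_mul, eval_pow, eval_ofNat, eval_natCast,
      eval_intCast, eval_one] at hS
    generalize ((c₀ : ℂ[X]) * G₀ ^ 2).eval x = P at *
    generalize ((c₁ : ℂ[X]) * G₁ ^ 3).eval x = Q at *
    generalize ((c₂ : ℂ[X]) * G₂ ^ (k + 2)).eval x = R at *
    generalize (κ : ℂ) / (c₀ * c₁ * c₂) = s at *
    generalize G₀.eval x = y₀ at *
    generalize G₁.eval x = y₁ at *
    generalize G₂.eval x = y₂ at *
    generalize (derivative G₀).eval x = z₀ at *
    generalize (derivative G₁).eval x = z₁ at *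
    generalize (derivative G₂).eval x = z₂ at *
    generalize (derivative (derivative G₀)).eval x = w₀ at *
    generalize (derivative (derivative G₁)).eval x = w₁ at *
    generalize (derivative (derivative G₂)).eval x = w₂ at *
    have hS' : 72 * ((w₀ * y₀ - z₀ ^ 2) * (y₁ * y₂) ^ 2 + 2 * ((w₁ * y₁ - z₁ ^ 2) * (y₀ * y₂) ^ 2)
        - (k + 3) * ((w₂ * y₂ - z₂ ^ 2) * (y₀ * y₁) ^ 2))
        - 36 * (z₀ * (y₁ * y₂) + 2 * (z₁ * (y₀ * y₂)) - (k + 3) * (z₂ * (y₀ * y₁))) ^ 2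
        = (k + 2) ^ 2 * (27 * (Q * R) + 32 * (P * R)) + 36 * (((k + 2) ^ 2 - 1) * (P * Q)) := by
      rw [hS, ← hP, ← hQ, ← hR]
      ring
    have hI : (-(s / (y₀ * y₁ * y₂) * (P * Q * R)) / (-R) ^ 2) ^ 2 * (3 / 4 / (2 * (P / -R) ^ 2)
        + 8 / 9 / (2 * (Q / R) ^ 2)
        + (1 - 1 / ((k : ℂ) + 2) ^ 2 - 3 / 4 - 8 / 9) / (2 * (P / -R * (Q / R))))
        = s ^ 2 * (3 / 8 * Q ^ 2 + 4 / 9 * P ^ 2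
          + (3 / 4 + 8 / 9 - (1 - 1 / ((k : ℂ) + 2) ^ 2)) / 2 * (P * Q)) / (y₀ * y₁ * y₂) ^ 2 := by
      field_simp
      ring
    rw [hI, hκc]
    obtain rfl : R = -(P + Q) := by linear_combination hs
    clear hI hS hs hP hQ hR
    linear_combination (norm := skip) 1 / (72 * (y₀ * y₁ * y₂) ^ 2) * hS'
    field_simp
    ring

end IsPolyhedralSystem

end Polyhedra

/-! ### The tetrahedral, octahedral and icosahedral invariants -/

section PolyhedralExamples

/-- The invariants of the tetrahedral group. -/
theorem isPolyhedralSystem_tetrahedral : IsPolyhedralSystem 1 (-1) 1 (-64) 192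
    (X ^ 6 - 20 * X ^ 3 - 8) (X ^ 4 + 8 * X) (X ^ 3 - 1) where
  ne_zero := by decide
  sq_eq := by norm_num
  sum_eq_zero := by push_cast; ring
  wronskian_eq := by
    simp only [derivative_add, derivative_sub, derivative_mul, derivative_X_pow,
      derivative_ofNat, derivative_X, map_natCast]
    push_cast
    ring
  no_common_root x h0 h1 _ := by
    simp only [eval_add, eval_sub, eval_mul, eval_pow, eval_X, eval_ofNat] at h0 h1
    have : (1 : ℂ) = 0 := by
      -- The multipliers are the coefficients of a Bézout identity for two of the invariants, which
      -- rules out a common root.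
      linear_combination (-1 / 8 - 7 / 432 * x ^ 3) * h0 + (-71 / 216 * x ^ 2 + 7 / 432 * x ^ 5) * h1
    exact one_ne_zero this
  natDegree_pos := by
    have : (X ^ 3 - 1 : ℂ[X]).natDegree = 3 := by compute_degree!
    omega
  natDegree_lt := by
    have h2 : (X ^ 3 - 1 : ℂ[X]).natDegree = 3 := by compute_degree!
    have h0 : (X ^ 6 - 20 * X ^ 3 - 8 : ℂ[X]).natDegree = 6 := by compute_degree!
    omega
  schwarz_eq := by
    simp only [derivative_add, derivative_sub, derivative_mul, derivative_X_pow,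
      derivative_ofNat, derivative_one, derivative_natCast, derivative_zero,  derivative_X, map_natCast]
    push_cast
    ring

/-- The invariants of the octahedral group. -/
theorem isPolyhedralSystem_octahedral : IsPolyhedralSystem 2 (-1) 1 (-108) 432
    (X ^ 12 - 33 * X ^ 8 - 33 * X ^ 4 + 1) (X ^ 8 + 14 * X ^ 4 + 1) (X ^ 5 - X) where
  ne_zero := by decide
  sq_eq := by norm_num
  sum_eq_zero := by push_cast; ring
  wronskian_eq := by
    simp only [derivative_add, derivative_sub, derivative_mul, derivative_X_pow,
      derivative_ofNat, derivative_one, map_natCast]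
    push_cast
    ring
  no_common_root x h0 _ h2 := by
    simp only [eval_add, eval_sub, eval_mul, eval_pow, eval_X, eval_one, eval_ofNat] at h0 h2
    have : (1 : ℂ) = 0 := by
      linear_combination (1 - 65 / 64 * x ^ 4) * h0
        + (-2177 / 64 * x ^ 3 - 67 / 2 * x ^ 7 + 65 / 64 * x ^ 11) * h2
    exact one_ne_zero this
  natDegree_pos := by
    have : (X ^ 5 - X : ℂ[X]).natDegree = 5 := by compute_degree!
    omega
  natDegree_lt := by
    have h2 : (X ^ 5 - X : ℂ[X]).natDegree = 5 := by compute_degree!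
    have h0 : (X ^ 12 - 33 * X ^ 8 - 33 * X ^ 4 + 1 : ℂ[X]).natDegree = 12 := by compute_degree!
    omega
  schwarz_eq := by
    simp only [derivative_add, derivative_sub, derivative_mul, derivative_X_pow,
      derivative_ofNat, derivative_one, derivative_natCast, derivative_zero,  derivative_X, map_natCast]
    push_cast
    ring

/-- The invariants of the icosahedral group. -/
theorem isPolyhedralSystem_icosahedral : IsPolyhedralSystem 3 1 1 (-1728) (-8640)
    (X ^ 30 + 522 * X ^ 25 - 10005 * X ^ 20 - 10005 * X ^ 10 - 522 * X ^ 5 + 1)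
    (-X ^ 20 + 228 * X ^ 15 - 494 * X ^ 10 - 228 * X ^ 5 - 1) (X ^ 11 + 11 * X ^ 6 - X) where
  ne_zero := by decide
  sq_eq := by norm_num
  sum_eq_zero := by push_cast; ring
  wronskian_eq := by
    simp only [derivative_add, derivative_sub, derivative_neg, derivative_mul, derivative_X_pow,
      derivative_ofNat, derivative_one, map_natCast]
    push_cast
    ring
  no_common_root x _ h1 h2 := by
    simp only [eval_add, eval_sub, eval_mul, eval_pow, eval_X, eval_one, eval_ofNat, eval_neg]
      at h1 h2
    have : (1 : ℂ) = 0 := by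
      linear_combination (-1 + 33022 / 3125 * x ^ 5 + 3003 / 3125 * x ^ 10) * h1
        + (679478 / 3125 * x ^ 4 + 1485989 / 3125 * x ^ 9 - 136939 / 625 * x ^ 14
          + 3003 / 3125 * x ^ 19) * h2
    exact one_ne_zero this
  natDegree_pos := by
    have : (X ^ 11 + 11 * X ^ 6 - X : ℂ[X]).natDegree = 11 := by compute_degree!
    omega
  natDegree_lt := by
    have h2 : (X ^ 11 + 11 * X ^ 6 - X : ℂ[X]).natDegree = 11 := by compute_degree!
    have h0 : (X ^ 30 + 522 * X ^ 25 - 10005 * X ^ 20 - 10005 * X ^ 10 - 522 * X ^ 5 + 1 :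
      ℂ[X]).natDegree = 30 := by compute_degree!
    omega
  schwarz_eq := by
    simp only [derivative_add, derivative_sub, derivative_neg, derivative_mul, derivative_X_pow,
      derivative_ofNat, derivative_one, derivative_natCast, derivative_zero,  derivative_X, map_natCast]
    push_cast
    ring

end PolyhedralExamples

lemma exists_isKleinianCovering {m : ℕ} (hm : m = 3 ∨ m = 4 ∨ m = 5) : ∃ F₀ F₁ F₂ : ℂ[X],
    IsKleinianCovering (3 / 4) (8 / 9) (1 - 1 / (m : ℂ) ^ 2) F₀ F₁ F₂ := by
  have key : ∀ {k : ℕ} {c₀ c₁ c₂ κ : ℤ} {G₀ G₁ G₂ : ℂ[X]},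
      IsPolyhedralSystem k c₀ c₁ c₂ κ G₀ G₁ G₂ → m = k + 2 → ∃ F₀ F₁ F₂ : ℂ[X],
      IsKleinianCovering (3 / 4) (8 / 9) (1 - 1 / (m : ℂ) ^ 2) F₀ F₁ F₂ := by
    rintro k c₀ c₁ c₂ κ G₀ G₁ G₂ h rfl
    have e : ((k + 2 : ℕ) : ℂ) = k + 2 := by push_cast; ring
    rw [e]
    exact ⟨_, _, _, h.isKleinianCovering⟩
  rcases hm with rfl | rfl | rfl
  · exact key isPolyhedralSystem_tetrahedral rfl
  · exact key isPolyhedralSystem_octahedral rfl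
  · exact key isPolyhedralSystem_icosahedral rfl

lemma IsPolyhedralTriple.ne_zero {k₀ k₁ k₂ : ℕ} (h : IsPolyhedralTriple k₀ k₁ k₂) :
    k₀ ≠ 0 ∧ k₁ ≠ 0 ∧ k₂ ≠ 0 := by
  obtain ⟨m, hm, h⟩ := h
  omega

lemma IsPolyhedralTriple.exists_isKleinianCovering {k₀ k₁ k₂ : ℕ}
    (h : IsPolyhedralTriple k₀ k₁ k₂) {a₀ a₁ a₂ : ℂ} (h0 : (k₀ : ℂ) ^ 2 * (1 - a₀) = 1)
    (h1 : (k₁ : ℂ) ^ 2 * (1 - a₁) = 1) (h2 : (k₂ : ℂ) ^ 2 * (1 - a₂) = 1) :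
    ∃ F₀ F₁ F₂ : ℂ[X], IsKleinianCovering a₀ a₁ a₂ F₀ F₁ F₂ := by
  have e2 : ∀ {a : ℂ}, ((2 : ℕ) : ℂ) ^ 2 * (1 - a) = 1 → a = 3 / 4 := by
    intro a h
    push_cast at h
    linear_combination -h / 4
  have e3 : ∀ {a : ℂ}, ((3 : ℕ) : ℂ) ^ 2 * (1 - a) = 1 → a = 8 / 9 := by
    intro a h
    push_cast at h
    linear_combination -h / 9
  obtain ⟨m, hm, h⟩ := h
  obtain ⟨F₀, F₁, F₂, hF⟩ := HeunPullback.exists_isKleinianCovering hm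
  have em : ∀ {a : ℂ}, (m : ℂ) ^ 2 * (1 - a) = 1 → a = 1 - 1 / (m : ℂ) ^ 2 := by
    intro a h
    have hm0 : (m : ℂ) ≠ 0 := by rintro e; simp [e] at h
    field_simp
    linear_combination -h
  rcases h with ⟨rfl, rfl, rfl⟩ | ⟨rfl, rfl, rfl⟩ | ⟨rfl, rfl, rfl⟩ | ⟨rfl, rfl, rfl⟩ |
    ⟨rfl, rfl, rfl⟩ | ⟨rfl, rfl, rfl⟩
  · rw [e2 h0, e3 h1, em h2]
    exact ⟨_, _, _, hF⟩
  · rw [e2 h0, em h1, e3 h2]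
    exact ⟨_, _, _, hF.rotate.rotate.swap⟩
  · rw [e3 h0, e2 h1, em h2]
    exact ⟨_, _, _, hF.swap⟩
  · rw [e3 h0, em h1, e2 h2]
    exact ⟨_, _, _, hF.rotate⟩
  · rw [em h0, e2 h1, e3 h2]
    exact ⟨_, _, _, hF.rotate.rotate⟩
  · rw [em h0, e3 h1, e2 h2]
    exact ⟨_, _, _, hF.rotate.swap⟩

lemma exists_rat_of_sq {δ : ℂ} {k : ℕ} (hk : k ≠ 0) (h : (k : ℂ) ^ 2 * δ ^ 2 = 1) :
    ∃ r : ℚ, (r : ℂ) = δ := by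
  have hk' : (k : ℂ) ≠ 0 := by exact_mod_cast hk
  have h' : δ ^ 2 = (1 / k) ^ 2 := by field_simp; linear_combination h
  rcases sq_eq_sq_iff_eq_or_eq_neg.1 h' with h | h
  · exact ⟨1 / k, by rw [h]; push_cast; rfl⟩
  · exact ⟨-(1 / k), by rw [h]; push_cast; rfl⟩

end HeunPullback

/-! ### Assembly of the cases -/

theorem mainTheorem9
    (A B C : ℂ) (t q a b c d : ℂ) (ht0 : t ≠ 0) (ht1 : t ≠ 1)
    (φ : RatFunc ℂ) (hφ : ∀ k : ℂ, φ ≠ RatFunc.C k) (R : RadicalFunction)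
    (hpull : IsPullbackTransformation (hypergeometricEq A B C) (heunEq t q a b c d) φ R)
    (S : OnePoint ℂ) (hbranch : 2 ≤ branchingIndex φ S) (hS : projMap φ S ∉ sing) :
    {s : OnePoint ℂ | (hypergeometricEq A B C).IsRelevantSingularity s}.ncard = 2 ∨
    (∃ s₁ ∈ sing, ∃ s₂ ∈ sing, s₁ ≠ s₂ ∧
      (hypergeometricEq A B C).HasExponentDifference s₁ (1 / 2) ∧
      (hypergeometricEq A B C).HasExponentDifference s₂ (1 / 2)) ∨
    (∀ z₀ : ℂ, z₀ ≠ 0 → z₀ ≠ 1 → (hypergeometricEq A B C).HasAlgebraicBasisAt z₀) := by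
  have hW := wronskian_num_denom_ne_zero hφ
  have hWeq : wronskian φ.num (φ.denom - φ.num) = wronskian φ.num φ.denom := by
    simp only [wronskian, derivative_sub]; ring
  have hf0 : φ.num ≠ 0 := by rintro h; simp [h] at hW
  have hgf0 : φ.denom - φ.num ≠ 0 := by
    intro h
    rw [sub_eq_zero.1 h, wronskian_self_eq_zero] at hW
    exact hW rfl
  have hco : IsCoprime φ.num (φ.denom - φ.num) := by
    obtain ⟨u, v, h⟩ := RatFunc.isCoprime_num_denom φ
    exact ⟨u + v, v, by linear_combination h⟩
  have hreg := schwarzRegular_of_pullback hφ hpull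
  -- The three finite points where Heun's invariant may have poles; infinity, the fourth, is
  -- accounted for by counting only finite points.
  have hcard : ({0, 1, t} : Finset ℂ).card ≤ 3 := Finset.card_le_three
  have half : ∀ {s : OnePoint ℂ} {e₁ e₂ δ : ℂ}, (hypergeometricEq A B C).HasLocalExponents s e₁ e₂ →
      (e₁ - e₂) ^ 2 = δ ^ 2 → 2 ^ 2 * (1 - (1 - δ ^ 2)) = 1 →
      (hypergeometricEq A B C).HasExponentDifference s (1 / 2) := by
    intro s e₁ e₂ δ h h1 h2
    exact h.hasExponentDifference (by rw [h1]; linear_combination h2 / 4)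
  have half0 := half (δ := 1 - C) (hasLocalExponents_zero A B C) (by ring)
  have half1 := half (δ := C - A - B) (hasLocalExponents_one A B C) (by ring)
  have half2 := half (δ := A - B) (hasLocalExponents_infty A B C) rfl
  have s0 : ((0 : ℂ) : OnePoint ℂ) ∈ sing := by simp [sing]
  have s1 : ((1 : ℂ) : OnePoint ℂ) ∈ sing := by simp [sing]
  have s2 : ∞ ∈ sing := by simp [sing]
  have hreg' : SchwarzRegular (({0, 1, t} : Finset ℂ) : Set ℂ) (1 - (1 - C) ^ 2)
      (1 - (C - A - B) ^ 2) (1 - (A - B) ^ 2) φ.num (φ.denom - φ.num) (-φ.denom) := by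
    have e : (({0, 1, t} : Finset ℂ) : Set ℂ) = {0, 1, t} := by simp
    rw [e]
    exact hreg
  have hsum : φ.num + (φ.denom - φ.num) + -φ.denom = 0 := by ring
  rw [← hWeq] at hW
  have key := polyhedral_of_branching hcard hsum hco hW hf0 hgf0
    (neg_ne_zero.2 φ.denom_ne_zero) hreg' (wronskian_of_branching hφ hbranch hS)
  clear hreg hreg' hW hWeq hf0 hgf0 hco hsum hcard
  rcases key with (⟨h, h'⟩ | ⟨h, h'⟩ | ⟨h, h'⟩) | (⟨h, h'⟩ | ⟨h, h'⟩ | ⟨h, h'⟩) | ⟨k₀, k₁, k₂, hk, h0, h1, h2⟩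
  · exact (twoRelevantOrAlgebraic_zero (by linear_combination -h)
      (by linear_combination -h')).imp_right Or.inr
  · exact (twoRelevantOrAlgebraic_one (by linear_combination -h)
      (by linear_combination -h')).imp_right Or.inr
  · exact (twoRelevantOrAlgebraic_infty (by linear_combination -h)
      (by linear_combination -h')).imp_right Or.inr
  · exact Or.inr (Or.inl ⟨_, s0, _, s1, by simp, half0 h, half1 h'⟩)
  · exact Or.inr (Or.inl ⟨_, s0, _, s2, OnePoint.coe_ne_infty _, half0 h, half2 h'⟩)
  · exact Or.inr (Or.inl ⟨_, s1, _, s2, OnePoint.coe_ne_infty _, half1 h, half2 h'⟩)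
  · refine Or.inr (Or.inr fun z₀ hz0 hz1 => ?_)
    obtain ⟨F₀, F₁, F₂, hF⟩ := hk.exists_isKleinianCovering h0 h1 h2
    -- From `1 - C = r` and `C - A - B = u` one gets `C = 1 - r` and `A + B - C + 1 = 1 - u`, the
    -- rational residues that Klein's construction requires.
    obtain ⟨r, hr⟩ := exists_rat_of_sq hk.ne_zero.1 (δ := 1 - C) (by linear_combination h0)
    obtain ⟨u, hu⟩ := exists_rat_of_sq hk.ne_zero.2.1 (δ := C - A - B) (by linear_combination h1)
    exact hF.hasAlgebraicBasisAt (c := 1 - r) (d := 1 - u) (by push_cast; rw [hr]; ring)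
      (by push_cast; rw [hu]; ring) hz0 hz1
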